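/- **Setting.** Let $\mathcal D$ be the set of dyadic intervals $[i2^{-j},(i+1)2^{-j})\subset[0,1)$, put $h_I=\chi_{I^+}-\chi_{I^-}$ for $I\in\mathcal D$ ($I^+$, $I^-$ being the left and right half of $I$), $h_\varnothing=\chi_{[0,1)}$, $\mathcal D^+=\mathcal D\cup\{\varnothing\}$, and $H=\operatorname{span}_{\mathbb R}\{h_I: I\in\mathcal D^+\}$. A *Haar system space* $X$ is the completion of $H$ under a norm $\|\cdot\|_X$ such that $\|f\|_X=\|g\|_X$ whenever $|f|$ and $|g|$ have the same distribution, and $\|\chi_{[0,1)}\|_X=1$. Let $r_n=\sum_{|I|=2^{-n}}h_I$ be the Rademacher functions, and let $\mathbf r=(r_I)_{I\in\mathcal D^+}$ be either $(r_{\iota(I)})_{I\in\mathcal D^+}$, where $\iota(\varnothing)=0$ and $\iota([i2^{-j},(i+1)2^{-j}))=2^j+i$, or the constant family $(r_0)_{I\in\mathcal D^+}$. The *Haar system Hardy space* $Y=X_0(\mathbf r)$ is the closure of $\operatorname{span}\{h_I:I\in\mathcal D\}$ in the completion of $H$ under $$\Big\|\sum_{I\in\mathcal D^+} a_Ih_I\Big\|_{X(\mathbf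 r)}=\Big\|s\mapsto\int_0^1\Big|\sum_{I\in\mathcal D^+} r_I(u)a_Ih_I(s)\Big|\,du\Big\|_X .$$ For $n\in\mathbb N_0$ let $Y_n=\operatorname{span}\{h_I: I\in\mathcal D,\ |I|\ge 2^{-n}\}\subset Y$. The Haar system is *$K$-unconditional in $Y$* if $\|\sum_I\theta_Ia_Ih_I\|_Y\le K\|\sum_I a_Ih_I\|_Y$ for all finitely supported real families $(a_I)_{I\in\mathcal D}$ and all signs $\theta_I=\pm1$. An operator $T\colon Y_N\to Y_N$ has *$\delta$-large positive diagonal* if $\int_0^1 h_I\cdot Th_I\ge\delta|I|$ for all $I\in\mathcal D$ with $|I|\ge 2^{-N}$. An operator $S\colon E\to E$ *projectionally factors through $T\colon F\to F$ with constant $C$ and error $\rho$* if there are bounded linear operators $B\colon E\to F$ and $A\colon F\to E$ with $\|A\|\|B\|\le C$, $\|S-ATB\|\le\rho$ and $AB=I_E$. **Proposition 4.1.** Let $Y$ be a Haar system Hardy space, let $\Gamma,\delta,\eta>0$, and let $n,N\in\mathbb N_0$ with $n\le N$ be such that $$N\ \ge\ 42\,n(n+1)\Big\lceil\frac{\Gamma}{\eta\delta}\Big\rceil+42+\Big\lfloor4\log_2\Big(\frac{\Gamma}{\eta\delta}\Big)\Big\rfloor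 .$$ Then for every linear operator $T\colon Y_N\to Y_N$ with $\|T\|\le\Gamma$ there exists a scalar $c$ with $|c|\le\|T\|$ such that $c\,I_{Y_n}$ projectionally factors through $T$ with constant $1$ and error $3\eta\delta$, and such that moreover $c\ge(1-\eta)\delta$ if $T$ has $\delta$-large positive diagonal. If the Haar system is $K$-unconditional in $Y$ for some $K\ge1$, then the displayed inequality can be replaced by $$N\ \ge\ 42\,n\Big\lceil\frac{K\Gamma}{\eta\delta}\Big\rceil+42+\Big\lfloor4\log_2\Big(\frac{\Gamma}{\eta\delta}\Big)\Big\rfloor .$$ -/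

import Mathlib

open MeasureTheory

/-- The dyadic intervals of `[0,1)`: the pair `⟨j, i⟩` with `i < 2 ^ j` stands for
`[i / 2^j, (i + 1) / 2^j)`. -/
abbrev DyadicInterval : Type := (j : ℕ) × Fin (2 ^ j)

namespace DyadicInterval

/-- The level `j` of a dyadic interval `I`, so that `|I| = 2^{-j}`. -/
def level (I : DyadicInterval) : ℕ := I.1

/-- The half-open interval that the index stands for. -/
def toSet (I : DyadicInterval) : Set ℝ :=
  Set.Ico (((I.2 : ℕ) : ℝ) / 2 ^ I.1) ((((I.2 : ℕ) : ℝ) + 1) / 2 ^ I.1)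

/-- The length `|I| = 2^{-j}`. -/
noncomputable def length (I : DyadicInterval) : ℝ := 1 / 2 ^ I.level

/-- The left half `I⁺`. -/
def left (I : DyadicInterval) : DyadicInterval :=
  ⟨I.1 + 1, ⟨2 * (I.2 : ℕ), by have := I.2.2; rw [pow_succ]; omega⟩⟩

/-- The right half `I⁻`. -/
def right (I : DyadicInterval) : DyadicInterval :=
  ⟨I.1 + 1, ⟨2 * (I.2 : ℕ) + 1, by have := I.2.2; rw [pow_succ]; omega⟩⟩

/-- The Haar function `h_I = χ_{I⁺} - χ_{I⁻}`. -/
noncomputable def haar (I : DyadicInterval) (s : ℝ) : ℝ :=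
  I.left.toSet.indicator 1 s - I.right.toSet.indicator 1 s

end DyadicInterval

/-- The Haar system indexed by `𝒟⁺ = 𝒟 ∪ {∅}`; the index `none` plays the role of `∅`, and
`h_∅ = χ_{[0,1)}`. -/
noncomputable def haarPlus : Option DyadicInterval → ℝ → ℝ
  | none => (Set.Ico (0 : ℝ) 1).indicator 1
  | some I => I.haar

/-- The enumeration `ι` of `𝒟⁺`: `ι(∅) = 0` and `ι([i/2^j, (i+1)/2^j)) = 2^j + i`. -/
def haarIndex : Option DyadicInterval → ℕ
  | none => 0
  | some I => 2 ^ I.1 + (I.2 : ℕ)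

/-- The standard Rademacher function `r_n`, the sum of all `h_I` with `|I| = 2^{-n}`. -/
noncomputable def rademacher (n : ℕ) (u : ℝ) : ℝ :=
  ∑ i : Fin (2 ^ n), DyadicInterval.haar ⟨n, i⟩ u

/-- The two admissible families `(r_I)_{I ∈ 𝒟⁺}`: `r_I = r_{ι(I)}` (independent) or `r_I = r_0`
(constant). -/
inductive RademacherChoice : Type
  | independent
  | constant

/-- The member `r_I` of the chosen family. -/
noncomputable def RademacherChoice.fn (r : RademacherChoice) (I : Option DyadicInterval) :
    ℝ → ℝ :=
  match r with
  | .independent => rademacher (haarIndex I)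
  | .constant => rademacher 0

/-- The space `H`, the linear span of the Haar system `(h_I)_{I ∈ 𝒟⁺}`, as a space of functions
(they vanish outside `[0,1)`). -/
noncomputable def haarSpan : Submodule ℝ (ℝ → ℝ) := Submodule.span ℝ (Set.range haarPlus)

theorem haarPlus_mem (I : Option DyadicInterval) : haarPlus I ∈ haarSpan :=
  Submodule.subset_span ⟨I, rfl⟩

/-- The Haar function `h_I`, `I ∈ 𝒟⁺`, as an element of `H`. -/
noncomputable def haarVec (I : Option DyadicInterval) : haarSpan := ⟨haarPlus I, haarPlus_mem I⟩

/-- A Haar system space `X`, given by its norm on `H`: a norm such that `‖f‖ = ‖g‖` whenever `|f|`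
and `|g|` have the same distribution (with respect to Lebesgue measure on `[0,1)`), and
`‖χ_{[0,1)}‖ = 1`. The space `X` itself is the completion of `H` under this norm. -/
structure HaarSystemSpace where
  norm : Seminorm ℝ haarSpan
  eq_zero_of_norm : ∀ f : haarSpan, norm f = 0 → f = 0
  norm_eq_of_distribution : ∀ f g : haarSpan,
    (volume.restrict (Set.Ico (0 : ℝ) 1)).map (fun s => |(f : ℝ → ℝ) s|) =
      (volume.restrict (Set.Ico (0 : ℝ) 1)).map (fun s => |(g : ℝ → ℝ) s|) →
    norm f = norm g
  norm_one : norm (haarVec none) = 1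

/-! Auxiliary facts: elements of `H` are exactly the dyadic step functions, and the Haar system is
linearly independent. -/

section Aux

/-- `f` vanishes outside `[0,1)` and is constant on every dyadic interval of level `J`. -/
def IsDyadicStep (J : ℕ) (f : ℝ → ℝ) : Prop :=
  (∀ s, s ∉ Set.Ico (0 : ℝ) 1 → f s = 0) ∧
    ∀ s ∈ Set.Ico (0 : ℝ) 1, ∀ t ∈ Set.Ico (0 : ℝ) 1,
      ⌊s * 2 ^ J⌋₊ = ⌊t * 2 ^ J⌋₊ → f s = f t

theorem floor_eq_of_le {J J' : ℕ} (h : J ≤ J') {s t : ℝ} (hst : ⌊s * 2 ^ J'⌋₊ = ⌊t * 2 ^ J'⌋₊) :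
    ⌊s * 2 ^ J⌋₊ = ⌊t * 2 ^ J⌋₊ := by
  obtain ⟨d, rfl⟩ := Nat.exists_eq_add_of_le h
  have key : ∀ x : ℝ, ⌊x * 2 ^ J⌋₊ = ⌊x * 2 ^ (J + d)⌋₊ / 2 ^ d := by
    intro x
    have h1 := Nat.floor_div_natCast (x * 2 ^ (J + d)) (2 ^ d)
    rw [← h1]
    congr 1
    push_cast
    rw [pow_add]
    field_simp
  rw [key, key, hst]

theorem IsDyadicStep.mono {J J' : ℕ} (h : J ≤ J') {f : ℝ → ℝ} (hf : IsDyadicStep J f) :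
    IsDyadicStep J' f :=
  ⟨hf.1, fun s hs t ht hst => hf.2 s hs t ht (floor_eq_of_le h hst)⟩

theorem DyadicInterval.mem_toSet_iff (I : DyadicInterval) {s : ℝ} (hs : 0 ≤ s) :
    s ∈ I.toSet ↔ ⌊s * 2 ^ I.1⌋₊ = (I.2 : ℕ) := by
  have hp : (0 : ℝ) < 2 ^ I.1 := by positivity
  rw [Nat.floor_eq_iff (by positivity), DyadicInterval.toSet, Set.mem_Ico, div_le_iff₀ hp,
    lt_div_iff₀ hp]

theorem DyadicInterval.toSet_subset (I : DyadicInterval) : I.toSet ⊆ Set.Ico (0 : ℝ) 1 := by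
  intro s hs
  have hp : (0 : ℝ) < 2 ^ I.1 := by positivity
  refine ⟨le_trans (by positivity) hs.1, lt_of_lt_of_le hs.2 ?_⟩
  rw [div_le_one hp]
  exact_mod_cast I.2.2

theorem isDyadicStep_indicator (I : DyadicInterval) :
    IsDyadicStep I.1 (I.toSet.indicator 1) := by
  refine ⟨fun s hs => Set.indicator_of_notMem (fun h => hs (I.toSet_subset h)) _, ?_⟩
  intro s hs t ht hst
  have : s ∈ I.toSet ↔ t ∈ I.toSet := by
    rw [I.mem_toSet_iff hs.1, I.mem_toSet_iff ht.1, hst]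
  by_cases h : s ∈ I.toSet
  · rw [Set.indicator_of_mem h, Set.indicator_of_mem (this.1 h)]; rfl
  · rw [Set.indicator_of_notMem h, Set.indicator_of_notMem (fun h' => h (this.2 h'))]

/-- A level beyond which `h_I` is a step function. -/
def haarDepth : Option DyadicInterval → ℕ
  | none => 0
  | some I => I.1 + 1

theorem isDyadicStep_haarPlus (I : Option DyadicInterval) :
    IsDyadicStep (haarDepth I) (haarPlus I) := by
  cases I with
  | none =>
    refine ⟨fun s hs => Set.indicator_of_notMem hs _, fun s hs t ht _ => ?_⟩
    simp only [haarPlus]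
    rw [Set.indicator_of_mem hs, Set.indicator_of_mem ht]; rfl
  | some I =>
    have h1 := isDyadicStep_indicator I.left
    have h2 := isDyadicStep_indicator I.right
    refine ⟨fun s hs => ?_, fun s hs t ht hst => ?_⟩
    · simp only [haarPlus, DyadicInterval.haar]
      rw [h1.1 s hs, h2.1 s hs, sub_zero]
    · simp only [haarPlus, DyadicInterval.haar]
      rw [h1.2 s hs t ht hst, h2.2 s hs t ht hst]

theorem exists_isDyadicStep {f : ℝ → ℝ} (hf : f ∈ haarSpan) : ∃ J, IsDyadicStep J f := by
  induction hf using Submodule.span_induction with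
  | mem x h =>
    obtain ⟨I, rfl⟩ := h
    exact ⟨_, isDyadicStep_haarPlus I⟩
  | zero => exact ⟨0, fun _ _ => rfl, fun _ _ _ _ _ => rfl⟩
  | add x y _ _ hx hy =>
    obtain ⟨J, hJ⟩ := hx
    obtain ⟨J', hJ'⟩ := hy
    have h1 := hJ.mono (le_max_left J J')
    have h2 := hJ'.mono (le_max_right J J')
    refine ⟨max J J', fun s hs => ?_, fun s hs t ht hst => ?_⟩
    · rw [Pi.add_apply, h1.1 s hs, h2.1 s hs, add_zero]
    · rw [Pi.add_apply, Pi.add_apply, h1.2 s hs t ht hst, h2.2 s hs t ht hst]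
  | smul a x _ hx =>
    obtain ⟨J, hJ⟩ := hx
    refine ⟨J, fun s hs => ?_, fun s hs t ht hst => ?_⟩
    · rw [Pi.smul_apply, hJ.1 s hs, smul_zero]
    · rw [Pi.smul_apply, Pi.smul_apply, hJ.2 s hs t ht hst]

theorem DyadicInterval.indicator_add (I : DyadicInterval) :
    (I.left.toSet.indicator 1 + I.right.toSet.indicator 1 : ℝ → ℝ) = I.toSet.indicator 1 := by
  funext s
  by_cases hs : s ∈ Set.Ico (0 : ℝ) 1
  · have h0 : ⌊s * 2 ^ I.1⌋₊ = ⌊s * 2 ^ (I.1 + 1)⌋₊ / 2 := by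
      have h1 := Nat.floor_div_natCast (s * 2 ^ (I.1 + 1)) 2
      rw [← h1]
      congr 1
      rw [pow_succ]
      push_cast
      field_simp
    have hl : s ∈ I.left.toSet ↔ ⌊s * 2 ^ (I.1 + 1)⌋₊ = 2 * (I.2 : ℕ) :=
      I.left.mem_toSet_iff hs.1
    have hr : s ∈ I.right.toSet ↔ ⌊s * 2 ^ (I.1 + 1)⌋₊ = 2 * (I.2 : ℕ) + 1 :=
      I.right.mem_toSet_iff hs.1
    have hi := I.mem_toSet_iff hs.1
    rw [h0] at hi
    classical
    simp only [Pi.add_apply, Set.indicator_apply, hl, hr, hi, Pi.one_apply]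
    split_ifs <;> first | omega | norm_num
  · have h : ∀ K : DyadicInterval, K.toSet.indicator (1 : ℝ → ℝ) s = 0 := fun K =>
      Set.indicator_of_notMem (fun h => hs (K.toSet_subset h)) _
    rw [Pi.add_apply, h, h, h, add_zero]

theorem DyadicInterval.indicator_mem_haarSpan :
    ∀ (J : ℕ) (i : Fin (2 ^ J)),
      (DyadicInterval.toSet ⟨J, i⟩).indicator (1 : ℝ → ℝ) ∈ haarSpan := by
  intro J
  induction J with
  | zero =>
    intro i
    have : (DyadicInterval.toSet ⟨0, i⟩).indicator (1 : ℝ → ℝ) = haarPlus none := by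
      simp [haarPlus, DyadicInterval.toSet]
    rw [this]
    exact haarPlus_mem none
  | succ J ih =>
    intro i
    have hi : (i : ℕ) < 2 ^ J * 2 := by rw [← pow_succ]; exact i.2
    set I : DyadicInterval := ⟨J, ⟨(i : ℕ) / 2, by omega⟩⟩ with hI
    have hadd := I.indicator_add
    have hm := ih ⟨(i : ℕ) / 2, by omega⟩
    have hh : I.haar ∈ haarSpan := haarPlus_mem (some I)
    have hhe : I.haar = I.left.toSet.indicator 1 - I.right.toSet.indicator 1 := rfl
    rcases Nat.mod_two_eq_zero_or_one (i : ℕ) with h | h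
    · have he : (⟨J + 1, i⟩ : DyadicInterval) = I.left := by
        have hv : i = ⟨2 * ((i : ℕ) / 2), by have := i.2; omega⟩ := Fin.ext (by simp only; omega)
        exact congrArg (Sigma.mk (J + 1)) hv
      have : I.left.toSet.indicator (1 : ℝ → ℝ) =
          (1 / 2 : ℝ) • (I.toSet.indicator 1 + I.haar) := by
        rw [← hadd, hhe]; funext s; simp; ring
      rw [he, this]
      exact haarSpan.smul_mem _ (haarSpan.add_mem hm hh)
    · have he : (⟨J + 1, i⟩ : DyadicInterval) = I.right := by
        have hv : i = ⟨2 * ((i : ℕ) / 2) + 1, by have := i.2; omega⟩ :=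
          Fin.ext (by simp only; omega)
        exact congrArg (Sigma.mk (J + 1)) hv
      have : I.right.toSet.indicator (1 : ℝ → ℝ) =
          (1 / 2 : ℝ) • (I.toSet.indicator 1 - I.haar) := by
        rw [← hadd, hhe]; funext s; simp; ring
      rw [he, this]
      exact haarSpan.smul_mem _ (haarSpan.sub_mem hm hh)

theorem IsDyadicStep.mem_haarSpan {J : ℕ} {f : ℝ → ℝ} (hf : IsDyadicStep J f) :
    f ∈ haarSpan := by
  have hp : (0 : ℝ) < 2 ^ J := by positivity
  have hpt : ∀ i : Fin (2 ^ J), ((i : ℕ) : ℝ) / 2 ^ J ∈ Set.Ico (0 : ℝ) 1 := by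
    intro i
    refine ⟨by positivity, ?_⟩
    rw [div_lt_one hp]
    exact_mod_cast i.2
  have : f = ∑ i : Fin (2 ^ J), f (((i : ℕ) : ℝ) / 2 ^ J) •
      (DyadicInterval.toSet ⟨J, i⟩).indicator (1 : ℝ → ℝ) := by
    funext s
    rw [Finset.sum_apply]
    by_cases hs : s ∈ Set.Ico (0 : ℝ) 1
    · have hlt : ⌊s * 2 ^ J⌋₊ < 2 ^ J := by
        rw [Nat.floor_lt (mul_nonneg hs.1 hp.le)]
        push_cast
        nlinarith [hs.2]
      rw [Finset.sum_eq_single (⟨⌊s * 2 ^ J⌋₊, hlt⟩ : Fin (2 ^ J))]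
      · rw [Pi.smul_apply, Set.indicator_of_mem
          ((DyadicInterval.mem_toSet_iff ⟨J, ⟨⌊s * 2 ^ J⌋₊, hlt⟩⟩ hs.1).2 rfl)]
        simp only [Pi.one_apply, smul_eq_mul, mul_one]
        refine hf.2 s hs _ (hpt ⟨⌊s * 2 ^ J⌋₊, hlt⟩) ?_
        rw [div_mul_cancel₀ _ hp.ne', Nat.floor_natCast]
      · intro i _ hi
        rw [Pi.smul_apply, Set.indicator_of_notMem, smul_zero]
        intro h
        rw [DyadicInterval.mem_toSet_iff _ hs.1] at h
        exact hi (Fin.ext h.symm)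
      · intro h
        exact absurd (Finset.mem_univ _) h
    · rw [hf.1 s hs, Finset.sum_eq_zero]
      intro i _
      rw [Pi.smul_apply, Set.indicator_of_notMem, smul_zero]
      exact fun h => hs (DyadicInterval.toSet_subset _ h)
  rw [this]
  exact haarSpan.sum_mem fun i _ =>
    haarSpan.smul_mem _ (DyadicInterval.indicator_mem_haarSpan J i)

theorem DyadicInterval.haar_sub_self (I : DyadicInterval) :
    I.haar (((2 * (I.2 : ℕ) : ℕ) : ℝ) / 2 ^ (I.1 + 1)) -
      I.haar (((2 * (I.2 : ℕ) + 1 : ℕ) : ℝ) / 2 ^ (I.1 + 1)) = 2 := by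
  have hp : (0 : ℝ) < 2 ^ (I.1 + 1) := by positivity
  have hl : ∀ m : ℕ, ((m : ℝ) / 2 ^ (I.1 + 1)) ∈ I.left.toSet ↔ m = 2 * (I.2 : ℕ) := by
    intro m
    rw [I.left.mem_toSet_iff (by positivity)]
    have : ((m : ℝ) / 2 ^ (I.1 + 1)) * 2 ^ I.left.1 = m := div_mul_cancel₀ _ hp.ne'
    rw [this, Nat.floor_natCast]
    rfl
  have hr : ∀ m : ℕ, ((m : ℝ) / 2 ^ (I.1 + 1)) ∈ I.right.toSet ↔ m = 2 * (I.2 : ℕ) + 1 := by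
    intro m
    rw [I.right.mem_toSet_iff (by positivity)]
    have : ((m : ℝ) / 2 ^ (I.1 + 1)) * 2 ^ I.right.1 = m := div_mul_cancel₀ _ hp.ne'
    rw [this, Nat.floor_natCast]
    rfl
  simp only [DyadicInterval.haar]
  rw [Set.indicator_of_mem ((hl _).2 rfl), Set.indicator_of_mem ((hr _).2 rfl),
    Set.indicator_of_notMem (fun h => by have := (hr _).1 h; omega),
    Set.indicator_of_notMem (fun h => by have := (hl _).1 h; omega)]
  norm_num

theorem linearIndependent_haarPlus : LinearIndependent ℝ haarPlus := by
  rw [linearIndependent_iff]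
  intro l hl
  by_contra hne
  have hsupp : l.support.Nonempty := Finsupp.support_nonempty_iff.2 hne
  obtain ⟨I₀, hI₀, hmax⟩ := Finset.exists_max_image l.support haarDepth hsupp
  have hval : ∀ s : ℝ, ∑ K ∈ l.support, l K * haarPlus K s = 0 := by
    intro s
    have := congrFun hl s
    rw [Finsupp.linearCombination_apply, Finsupp.sum, Finset.sum_apply] at this
    simpa using this
  apply (Finsupp.mem_support_iff.1 hI₀)
  cases I₀ with
  | none =>
    have h0 := hval 0
    rw [Finset.sum_eq_single none] at h0
    · simpa [haarPlus] using h0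
    · intro K hK hKn
      cases K with
      | none => exact absurd rfl hKn
      | some K =>
        have := hmax _ hK
        simp [haarDepth] at this
    · intro h
      exact absurd hI₀ h
  | some I =>
    have hs := hval (((2 * (I.2 : ℕ) : ℕ) : ℝ) / 2 ^ (I.1 + 1))
    have ht := hval (((2 * (I.2 : ℕ) + 1 : ℕ) : ℝ) / 2 ^ (I.1 + 1))
    have hp : (0 : ℝ) < 2 ^ (I.1 + 1) := by positivity
    have hpt : ∀ m : ℕ, m < 2 ^ (I.1 + 1) →
        ((m : ℝ) / 2 ^ (I.1 + 1)) ∈ Set.Ico (0 : ℝ) 1 := by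
      intro m hm
      refine ⟨by positivity, ?_⟩
      rw [div_lt_one hp]
      exact_mod_cast hm
    have hm1 : 2 * (I.2 : ℕ) + 1 < 2 ^ (I.1 + 1) := by
      have := I.2.2; rw [pow_succ]; omega
    have hfl : ∀ m : ℕ, ⌊((m : ℝ) / 2 ^ (I.1 + 1)) * 2 ^ I.1⌋₊ = m / 2 := by
      intro m
      have : ((m : ℝ) / 2 ^ (I.1 + 1)) * 2 ^ I.1 = (m : ℝ) / ((2 : ℕ) : ℝ) := by
        rw [pow_succ]; push_cast; field_simp
      rw [this, Nat.floor_div_natCast, Nat.floor_natCast]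
    have hsub : ∑ K ∈ l.support, l K *
        (haarPlus K (((2 * (I.2 : ℕ) : ℕ) : ℝ) / 2 ^ (I.1 + 1)) -
          haarPlus K (((2 * (I.2 : ℕ) + 1 : ℕ) : ℝ) / 2 ^ (I.1 + 1))) = 0 := by
      simp only [mul_sub, Finset.sum_sub_distrib]
      rw [hs, ht, sub_zero]
    rw [Finset.sum_eq_single (some I)] at hsub
    · have h2 := I.haar_sub_self
      simp only [haarPlus] at hsub
      rw [h2] at hsub
      linarith
    · intro K hK hKI
      have hd := hmax _ hK
      have hzero : haarPlus K (((2 * (I.2 : ℕ) : ℕ) : ℝ) / 2 ^ (I.1 + 1)) =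
          haarPlus K (((2 * (I.2 : ℕ) + 1 : ℕ) : ℝ) / 2 ^ (I.1 + 1)) := by
        by_cases hlt : haarDepth K ≤ I.1
        · refine ((isDyadicStep_haarPlus K).mono hlt).2 _ (hpt _ (by omega)) _ (hpt _ hm1) ?_
          rw [hfl, hfl]
          omega
        · cases K with
          | none => simp [haarDepth] at hlt
          | some K =>
            simp only [haarDepth] at hd hlt
            obtain ⟨k, i'⟩ := K
            obtain ⟨j, i⟩ := I
            have hkj : k = j := by simp only at hd hlt; omega
            subst hkj
            have hii : (i' : ℕ) ≠ (i : ℕ) := fun h => hKI (by rw [Fin.ext h])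
            have hz : ∀ m : ℕ, m / 2 = (i : ℕ) →
                haarPlus (some ⟨k, i'⟩) ((m : ℝ) / 2 ^ (k + 1)) = 0 := by
              intro m hm
              have hq : ((m : ℝ) / 2 ^ (k + 1)) * 2 ^ (k + 1) = m := div_mul_cancel₀ _ hp.ne'
              simp only [haarPlus, DyadicInterval.haar]
              rw [Set.indicator_of_notMem, Set.indicator_of_notMem, sub_zero]
              · intro h
                rw [DyadicInterval.mem_toSet_iff _ (by positivity)] at h
                simp only [DyadicInterval.right] at h
                rw [hq, Nat.floor_natCast] at h
                omega
              · intro h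
                rw [DyadicInterval.mem_toSet_iff _ (by positivity)] at h
                simp only [DyadicInterval.left] at h
                rw [hq, Nat.floor_natCast] at h
                omega
            simp only
            rw [hz _ (by omega), hz _ (by omega)]
      rw [hzero, sub_self, mul_zero]
    · intro h
      exact absurd hI₀ h

end Aux

/-- The Haar system `(h_I)_{I ∈ 𝒟⁺}` as an algebraic basis of `H`. -/
noncomputable def haarBasis : Module.Basis (Option DyadicInterval) ℝ haarSpan :=
  Module.Basis.span linearIndependent_haarPlus

theorem haarBasis_apply (I : Option DyadicInterval) : haarBasis I = haarVec I :=
  Module.Basis.span_apply linearIndependent_haarPlus I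

/-- For `f = ∑ a_I h_I` in `H`, the function `∑ r_I(u) a_I h_I(s)` of `u` and `s`. -/
noncomputable def randomSum (r : RademacherChoice) (f : haarSpan) (u s : ℝ) : ℝ :=
  (haarBasis.repr f).sum fun I a => r.fn I u * a * haarPlus I s

/-- For `f = ∑ a_I h_I` in `H`, the function `s ↦ ∫₀¹ |∑ r_I(u) a_I h_I(s)| du`. -/
noncomputable def randomAverage (r : RademacherChoice) (f : haarSpan) (s : ℝ) : ℝ :=
  ∫ u in Set.Ico (0 : ℝ) 1, |randomSum r f u s|

section Aux

theorem randomSum_add (r : RademacherChoice) (f g : haarSpan) (u s : ℝ) :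
    randomSum r (f + g) u s = randomSum r f u s + randomSum r g u s := by
  unfold randomSum
  rw [map_add]
  exact Finsupp.sum_add_index' (fun _ => by ring) (fun _ _ _ => by ring)

theorem randomSum_smul (r : RademacherChoice) (c : ℝ) (f : haarSpan) (u s : ℝ) :
    randomSum r (c • f) u s = c * randomSum r f u s := by
  unfold randomSum
  rw [map_smul, Finsupp.sum_smul_index' (fun _ => by ring), Finsupp.sum, Finsupp.sum,
    Finset.mul_sum]
  exact Finset.sum_congr rfl fun _ _ => by rw [smul_eq_mul]; ring

theorem integrable_rademacher (n : ℕ) :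
    Integrable (rademacher n) (volume.restrict (Set.Ico (0 : ℝ) 1)) := by
  unfold rademacher
  refine integrable_finsetSum _ fun i _ => ?_
  have h : ∀ K : DyadicInterval, Integrable (K.toSet.indicator (1 : ℝ → ℝ))
      (volume.restrict (Set.Ico (0 : ℝ) 1)) := fun K =>
    (integrable_const (1 : ℝ)).indicator measurableSet_Ico
  exact (h _).sub (h _)

theorem integrable_randomSum (r : RademacherChoice) (f : haarSpan) (s : ℝ) :
    Integrable (fun u => randomSum r f u s) (volume.restrict (Set.Ico (0 : ℝ) 1)) := by
  unfold randomSum Finsupp.sum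
  refine integrable_finsetSum _ fun I _ => ?_
  refine Integrable.mul_const (Integrable.mul_const ?_ _) _
  cases r <;> exact integrable_rademacher _

theorem randomAverage_mem (r : RademacherChoice) (f : haarSpan) :
    randomAverage r f ∈ haarSpan := by
  have hstep : ∀ K ∈ (haarBasis.repr f).support,
      IsDyadicStep ((haarBasis.repr f).support.sup haarDepth) (haarPlus K) := fun K hK =>
    (isDyadicStep_haarPlus K).mono (Finset.le_sup hK)
  refine IsDyadicStep.mem_haarSpan (J := (haarBasis.repr f).support.sup haarDepth)
    ⟨fun s hs => ?_, fun s hs t ht hst => ?_⟩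
  · have : ∀ u, randomSum r f u s = 0 := fun u =>
      Finset.sum_eq_zero fun K hK => by simp only [(hstep K hK).1 s hs, mul_zero]
    simp [randomAverage, this]
  · have : ∀ u, randomSum r f u s = randomSum r f u t := fun u =>
      Finset.sum_congr rfl fun K hK => by simp only [(hstep K hK).2 s hs t ht hst]
    simp [randomAverage, this]

end Aux

namespace HaarSystemSpace

/-- The norm of the Haar system Hardy space `X(𝐫)` on `H`:
`‖∑ a_I h_I‖ = ‖ s ↦ ∫₀¹ |∑ r_I(u) a_I h_I(s)| du ‖_X`. -/
noncomputable def hardyNorm (X : HaarSystemSpace) (r : RademacherChoice) (f : haarSpan) : ℝ :=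
  X.norm ⟨randomAverage r f, randomAverage_mem r f⟩

section Aux

variable (X : HaarSystemSpace)

/-- Changing the value on a single dyadic interval to one of smaller modulus does not increase the
norm. -/
theorem norm_update_le (J i : ℕ) (g k : haarSpan) (t : ℝ) (ht : |t| ≤ 1)
    (h1 : ∀ s, ⌊s * 2 ^ J⌋₊ = i → (k : ℝ → ℝ) s = t * (g : ℝ → ℝ) s)
    (h2 : ∀ s, ⌊s * 2 ^ J⌋₊ ≠ i → (k : ℝ → ℝ) s = (g : ℝ → ℝ) s) :
    X.norm k ≤ X.norm g := by
  classical
  obtain ⟨J', hJ'⟩ := exists_isDyadicStep g.2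
  have hstep : IsDyadicStep (max J J')
      (fun s => if ⌊s * 2 ^ J⌋₊ = i then -(g : ℝ → ℝ) s else (g : ℝ → ℝ) s) := by
    refine ⟨fun s hs => ?_, fun s hs u hu hsu => ?_⟩
    · simp [hJ'.1 s hs]
    · simp only [floor_eq_of_le (le_max_left J J') hsu,
        (hJ'.mono (le_max_right J J')).2 s hs u hu hsu]
  set w : haarSpan := ⟨_, hstep.mem_haarSpan⟩ with hw
  have hwg : X.norm w = X.norm g := by
    apply X.norm_eq_of_distribution
    congr 1
    funext s
    simp only [hw]
    split_ifs <;> simp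
  have hk : k = ((1 + t) / 2) • g + ((1 - t) / 2) • w := by
    apply Subtype.ext
    funext s
    simp only [hw, Submodule.coe_add, Submodule.coe_smul, Pi.add_apply, Pi.smul_apply, smul_eq_mul]
    by_cases hs : ⌊s * 2 ^ J⌋₊ = i
    · rw [h1 s hs, if_pos hs]; ring
    · rw [h2 s hs, if_neg hs]; ring
  have := abs_le.1 ht
  calc X.norm k ≤ X.norm (((1 + t) / 2) • g) + X.norm (((1 - t) / 2) • w) := by
        rw [hk]; exact map_add_le_add _ _ _
    _ = (1 + t) / 2 * X.norm g + (1 - t) / 2 * X.norm g := by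
        rw [map_smul_eq_mul, map_smul_eq_mul, hwg, Real.norm_of_nonneg (by linarith),
          Real.norm_of_nonneg (by linarith)]
    _ = X.norm g := by ring

/-- The norm is monotone: `|f| ≤ |g|` implies `‖f‖ ≤ ‖g‖`. -/
theorem norm_mono (f g : haarSpan) (h : ∀ s, |(f : ℝ → ℝ) s| ≤ |(g : ℝ → ℝ) s|) :
    X.norm f ≤ X.norm g := by
  classical
  obtain ⟨J₁, hJ₁⟩ := exists_isDyadicStep f.2
  obtain ⟨J₂, hJ₂⟩ := exists_isDyadicStep g.2
  set J := max J₁ J₂ with hJ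
  have hf : IsDyadicStep J f := hJ₁.mono (le_max_left _ _)
  have hg : IsDyadicStep J g := hJ₂.mono (le_max_right _ _)
  have hp : (0 : ℝ) < 2 ^ J := by positivity
  have hstep : ∀ m : ℕ, IsDyadicStep J
      (fun s => if ⌊s * 2 ^ J⌋₊ < m then (f : ℝ → ℝ) s else (g : ℝ → ℝ) s) := by
    intro m
    refine ⟨fun s hs => ?_, fun s hs t ht hst => ?_⟩
    · simp [hf.1 s hs, hg.1 s hs]
    · simp only [hst, hf.2 s hs t ht hst, hg.2 s hs t ht hst]
  have key : ∀ m : ℕ, X.norm ⟨_, (hstep m).mem_haarSpan⟩ ≤ X.norm g := by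
    intro m
    induction m with
    | zero =>
      apply le_of_eq
      congr 1
    | succ m ih =>
      refine le_trans ?_ ih
      by_cases hm : m < 2 ^ J
      · have hx : ((m : ℝ) / 2 ^ J) ∈ Set.Ico (0 : ℝ) 1 := by
          refine ⟨by positivity, ?_⟩
          rw [div_lt_one hp]
          exact_mod_cast hm
        have hxf : ⌊((m : ℝ) / 2 ^ J) * 2 ^ J⌋₊ = m := by
          rw [div_mul_cancel₀ _ hp.ne', Nat.floor_natCast]
        set a := (f : ℝ → ℝ) ((m : ℝ) / 2 ^ J) with ha
        set b := (g : ℝ → ℝ) ((m : ℝ) / 2 ^ J) with hb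
        have hab : |a| ≤ |b| := h _
        refine norm_update_le X J m _ _ (a / b) ?_ ?_ ?_
        · rw [abs_div]
          exact div_le_one_of_le₀ hab (abs_nonneg _)
        · intro s hs
          simp only [hs, lt_irrefl, Nat.lt_succ_self, if_true, if_false]
          by_cases hs1 : s ∈ Set.Ico (0 : ℝ) 1
          · rw [hf.2 s hs1 _ hx (hs.trans hxf.symm), hg.2 s hs1 _ hx (hs.trans hxf.symm),
              ← ha, ← hb]
            by_cases hb0 : b = 0
            · rw [hb0, abs_zero] at hab
              rw [hb0, abs_eq_zero.1 (le_antisymm hab (abs_nonneg _))]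
              simp
            · field_simp
          · rw [hf.1 s hs1, hg.1 s hs1, mul_zero]
        · intro s hs
          have : ⌊s * 2 ^ J⌋₊ < m + 1 ↔ ⌊s * 2 ^ J⌋₊ < m := by omega
          simp only [this]
      · apply le_of_eq
        congr 1
        apply Subtype.ext
        funext s
        by_cases hs : s ∈ Set.Ico (0 : ℝ) 1
        · have hlt : ⌊s * 2 ^ J⌋₊ < 2 ^ J := by
            rw [Nat.floor_lt (mul_nonneg hs.1 hp.le)]
            push_cast
            nlinarith [hs.2]
          have e1 : ⌊s * 2 ^ J⌋₊ < m + 1 := by omega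
          have e2 : ⌊s * 2 ^ J⌋₊ < m := by omega
          simp only [e1, e2]
        · exact ((hstep (m + 1)).1 s hs).trans ((hstep m).1 s hs).symm
  have hfin := key (2 ^ J)
  have : f = ⟨_, (hstep (2 ^ J)).mem_haarSpan⟩ := by
    apply Subtype.ext
    funext s
    by_cases hs : s ∈ Set.Ico (0 : ℝ) 1
    · have hlt : ⌊s * 2 ^ J⌋₊ < 2 ^ J := by
        rw [Nat.floor_lt (mul_nonneg hs.1 hp.le)]
        push_cast
        nlinarith [hs.2]
      simp only [hlt, if_true]
    · exact (hf.1 s hs).trans ((hstep (2 ^ J)).1 s hs).symm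
  rw [this]
  exact hfin

theorem hardyNorm_add_le (r : RademacherChoice) (f g : haarSpan) :
    X.hardyNorm r (f + g) ≤ X.hardyNorm r f + X.hardyNorm r g := by
  unfold hardyNorm
  refine le_trans ?_ (map_add_le_add X.norm _ _)
  apply X.norm_mono
  intro s
  have h0 : ∀ k : haarSpan, 0 ≤ randomAverage r k s := fun k =>
    integral_nonneg fun _ => abs_nonneg _
  simp only [Submodule.coe_add, Pi.add_apply]
  rw [abs_of_nonneg (h0 _), abs_of_nonneg (add_nonneg (h0 _) (h0 _))]
  unfold randomAverage
  rw [← integral_add (integrable_randomSum r f s).abs (integrable_randomSum r g s).abs]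
  refine integral_mono (integrable_randomSum r _ s).abs
    ((integrable_randomSum r f s).abs.add (integrable_randomSum r g s).abs) fun u => ?_
  simp only [randomSum_add]
  exact abs_add_le _ _

theorem hardyNorm_smul (r : RademacherChoice) (c : ℝ) (f : haarSpan) :
    X.hardyNorm r (c • f) = |c| * X.hardyNorm r f := by
  unfold hardyNorm
  have : (⟨randomAverage r (c • f), randomAverage_mem r _⟩ : haarSpan) =
      |c| • ⟨randomAverage r f, randomAverage_mem r f⟩ := by
    apply Subtype.ext
    funext s
    simp only [Submodule.coe_smul, Pi.smul_apply, smul_eq_mul, randomAverage, randomSum_smul,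
      abs_mul, integral_const_mul]
  rw [this, map_smul_eq_mul, Real.norm_eq_abs, abs_abs]

theorem rademacher_eq_one {n m : ℕ} (h : n ≤ m) {u : ℝ}
    (hu : u ∈ Set.Ico (0 : ℝ) (1 / 2 ^ (m + 1))) : rademacher n u = 1 := by
  have hu' : u * 2 ^ (m + 1) < 1 := by
    have := hu.2
    rwa [lt_div_iff₀ (by positivity)] at this
  have hf0 : ∀ j ≤ m + 1, ⌊u * 2 ^ j⌋₊ = 0 := by
    intro j hj
    rw [Nat.floor_eq_zero]
    refine lt_of_le_of_lt ?_ hu'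
    exact mul_le_mul_of_nonneg_left (pow_le_pow_right₀ (by norm_num) hj) hu.1
  unfold rademacher
  rw [Finset.sum_eq_single (⟨0, by positivity⟩ : Fin (2 ^ n))]
  · simp only [DyadicInterval.haar]
    rw [Set.indicator_of_mem, Set.indicator_of_notMem]
    · simp
    · rw [DyadicInterval.mem_toSet_iff _ hu.1]
      simp only [DyadicInterval.right]
      rw [hf0 _ (by omega)]
      omega
    · rw [DyadicInterval.mem_toSet_iff _ hu.1]
      simp only [DyadicInterval.left]
      rw [hf0 _ (by omega)]
  · intro i _ hi
    have hi0 : (i : ℕ) ≠ 0 := fun h0 => hi (Fin.ext h0)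
    simp only [DyadicInterval.haar]
    rw [Set.indicator_of_notMem, Set.indicator_of_notMem, sub_zero]
    · rw [DyadicInterval.mem_toSet_iff _ hu.1]
      simp only [DyadicInterval.right]
      rw [hf0 _ (by omega)]
      omega
    · rw [DyadicInterval.mem_toSet_iff _ hu.1]
      simp only [DyadicInterval.left]
      rw [hf0 _ (by omega)]
      omega
  · intro h
    exact absurd (Finset.mem_univ _) h

theorem hardyNorm_eq_zero (r : RademacherChoice) (f : haarSpan) (h : X.hardyNorm r f = 0) :
    f = 0 := by
  have h0 := X.eq_zero_of_norm _ h
  have h1 : ∀ s, randomAverage r f s = 0 := fun s =>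
    congrFun (congrArg Subtype.val h0) s
  set m := (haarBasis.repr f).support.sup haarIndex with hm
  have hfs : ∀ s, (f : ℝ → ℝ) s = (haarBasis.repr f).sum fun I a => a * haarPlus I s := by
    intro s
    conv_lhs => rw [← haarBasis.linearCombination_repr f]
    rw [Finsupp.linearCombination_apply, Finsupp.sum, Finsupp.sum, Submodule.coe_sum,
      Finset.sum_apply]
    refine Finset.sum_congr rfl fun I _ => ?_
    rw [haarBasis_apply]
    rfl
  have hsum : ∀ s, ∀ u ∈ Set.Ico (0 : ℝ) (1 / 2 ^ (m + 1)),
      randomSum r f u s = (f : ℝ → ℝ) s := by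
    intro s u hu
    rw [hfs]
    refine Finset.sum_congr rfl fun I hI => ?_
    have : r.fn I u = 1 := by
      cases r with
      | independent => exact rademacher_eq_one (Finset.le_sup hI) hu
      | constant => exact rademacher_eq_one (Nat.zero_le _) hu
    simp only [this, one_mul]
  apply Subtype.ext
  funext s
  have hint := (integrable_randomSum r f s).abs
  have hz := (integral_eq_zero_iff_of_nonneg (fun _ => abs_nonneg _) hint).1 (h1 s)
  by_contra hne
  have hsub : Set.Ico (0 : ℝ) (1 / 2 ^ (m + 1)) ⊆ Set.Ico (0 : ℝ) 1 := by
    refine Set.Ico_subset_Ico_right ?_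
    rw [div_le_one (by positivity)]
    exact one_le_pow₀ (by norm_num)
  rw [Filter.EventuallyEq, ae_restrict_iff' measurableSet_Ico] at hz
  have hnull : volume (Set.Ico (0 : ℝ) (1 / 2 ^ (m + 1))) = 0 := by
    refine measure_mono_null ?_ (ae_iff.1 hz)
    intro u hu hcon
    have := hcon (hsub hu)
    rw [hsum s u hu] at this
    exact hne (abs_eq_zero.1 this)
  rw [Real.volume_Ico, ENNReal.ofReal_eq_zero] at hnull
  have : (0 : ℝ) < 1 / 2 ^ (m + 1) := by positivity
  linarith

end Aux

/-- The space `H` equipped with the norm of `X(𝐫)`. The Haar system Hardy space `X(𝐫)` is its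
completion, and `Y = X₀(𝐫)` is the closure of the span of `(h_I)_{I ∈ 𝒟}` in it. -/
def Hardy (_X : HaarSystemSpace) (_r : RademacherChoice) : Type := haarSpan

variable (X : HaarSystemSpace) (r : RademacherChoice)

noncomputable instance : AddCommGroup (X.Hardy r) := inferInstanceAs (AddCommGroup haarSpan)

noncomputable instance : Module ℝ (X.Hardy r) := inferInstanceAs (Module ℝ haarSpan)

noncomputable instance : Norm (X.Hardy r) := ⟨fun f => X.hardyNorm r f⟩

theorem hardyCore : NormedSpace.Core ℝ (X.Hardy r) where
  norm_nonneg _ := apply_nonneg X.norm _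
  norm_smul c f := X.hardyNorm_smul r c f
  norm_triangle f g := X.hardyNorm_add_le r f g
  norm_eq_zero_iff f := by
    refine ⟨X.hardyNorm_eq_zero r f, fun h => ?_⟩
    have h0 := X.hardyNorm_smul r 0 (0 : haarSpan)
    rw [zero_smul, abs_zero, zero_mul] at h0
    rw [h]
    exact h0

noncomputable instance : NormedAddCommGroup (X.Hardy r) :=
  NormedAddCommGroup.ofCore (X.hardyCore r)

noncomputable instance : NormedSpace ℝ (X.Hardy r) := NormedSpace.ofCore (X.hardyCore r)

/-- The underlying function on `[0,1)` of an element of `H`. -/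
def Hardy.toFun {X : HaarSystemSpace} {r : RademacherChoice} (f : X.Hardy r) : ℝ → ℝ :=
  Subtype.val (p := (· ∈ haarSpan)) f

/-- The Haar function `h_I`, `I ∈ 𝒟`, as a vector of the Haar system Hardy space. -/
noncomputable def haarHardy (I : DyadicInterval) : X.Hardy r := haarVec (some I)

/-- The space `Y_n = span {h_I : I ∈ 𝒟, |I| ≥ 2^{-n}}` with the norm of `Y = X₀(𝐫)`. -/
noncomputable def levelSpan (n : ℕ) : Submodule ℝ (X.Hardy r) :=
  Submodule.span ℝ (X.haarHardy r '' {I | I.level ≤ n})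

/-- The Haar function `h_I` as a vector of `Y_n`, for `I ∈ 𝒟` with `|I| ≥ 2^{-n}`. -/
noncomputable def levelHaar {n : ℕ} (I : DyadicInterval) (hI : I.level ≤ n) : X.levelSpan r n :=
  ⟨X.haarHardy r I, Submodule.subset_span ⟨I, hI, rfl⟩⟩

/-- The Haar system `(h_I)_{I ∈ 𝒟}` is `K`-unconditional in `Y = X₀(𝐫)`: changing the signs of the
coefficients of a finite linear combination increases its norm at most by the factor `K`. -/
def IsUnconditional (K : ℝ) : Prop :=
  ∀ (s : Finset DyadicInterval) (a θ : DyadicInterval → ℝ), (∀ I, θ I = 1 ∨ θ I = -1) →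
    ‖∑ I ∈ s, (θ I * a I) • X.haarHardy r I‖ ≤ K * ‖∑ I ∈ s, a I • X.haarHardy r I‖

variable {X r}

/-- `T : Y_N → Y_N` has `δ`-large positive diagonal: `⟨h_I, T h_I⟩ ≥ δ |I|` for all `I ∈ 𝒟` with
`|I| ≥ 2^{-N}`, where `⟨f, g⟩ = ∫₀¹ f g`. -/
def HasLargePositiveDiagonal {N : ℕ} (δ : ℝ) (T : X.levelSpan r N →L[ℝ] X.levelSpan r N) : Prop :=
  ∀ (I : DyadicInterval) (hI : I.level ≤ N),
    δ * I.length ≤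
      ∫ s in Set.Ico (0 : ℝ) 1, I.haar s * Hardy.toFun (T (X.levelHaar r I hI) : X.Hardy r) s

end HaarSystemSpace

/-- `S` projectionally factors through `T` with constant `C` and error `η`. -/
def ProjectionallyFactors {E F : Type*} [NormedAddCommGroup E] [NormedSpace ℝ E]
    [NormedAddCommGroup F] [NormedSpace ℝ F] (S : E →L[ℝ] E) (T : F →L[ℝ] F) (C η : ℝ) : Prop :=
  ∃ (B : E →L[ℝ] F) (A : F →L[ℝ] E),
    ‖A‖ * ‖B‖ ≤ C ∧ ‖S - A ∘L T ∘L B‖ ≤ η ∧ A ∘L B = ContinuousLinearMap.id ℝ E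

/-!
Elements of `Y_n` are handled through their Haar coefficients (`Coef`), the dyadic intervals being
addressed by binary words (`Cube`). In these terms the norm of `f = ∑ a_I h_I` is the norm in `X` of
the step function that assigns to a cell the average over the signs of the modulus of the signed sum
of the terms of the expansion (`HaarSystemSpace.coefNorm`). Since the norm of `X` depends on
distributions only, averaging over rearrangements is contractive
(`HaarSystemSpace.cubeNorm_expect_extend_le`).

For levels `m 0 < ⋯ < m n` the operator `Coef.spread m` replaces the digits number `0, …, n` by the
digits number `m 0, …, m n`; it is isometric, and its left inverse `Coef.compress m`, a conditional
expectation, is contractive. An automorphism of the dyadic tree, given by a sign for every node, acts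
isometrically on the coefficients (`Coef.twist`). So for all signs `ε` the operators
`B = twist ε ∘ spread m` and `A = compress m ∘ (twist ε)⁻¹` satisfy `A B = I` and `‖A‖ ‖B‖ ≤ 1`. The
levels and the signs are chosen to bring `A T B` close to a multiple of the identity.

* For random signs the entries of `A T B` are bilinear forms in the signs. Their off-diagonal parts
  have second moments bounded by Hilbert–Schmidt norms of blocks of `T`, which are small at high
  levels: rearrangement invariance gives the two bounds by `‖χ_I‖` and by its dual norm, and the
  product of these is at most `2^{-k}` if both levels are at least `k`
  (`HaarSystemSpace.sum_sq_entries_le`). The diagonal parts are sums of diagonal entries of `T` over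
  random subsets of a level, and they concentrate at a multiple of the average of the diagonal over
  that level (`expect_sq_sum_matchInd_le`). Hence some choice of the signs makes `A T B` a small
  perturbation of the Haar multiplier whose entries are these level averages
  (`HaarSystemSpace.exists_coefNorm_conjugate_sub_le`).
* By the pigeonhole principle (`exists_strictMono_close`) the levels can be chosen with almost equal
  averages, so that the level multiplier is close to `c I`, where `c` is one of the averages. The
  norm of a multiplier with entries of modulus at most `w` on the levels is at most `(n + 1) w`, and
  at most `K w` if the Haar system is `K`-unconditional; this is the origin of the two conditions
  on `N`.

As `c` is an average of diagonal entries of `T`, it is at most `‖T‖` in modulus, and at least `δ` if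
the diagonal is `δ`-large.
-/

/-! ### The discrete cube -/

section CubeSection

open Finset
open scoped BigOperators

/-- The sign `(-1)^b` of a binary digit. -/
def bitSign (b : Bool) : ℝ := if b then -1 else 1

@[simp] theorem bitSign_true : bitSign true = -1 := rfl

@[simp] theorem bitSign_false : bitSign false = 1 := rfl

theorem bitSign_xor (a b : Bool) : bitSign (a ^^ b) = bitSign a * bitSign b := by
  cases a <;> cases b <;> norm_num

theorem bitSign_not (a : Bool) : bitSign (!a) = -bitSign a := by
  cases a <;> norm_num

@[simp] theorem abs_bitSign (a : Bool) : |bitSign a| = 1 := by cases a <;> norm_num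

@[simp] theorem bitSign_mul_self (a : Bool) : bitSign a * bitSign a = 1 := by
  cases a <;> norm_num

/-- Binary words of length `k`. They serve both as addresses of the dyadic intervals of level `k`
(the digits are read off from the left) and as the cells of the partition into intervals of
length `2^{-k}`. -/
abbrev Cube (k : ℕ) : Type := Fin k → Bool

section Flip

variable {ι : Type*} [DecidableEq ι]

theorem update_not_involutive (i : ι) :
    Function.Involutive fun x : ι → Bool => Function.update x i (!x i) := by
  intro x
  simp

variable [Fintype ι]

/-- A function that changes sign when one digit is flipped has mean zero. -/
theorem expect_eq_zero_of_flip (i : ι) (F : (ι → Bool) → ℝ)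
    (h : ∀ x, F (Function.update x i (!x i)) = -F x) : 𝔼 x, F x = 0 := by
  have h1 : 𝔼 x, F x = 𝔼 x, -F x :=
    Fintype.expect_equiv (update_not_involutive i).toPerm _ _ fun x => by
      rw [← neg_eq_iff_eq_neg.2 (h x).symm.symm]
      simp [Function.Involutive.toPerm]
  rw [expect_neg_distrib] at h1
  linarith

/-- The mean of `F` is unchanged by a translation of the group `{0,1}^ι`. -/
theorem expect_xor (z : ι → Bool) (F : (ι → Bool) → ℝ) :
    𝔼 x : ι → Bool, F (fun i => x i ^^ z i) = 𝔼 x, F x := by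
  have hinv : Function.Involutive fun (x : ι → Bool) (i : ι) => x i ^^ z i := by
    intro x
    funext i
    simp
  exact Fintype.expect_equiv hinv.toPerm _ _ fun x => rfl

end Flip

namespace Cube

variable {D d : ℕ}

/-- The first `k` digits of a word. -/
def trunc (x : Cube D) (k : Fin D) : Cube k := fun i => x ⟨i, i.2.trans k.2⟩

/-- The word of length `D` that starts with `w` and continues with zeros. -/
def pad (D : ℕ) {k : ℕ} (w : Cube k) : Cube D := fun i => if h : i.1 < k then w ⟨i, h⟩ else false

theorem trunc_eq_iff {x y : Cube D} {k : Fin D} :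
    x.trunc k = y.trunc k ↔ ∀ i, i < k → x i = y i := by
  constructor
  · intro h i hi
    exact congrFun h ⟨i, hi⟩
  · intro h
    funext i
    exact h ⟨i, i.2.trans k.2⟩ i.2

theorem pad_trunc_apply (x : Cube D) {k i : Fin D} (h : i < k) :
    pad D (x.trunc k) i = x i := by
  have h' : i.1 < k.1 := h
  simp [pad, trunc, h']

@[simp] theorem trunc_pad {k : Fin D} (w : Cube k) : (pad D w).trunc k = w := by
  funext i
  simp [pad, trunc]

theorem trunc_update {x : Cube D} {k i : Fin D} (h : k ≤ i) (b : Bool) :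
    trunc (Function.update x i b) k = x.trunc k := by
  rw [trunc_eq_iff]
  intro j hj
  rw [Function.update_of_ne (hj.trans_le h).ne]

/-- The mean over words of a function of some of the digits. -/
theorem expect_comp {m : Fin d → Fin D} (hm : Function.Injective m) (G : Cube d → ℝ) :
    𝔼 x : Cube D, G (x ∘ m) = 𝔼 y, G y := by
  have h1 : ∀ y : Cube d, 𝔼 x : Cube D, G (fun i => (x ∘ m) i ^^ y i) = 𝔼 x : Cube D, G (x ∘ m) := by
    intro y
    rw [← expect_xor (Function.extend m y fun _ => false) fun x : Cube D => G (x ∘ m)]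
    refine expect_congr rfl fun x _ => ?_
    congr 1
    funext i
    simp [hm.extend_apply]
  have h2 : ∀ x : Cube D, 𝔼 y : Cube d, G (fun i => (x ∘ m) i ^^ y i) = 𝔼 y, G y := by
    intro x
    rw [← expect_xor (x ∘ m) G]
    refine expect_congr rfl fun y _ => ?_
    congr 1
    funext i
    exact Bool.xor_comm _ _
  calc 𝔼 x : Cube D, G (x ∘ m) = 𝔼 _y : Cube d, 𝔼 x : Cube D, G (x ∘ m) :=
        (Fintype.expect_const _).symm
    _ = 𝔼 y : Cube d, 𝔼 x : Cube D, G (fun i => (x ∘ m) i ^^ y i) :=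
        expect_congr rfl fun y _ => (h1 y).symm
    _ = 𝔼 x : Cube D, 𝔼 y : Cube d, G (fun i => (x ∘ m) i ^^ y i) := expect_comm _ _ _
    _ = 𝔼 _x : Cube D, 𝔼 y, G y := expect_congr rfl fun x _ => h2 x
    _ = 𝔼 y, G y := Fintype.expect_const _

/-- Averaging over the digits outside the range of `m`. -/
theorem expect_extend {m : Fin d → Fin D} (hm : Function.Injective m) (F : Cube D → ℝ)
    (x' : Cube D) : 𝔼 x, F (Function.extend m (x' ∘ m) x) =
      𝔼 z : Cube D, F (fun i => x' i ^^ Function.extend m (fun _ => false) z i) := by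
  rw [← expect_xor x' fun x => F (Function.extend m (x' ∘ m) x)]
  refine expect_congr rfl fun x _ => ?_
  congr 1
  funext i
  by_cases h : ∃ j, m j = i
  · obtain ⟨j, rfl⟩ := h
    simp [hm.extend_apply]
  · rw [Function.extend_apply' _ _ _ h, Function.extend_apply' _ _ _ h, Bool.xor_comm]

theorem expect_sign_mul_eq_zero (k : Fin D) (G : Cube D → ℝ)
    (hG : ∀ x, G (Function.update x k (!x k)) = G x) : 𝔼 x : Cube D, bitSign (x k) * G x = 0 := by
  refine expect_eq_zero_of_flip k _ fun x => ?_
  rw [hG, Function.update_self, bitSign_not]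
  ring

/-- The number with binary digits `w`, most significant digit first. -/
def code : (k : ℕ) → Cube k → ℕ
  | 0, _ => 0
  | k + 1, w => 2 * code k (Fin.init w) + (w (Fin.last k)).toNat

theorem code_lt : ∀ (k : ℕ) (w : Cube k), code k w < 2 ^ k
  | 0, _ => by simp [code]
  | k + 1, w => by
    have := code_lt k (Fin.init w)
    have h2 := Bool.toNat_lt (w (Fin.last k))
    rw [code, pow_succ]
    omega

theorem code_injective : ∀ k : ℕ, Function.Injective (code k)
  | 0 => fun _ _ _ => Subsingleton.elim _ _
  | k + 1 => fun v w h => by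
    rw [code, code] at h
    have h1 := Bool.toNat_lt (v (Fin.last k))
    have h2 := Bool.toNat_lt (w (Fin.last k))
    have h3 := code_injective k (show code k (Fin.init v) = code k (Fin.init w) by omega)
    have h4 : (v (Fin.last k)).toNat = (w (Fin.last k)).toNat := by omega
    have h5 : v (Fin.last k) = w (Fin.last k) := by
      revert h4
      cases v (Fin.last k) <;> cases w (Fin.last k) <;> simp
    rw [← Fin.snoc_init_self v, ← Fin.snoc_init_self w, h3, h5]

/-- Words of length `k` number the dyadic intervals of level `k`. -/
noncomputable def codeEquiv (k : ℕ) : Cube k ≃ Fin (2 ^ k) :=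
  Equiv.ofBijective (fun w => ⟨code k w, code_lt k w⟩)
    ((Fintype.bijective_iff_injective_and_card _).2
      ⟨fun _ _ h => code_injective k (Fin.mk.inj_iff.1 h), by simp⟩)

/-- The dyadic interval with address `w`. -/
noncomputable def node {k : ℕ} (w : Cube k) : DyadicInterval := ⟨k, codeEquiv k w⟩

theorem node_injective {k l : ℕ} {v : Cube k} {w : Cube l} (h : node v = node w) :
    ∃ h : k = l, h ▸ v = w := by
  obtain ⟨rfl, h2⟩ := Sigma.mk.inj_iff.1 h
  exact ⟨rfl, (codeEquiv k).injective (eq_of_heq h2)⟩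

theorem exists_node (I : DyadicInterval) : ∃ w : Cube I.1, node w = I :=
  ⟨(codeEquiv I.1).symm I.2, by simp [node]⟩

end Cube

/-! ### Binary digits of a real number -/

/-- The binary digit of `s` at position `m`, counted from `0`. -/
noncomputable def binDigit (s : ℝ) (m : ℕ) : Bool := decide (⌊s * 2 ^ (m + 1)⌋₊ % 2 = 1)

/-- The first `D` binary digits of `s`. -/
noncomputable def cell (D : ℕ) (s : ℝ) : Cube D := fun i => binDigit s i

theorem floor_pow_div_two (s : ℝ) (m : ℕ) : ⌊s * 2 ^ (m + 1)⌋₊ / 2 = ⌊s * 2 ^ m⌋₊ := by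
  have h1 := Nat.floor_div_natCast (s * 2 ^ (m + 1)) 2
  rw [← h1]
  congr 1
  rw [pow_succ]
  push_cast
  field_simp

theorem code_cell {s : ℝ} (hs : s ∈ Set.Ico (0 : ℝ) 1) :
    ∀ k : ℕ, Cube.code k (cell k s) = ⌊s * 2 ^ k⌋₊
  | 0 => by
    rw [Cube.code, eq_comm, Nat.floor_eq_zero]
    simpa using hs.2
  | k + 1 => by
    have h1 : Fin.init (cell (k + 1) s) = cell k s := rfl
    have h2 : cell (k + 1) s (Fin.last k) = binDigit s k := rfl
    rw [Cube.code, h1, h2, code_cell hs k, ← floor_pow_div_two s k, binDigit]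
    rcases Nat.mod_two_eq_zero_or_one ⌊s * 2 ^ (k + 1)⌋₊ with h | h
    · simp only [h]
      simp
      omega
    · simp only [h]
      simp
      omega

theorem trunc_cell (D : ℕ) (k : Fin D) (s : ℝ) : (cell D s).trunc k = cell k s := rfl

theorem mem_node_iff {s : ℝ} (hs : s ∈ Set.Ico (0 : ℝ) 1) {k : ℕ} (w : Cube k) :
    s ∈ (Cube.node w).toSet ↔ cell k s = w := by
  rw [DyadicInterval.mem_toSet_iff _ hs.1]
  change ⌊s * 2 ^ k⌋₊ = Cube.code k w ↔ _
  rw [← code_cell hs k, (Cube.code_injective k).eq_iff]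

theorem haar_node {s : ℝ} (hs : s ∈ Set.Ico (0 : ℝ) 1) {k : ℕ} (w : Cube k) :
    (Cube.node w).haar s = if cell k s = w then bitSign (binDigit s k) else 0 := by
  classical
  have hl : s ∈ (Cube.node w).left.toSet ↔ ⌊s * 2 ^ (k + 1)⌋₊ = 2 * Cube.code k w :=
    (Cube.node w).left.mem_toSet_iff hs.1
  have hr : s ∈ (Cube.node w).right.toSet ↔ ⌊s * 2 ^ (k + 1)⌋₊ = 2 * Cube.code k w + 1 :=
    (Cube.node w).right.mem_toSet_iff hs.1
  have hw : cell k s = w ↔ ⌊s * 2 ^ (k + 1)⌋₊ / 2 = Cube.code k w := by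
    rw [floor_pow_div_two, ← code_cell hs k, (Cube.code_injective k).eq_iff]
  simp only [DyadicInterval.haar, Set.indicator_apply, hl, hr, hw, binDigit, Pi.one_apply]
  rcases Nat.mod_two_eq_zero_or_one ⌊s * 2 ^ (k + 1)⌋₊ with h | h
  · split_ifs <;> first | omega | simp [h]
  · split_ifs <;> first | omega | simp [h]

theorem rademacher_eq {u : ℝ} (hu : u ∈ Set.Ico (0 : ℝ) 1) (n : ℕ) :
    rademacher n u = bitSign (binDigit u n) := by
  unfold rademacher
  rw [← (Cube.codeEquiv n).sum_comp fun i => DyadicInterval.haar ⟨n, i⟩ u]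
  have : ∀ w : Cube n, DyadicInterval.haar ⟨n, Cube.codeEquiv n w⟩ u =
      if cell n u = w then bitSign (binDigit u n) else 0 := fun w => haar_node hu w
  simp [this]

theorem measurable_cell (D : ℕ) : Measurable (cell D) := by
  refine measurable_pi_lambda _ fun i => ?_
  have h : Measurable fun s : ℝ => ⌊s * 2 ^ (i.1 + 1)⌋₊ := by fun_prop
  exact (measurable_from_top (f := fun m : ℕ => decide (m % 2 = 1))).comp h

/-- Lebesgue measure on `[0,1)`. -/
noncomputable abbrev unitMeasure : Measure ℝ := volume.restrict (Set.Ico (0 : ℝ) 1)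

theorem unitMeasure_cell {D : ℕ} (x : Cube D) :
    unitMeasure (cell D ⁻¹' {x}) = (2 ^ D : ENNReal)⁻¹ := by
  rw [Measure.restrict_apply (measurable_cell D (measurableSet_singleton x))]
  have : cell D ⁻¹' {x} ∩ Set.Ico (0 : ℝ) 1 = (Cube.node x).toSet := by
    ext s
    constructor
    · rintro ⟨h1, h2⟩
      exact (mem_node_iff h2 x).2 h1
    · intro h
      have h2 := (Cube.node x).toSet_subset h
      exact ⟨(mem_node_iff h2 x).1 h, h2⟩
  rw [this, DyadicInterval.toSet, Real.volume_Ico]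
  have h3 : (((Cube.node x).2 : ℕ) + 1 : ℝ) / 2 ^ (Cube.node x).1 -
      ((Cube.node x).2 : ℕ) / 2 ^ (Cube.node x).1 = (2 ^ D)⁻¹ := by
    change (_ : ℝ) / 2 ^ D - _ / 2 ^ D = _
    rw [← sub_div, add_sub_cancel_left, one_div]
  rw [h3, ENNReal.ofReal_inv_of_pos (by positivity), ENNReal.ofReal_pow (by norm_num)]
  norm_num

theorem integral_cell {D : ℕ} (G : Cube D → ℝ) :
    ∫ u in Set.Ico (0 : ℝ) 1, G (cell D u) = 𝔼 x, G x := by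
  have h1 : ∫ u in Set.Ico (0 : ℝ) 1, G (cell D u) =
      ∫ x, G x ∂(unitMeasure.map (cell D)) := by
    rw [integral_map (measurable_cell D).aemeasurable
      (Measurable.of_discrete.aestronglyMeasurable)]
  have : IsFiniteMeasure (unitMeasure.map (cell D)) := by infer_instance
  rw [h1, integral_fintype (Integrable.of_finite)]
  rw [Fintype.expect_eq_sum_div_card, Finset.sum_div]
  refine Finset.sum_congr rfl fun x _ => ?_
  rw [measureReal_def, Measure.map_apply (measurable_cell D) (measurableSet_singleton x),
    unitMeasure_cell]
  simp [div_eq_inv_mul]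

/-- A map of cubes that transports the uniform distribution to the uniform distribution. -/
def Equidistributed {D d : ℕ} (g : Cube D → Cube d) : Prop :=
  ∀ G : Cube d → ℝ, 𝔼 x, G (g x) = 𝔼 y, G y

theorem Equidistributed.map_cell {D d : ℕ} {g : Cube D → Cube d} (hg : Equidistributed g) :
    unitMeasure.map (fun s => g (cell D s)) = unitMeasure.map (cell d) := by
  classical
  have hm : Measurable fun s => g (cell D s) := Measurable.of_discrete.comp (measurable_cell D)
  have h1 : IsFiniteMeasure (unitMeasure.map fun s => g (cell D s)) := by infer_instance
  have h2 : IsFiniteMeasure (unitMeasure.map (cell d)) := by infer_instance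
  refine Measure.ext_of_singleton fun y => ?_
  rw [← measureReal_eq_measureReal_iff]
  have key : ∀ {e : ℕ} (f : Cube e → Cube d),
      (unitMeasure.map fun s => f (cell e s)).real {y} = 𝔼 x, if f x = y then (1 : ℝ) else 0 := by
    intro e f
    have hf : Measurable fun s => f (cell e s) := Measurable.of_discrete.comp (measurable_cell e)
    rw [← integral_cell fun x => if f x = y then (1 : ℝ) else 0, measureReal_def,
      Measure.map_apply hf (measurableSet_singleton y), ← measureReal_def,
      ← integral_indicator_one (hf (measurableSet_singleton y))]
    refine integral_congr_ae (Filter.Eventually.of_forall fun s => ?_)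
    simp [Set.indicator_apply]
  rw [key g, hg fun y' => if y' = y then (1 : ℝ) else 0]
  exact (key (e := d) id).symm

theorem equidistributed_comp {D d : ℕ} {m : Fin d → Fin D} (hm : Function.Injective m) :
    Equidistributed fun x : Cube D => x ∘ m :=
  fun G => Cube.expect_comp hm G

theorem equidistributed_equiv {D : ℕ} (e : Cube D ≃ Cube D) : Equidistributed e :=
  fun _ => Fintype.expect_equiv e _ _ fun _ => rfl

end CubeSection

/-! ### Norms on functions on the cube -/

section CubeNorm

open Finset
open scoped BigOperators

/-- The function on `[0,1)` whose value at `s` is the value of `F` at the first `D` digits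
of `s`. -/
noncomputable def stepMap (D : ℕ) : (Cube D → ℝ) →ₗ[ℝ] haarSpan where
  toFun F := ⟨fun s => (Set.Ico (0 : ℝ) 1).indicator (fun t => F (cell D t)) s, by
    refine IsDyadicStep.mem_haarSpan (J := D)
      ⟨fun s hs => Set.indicator_of_notMem hs _, fun s hs t ht hst => ?_⟩
    simp only [Set.indicator_of_mem hs, Set.indicator_of_mem ht]
    rw [← code_cell hs, ← code_cell ht] at hst
    rw [Cube.code_injective D hst]⟩
  map_add' F G := by
    apply Subtype.ext
    exact Set.indicator_add _ _ _
  map_smul' c F := by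
    apply Subtype.ext
    exact Set.indicator_const_smul _ c fun t => F (cell D t)

theorem stepMap_apply {D : ℕ} (F : Cube D → ℝ) {s : ℝ} (hs : s ∈ Set.Ico (0 : ℝ) 1) :
    (stepMap D F : ℝ → ℝ) s = F (cell D s) :=
  Set.indicator_of_mem hs fun t => F (cell D t)

theorem stepMap_apply_of_notMem {D : ℕ} (F : Cube D → ℝ) {s : ℝ} (hs : s ∉ Set.Ico (0 : ℝ) 1) :
    (stepMap D F : ℝ → ℝ) s = 0 :=
  Set.indicator_of_notMem hs fun t => F (cell D t)

namespace HaarSystemSpace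

variable (X : HaarSystemSpace)

/-- The norm of `X` on functions that depend on the first `D` digits only. -/
noncomputable def cubeNorm (D : ℕ) : Seminorm ℝ (Cube D → ℝ) := X.norm.comp (stepMap D)

variable {X} {D d : ℕ}

theorem cubeNorm_mono {F G : Cube D → ℝ} (h : ∀ x, |F x| ≤ |G x|) :
    X.cubeNorm D F ≤ X.cubeNorm D G := by
  refine X.norm_mono _ _ fun s => ?_
  by_cases hs : s ∈ Set.Ico (0 : ℝ) 1
  · rw [stepMap_apply _ hs, stepMap_apply _ hs]
    exact h _
  · rw [stepMap_apply_of_notMem _ hs, stepMap_apply_of_notMem _ hs]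

theorem map_abs_stepMap {g : Cube D → Cube d} (hg : Equidistributed g) (F : Cube d → ℝ) :
    unitMeasure.map (fun s => |(stepMap D (F ∘ g) : ℝ → ℝ) s|) =
      unitMeasure.map (fun s => |(stepMap d F : ℝ → ℝ) s|) := by
  have key : ∀ {e : ℕ} (f : Cube e → Cube d),
      unitMeasure.map (fun s => |(stepMap e (F ∘ f) : ℝ → ℝ) s|) =
        (unitMeasure.map fun s => f (cell e s)).map fun y => |F y| := by
    intro e f
    have hf : Measurable fun s => f (cell e s) := Measurable.of_discrete.comp (measurable_cell e)
    rw [Measure.map_map Measurable.of_discrete hf]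
    refine Measure.map_congr ?_
    filter_upwards [ae_restrict_mem measurableSet_Ico] with s hs
    rw [stepMap_apply _ hs]
    rfl
  rw [key g, hg.map_cell]
  exact (key (e := d) id).symm

theorem cubeNorm_comp {g : Cube D → Cube d} (hg : Equidistributed g) (F : Cube d → ℝ) :
    X.cubeNorm D (F ∘ g) = X.cubeNorm d F :=
  X.norm_eq_of_distribution _ _ (map_abs_stepMap hg F)

theorem cubeNorm_const (c : ℝ) : X.cubeNorm D (fun _ => c) = |c| := by
  have h1 : X.cubeNorm D (fun _ => 1) = 1 := by
    refine Eq.trans ?_ X.norm_one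
    refine congrArg X.norm ?_
    apply Subtype.ext
    funext s
    by_cases hs : s ∈ Set.Ico (0 : ℝ) 1
    · rw [stepMap_apply _ hs]
      exact (Set.indicator_of_mem hs (1 : ℝ → ℝ)).symm
    · rw [stepMap_apply_of_notMem _ hs]
      exact (Set.indicator_of_notMem hs (1 : ℝ → ℝ)).symm
  have h2 : (fun _ => c : Cube D → ℝ) = c • fun _ => 1 := by
    funext x
    simp
  rw [h2, map_smul_eq_mul, h1, mul_one, Real.norm_eq_abs]

theorem cubeNorm_expect_le {ι : Type*} [Fintype ι] (F : ι → Cube D → ℝ) {C : ℝ} [Nonempty ι]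
    (h : ∀ i, X.cubeNorm D (F i) ≤ C) : X.cubeNorm D (fun x => 𝔼 i, F i x) ≤ C := by
  have h1 : (fun x => 𝔼 i, F i x) = (Fintype.card ι : ℝ)⁻¹ • ∑ i, F i := by
    funext x
    rw [Fintype.expect_eq_sum_div_card, div_eq_inv_mul]
    simp
  have hc : (0 : ℝ) < Fintype.card ι := by exact_mod_cast Fintype.card_pos
  rw [h1, map_smul_eq_mul, Real.norm_of_nonneg (by positivity), inv_mul_le_iff₀ hc]
  calc X.cubeNorm D (∑ i, F i) ≤ ∑ i, X.cubeNorm D (F i) :=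
        Finset.le_sum_of_subadditive _ (map_zero (X.cubeNorm D)).le (map_add_le_add _) _ _
    _ ≤ ∑ _i : ι, C := Finset.sum_le_sum fun i _ => h i
    _ = Fintype.card ι * C := by simp

/-- Conditional expectations are contractive: averaging over rearrangements does not increase the
norm. -/
theorem cubeNorm_expect_extend_le {m : Fin d → Fin D} (hm : Function.Injective m)
    (F : Cube D → ℝ) :
    X.cubeNorm d (fun y => 𝔼 x, F (Function.extend m y x)) ≤ X.cubeNorm D F := by
  rw [← cubeNorm_comp (equidistributed_comp hm)]
  have : ((fun y => 𝔼 x, F (Function.extend m y x)) ∘ fun x : Cube D => x ∘ m) =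
      fun x' => 𝔼 z : Cube D, F (fun i => x' i ^^ Function.extend m (fun _ => false) z i) := by
    funext x'
    exact Cube.expect_extend hm F x'
  rw [this]
  refine cubeNorm_expect_le _ fun z => le_of_eq ?_
  have hinv : Function.Involutive
      fun (x : Cube D) (i : Fin D) => x i ^^ Function.extend m (fun _ => false) z i := by
    intro x
    funext i
    simp
  exact cubeNorm_comp (equidistributed_equiv hinv.toPerm) F

end HaarSystemSpace

end CubeNorm

/-! ### The Hardy norm in terms of Haar coefficients -/

section CoefNorm

open Finset
open scoped BigOperators

/-- Families of Haar coefficients of the levels `0, …, D - 1`; the coefficient of `h_I` is found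
under the level and the address of `I`. -/
abbrev Coef (D : ℕ) : Type := (k : Fin D) → Cube k → ℝ

/-- The integral `∫₀¹ |∑ r_k(u) v_k| du` for distinct members `r_k` of the chosen Rademacher
family. -/
noncomputable def signAverage (r : RademacherChoice) {D : ℕ} (v : Fin D → ℝ) : ℝ :=
  match r with
  | .independent => 𝔼 σ : Cube D, |∑ k, bitSign (σ k) * v k|
  | .constant => |∑ k, v k|

namespace Coef

variable {D : ℕ}

/-- The values at the cell `x` of the terms of the Haar expansion, one for each level. -/
noncomputable def term (a : Coef D) (x : Cube D) (k : Fin D) : ℝ :=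
  a k (x.trunc k) * bitSign (x k)

end Coef

variable {D d : ℕ}

theorem signAverage_nonneg (r : RademacherChoice) (v : Fin D → ℝ) : 0 ≤ signAverage r v := by
  cases r
  · exact expect_nonneg fun _ _ => abs_nonneg _
  · exact abs_nonneg _

theorem signAverage_single (r : RademacherChoice) (k : Fin D) (c : ℝ) :
    signAverage r (fun j => if j = k then c else 0) = |c| := by
  cases r
  · simp only [signAverage, mul_ite, mul_zero, sum_ite_eq', mem_univ, if_true, abs_mul,
      abs_bitSign, one_mul]
    exact Fintype.expect_const _
  · simp [signAverage]

theorem randomSum_haarVec (r : RademacherChoice) (I : Option DyadicInterval) (u s : ℝ) :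
    randomSum r (haarVec I) u s = r.fn I u * haarPlus I s := by
  unfold randomSum
  rw [← haarBasis_apply, Module.Basis.repr_self, Finsupp.sum_single_index (by ring), mul_one]

/-- The element of `H` with the given Haar coefficients. -/
noncomputable def haarSum (D : ℕ) : Coef D →ₗ[ℝ] haarSpan where
  toFun a := ∑ k : Fin D, ∑ w : Cube k, a k w • haarVec (some (Cube.node w))
  map_add' a b := by simp only [Pi.add_apply, add_smul, sum_add_distrib]
  map_smul' c a := by
    simp only [Pi.smul_apply, smul_eq_mul, mul_smul, smul_sum, RingHom.id_apply]

theorem haarSum_apply (a : Coef D) :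
    haarSum D a = ∑ k : Fin D, ∑ w : Cube k, a k w • haarVec (some (Cube.node w)) := rfl

theorem randomSum_haarSum (r : RademacherChoice) (a : Coef D) (u : ℝ) {s : ℝ}
    (hs : s ∈ Set.Ico (0 : ℝ) 1) :
    randomSum r (haarSum D a) u s =
      ∑ k : Fin D, r.fn (some (Cube.node (cell k s))) u * a.term (cell D s) k := by
  let L : haarSpan →ₗ[ℝ] ℝ :=
    { toFun := fun f => randomSum r f u s
      map_add' := fun f g => randomSum_add r f g u s
      map_smul' := fun c f => randomSum_smul r c f u s }
  change L _ = _
  rw [haarSum_apply, map_sum]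
  refine sum_congr rfl fun k _ => ?_
  rw [map_sum]
  have : ∀ w : Cube k, L (a k w • haarVec (some (Cube.node w))) =
      if cell k s = w then r.fn (some (Cube.node w)) u * (a k w * bitSign (binDigit s k))
        else 0 := by
    intro w
    rw [map_smul]
    change a k w • randomSum r _ u s = _
    rw [randomSum_haarVec]
    change a k w * (_ * (Cube.node w).haar s) = _
    rw [haar_node hs]
    split_ifs <;> ring
  simp only [this, sum_ite_eq, mem_univ, if_true]
  rfl

theorem haarSum_fun (a : Coef D) {s : ℝ} (hs : s ∈ Set.Ico (0 : ℝ) 1) :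
    (haarSum D a : ℝ → ℝ) s = ∑ k : Fin D, a.term (cell D s) k := by
  rw [haarSum_apply, Submodule.coe_sum, Finset.sum_apply]
  refine sum_congr rfl fun k _ => ?_
  rw [Submodule.coe_sum, Finset.sum_apply]
  have : ∀ w : Cube k, (↑(a k w • haarVec (some (Cube.node w))) : ℝ → ℝ) s =
      if cell k s = w then a k w * bitSign (binDigit s k) else 0 := by
    intro w
    change a k w * (Cube.node w).haar s = _
    rw [haar_node hs]
    split_ifs <;> ring
  simp only [this, sum_ite_eq, mem_univ, if_true]
  rfl

theorem haarPlus_eq_zero_of_notMem (I : Option DyadicInterval) {s : ℝ}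
    (hs : s ∉ Set.Ico (0 : ℝ) 1) : haarPlus I s = 0 :=
  (isDyadicStep_haarPlus I).1 s hs

/-- The position in the Rademacher enumeration of the interval of level `k` containing the
cell `x`. -/
def rademacherIndex (x : Cube D) (k : Fin D) : Fin (2 ^ D) :=
  ⟨2 ^ k.1 + Cube.code k (x.trunc k), by
    have h1 := Cube.code_lt k (x.trunc k)
    have h2 : 2 ^ (k.1 + 1) ≤ 2 ^ D := Nat.pow_le_pow_right (by norm_num) k.2
    rw [pow_succ] at h2
    omega⟩

theorem rademacherIndex_strictMono (x : Cube D) : StrictMono (rademacherIndex x) := by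
  intro k l hkl
  have h1 := Cube.code_lt k (x.trunc k)
  have h2 : 2 ^ (k.1 + 1) ≤ 2 ^ l.1 := Nat.pow_le_pow_right (by norm_num) hkl
  rw [pow_succ] at h2
  change 2 ^ k.1 + Cube.code k (x.trunc k) < 2 ^ l.1 + Cube.code l (x.trunc l)
  omega

theorem randomAverage_haarSum (r : RademacherChoice) (a : Coef D) :
    randomAverage r (haarSum D a) = stepMap D fun x => signAverage r (a.term x) := by
  funext s
  by_cases hs : s ∈ Set.Ico (0 : ℝ) 1
  · rw [stepMap_apply _ hs]
    unfold randomAverage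
    simp only [randomSum_haarSum r a _ hs]
    cases r with
    | independent =>
      have h1 : ∫ u in Set.Ico (0 : ℝ) 1, |∑ k : Fin D, RademacherChoice.independent.fn
            (some (Cube.node (cell k s))) u * a.term (cell D s) k| =
          ∫ u in Set.Ico (0 : ℝ) 1, |∑ k : Fin D,
            bitSign ((cell (2 ^ D) u ∘ rademacherIndex (cell D s)) k) * a.term (cell D s) k| := by
        refine setIntegral_congr_fun measurableSet_Ico fun u hu => ?_
        refine congrArg abs (sum_congr rfl fun k _ => ?_)
        congr 1
        exact rademacher_eq hu _
      rw [h1, integral_cell fun x => |∑ k : Fin D,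
        bitSign ((x ∘ rademacherIndex (cell D s)) k) * a.term (cell D s) k|]
      exact Cube.expect_comp (rademacherIndex_strictMono _).injective
        fun σ => |∑ k : Fin D, bitSign (σ k) * a.term (cell D s) k|
    | constant =>
      have h1 : ∫ u in Set.Ico (0 : ℝ) 1, |∑ k : Fin D, RademacherChoice.constant.fn
            (some (Cube.node (cell k s))) u * a.term (cell D s) k| =
          ∫ u in Set.Ico (0 : ℝ) 1, |∑ k : Fin D, a.term (cell D s) k| := by
        refine setIntegral_congr_fun measurableSet_Ico fun u hu => ?_
        simp only [RademacherChoice.fn]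
        rw [← mul_sum, abs_mul, rademacher_eq hu, abs_bitSign, one_mul]
      rw [h1]
      simp [signAverage]
  · rw [stepMap_apply_of_notMem _ hs]
    have : ∀ u, randomSum r (haarSum D a) u s = 0 := fun u => by
      unfold randomSum
      exact Finset.sum_eq_zero fun K _ => by
        simp only [haarPlus_eq_zero_of_notMem K hs, mul_zero]
    simp [randomAverage, this]

namespace HaarSystemSpace

/-- The norm of `X(𝐫)` in terms of Haar coefficients. -/
noncomputable def coefNorm (X : HaarSystemSpace) (r : RademacherChoice) {D : ℕ} (a : Coef D) : ℝ :=
  X.cubeNorm D fun x => signAverage r (a.term x)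

variable {X : HaarSystemSpace} {r : RademacherChoice}

theorem hardyNorm_haarSum (a : Coef D) : X.hardyNorm r (haarSum D a) = X.coefNorm r a := by
  unfold hardyNorm coefNorm
  change X.norm _ = X.norm _
  congr 1
  exact Subtype.ext (randomAverage_haarSum r a)

theorem coefNorm_nonneg (a : Coef D) : 0 ≤ X.coefNorm r a := apply_nonneg _ _

theorem coefNorm_add_le (a b : Coef D) :
    X.coefNorm r (a + b) ≤ X.coefNorm r a + X.coefNorm r b := by
  rw [← hardyNorm_haarSum, ← hardyNorm_haarSum, ← hardyNorm_haarSum, map_add]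
  exact X.hardyNorm_add_le r _ _

theorem coefNorm_smul (c : ℝ) (a : Coef D) : X.coefNorm r (c • a) = |c| * X.coefNorm r a := by
  rw [← hardyNorm_haarSum, ← hardyNorm_haarSum, map_smul]
  exact X.hardyNorm_smul r _ _

end HaarSystemSpace

end CoefNorm

/-! ### Contractions and isometries between spaces of coefficients -/

section CoefMaps

open Finset
open scoped BigOperators

variable {D d : ℕ}

namespace Cube

/-- Integrating first over the digits outside the range of `m` and then over the others. -/
theorem expect_expect_extend {m : Fin d → Fin D} (hm : Function.Injective m) (F : Cube D → ℝ) :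
    𝔼 y : Cube d, 𝔼 x : Cube D, F (Function.extend m y x) = 𝔼 x, F x := by
  rw [← expect_comp hm fun y => 𝔼 x : Cube D, F (Function.extend m y x)]
  simp only [expect_extend hm]
  rw [expect_comm]
  simp only [expect_xor]
  exact Fintype.expect_const _

theorem expect_trunc (k : Fin D) (G : Cube k → ℝ) : 𝔼 x : Cube D, G (x.trunc k) = 𝔼 w, G w :=
  expect_comp (m := fun i : Fin k => (⟨i, i.2.trans k.2⟩ : Fin D))
    (fun _ _ h => Fin.ext (Fin.mk.inj_iff.1 h)) G

theorem equidistributed_trunc (k : Fin D) : Equidistributed fun x : Cube D => x.trunc k :=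
  fun G => expect_trunc k G

theorem extend_update {m : Fin d → Fin D} (y : Cube d) (x : Cube D) {k : Fin D}
    (hk : ¬∃ j, m j = k) (b : Bool) :
    Function.extend m y (Function.update x k b) = Function.update (Function.extend m y x) k b := by
  funext i
  by_cases hi : i = k
  · subst hi
    rw [Function.extend_apply' _ _ _ hk, Function.update_self, Function.update_self]
  · rw [Function.update_of_ne hi]
    by_cases h : ∃ j, m j = i
    · simp only [Function.extend_def, h, dif_pos]
    · rw [Function.extend_apply' _ _ _ h, Function.extend_apply' _ _ _ h,
        Function.update_of_ne hi]

end Cube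

theorem signAverage_comp_le {m : Fin d → Fin D} (hm : Function.Injective m) (v : Fin D → ℝ) :
    signAverage .independent (v ∘ m) ≤ signAverage .independent v := by
  classical
  have h1 : ∀ τ : Cube D, ∑ j, bitSign (τ (m j)) * v (m j) =
      (1 / 2) * (∑ k, bitSign (τ k) * v k +
        ∑ k, bitSign (τ k ^^ Function.extend m (fun _ => false) (fun _ => true) k) * v k) := by
    intro τ
    rw [← sum_add_distrib, mul_sum]
    have h2 : ∀ k, (1 / 2 : ℝ) * (bitSign (τ k) * v k +
        bitSign (τ k ^^ Function.extend m (fun _ => false) (fun _ => true) k) * v k) =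
        if ∃ j, m j = k then bitSign (τ k) * v k else 0 := by
      intro k
      by_cases h : ∃ j, m j = k
      · rw [if_pos h]
        obtain ⟨j, rfl⟩ := h
        rw [hm.extend_apply, Bool.xor_false]
        ring
      · rw [if_neg h, Function.extend_apply' _ _ _ h, Bool.xor_true, bitSign_not]
        ring
    rw [sum_congr rfl fun k _ => h2 k, ← sum_filter]
    have h3 : (univ.filter fun k => ∃ j, m j = k) = univ.image m := by
      ext k
      simp
    rw [h3, sum_image fun _ _ _ _ h => hm h]
  simp only [signAverage]
  rw [← Cube.expect_comp hm fun σ : Cube d => |∑ j, bitSign (σ j) * (v ∘ m) j|]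
  simp only [Function.comp_apply, h1]
  calc 𝔼 τ : Cube D, |(1 / 2) * (∑ k, bitSign (τ k) * v k +
        ∑ k, bitSign (τ k ^^ Function.extend m (fun _ => false) (fun _ => true) k) * v k)|
      ≤ 𝔼 τ : Cube D, ((1 / 2) * |∑ k, bitSign (τ k) * v k| + (1 / 2) *
        |∑ k, bitSign (τ k ^^ Function.extend m (fun _ => false) (fun _ => true) k) * v k|) := by
        refine expect_le_expect fun τ _ => ?_
        rw [abs_mul, abs_of_pos (by norm_num : (0 : ℝ) < 1 / 2), ← mul_add]
        exact mul_le_mul_of_nonneg_left (abs_add_le _ _) (by norm_num)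
    _ = 𝔼 τ : Cube D, |∑ k, bitSign (τ k) * v k| := by
        rw [expect_add_distrib, ← mul_expect, ← mul_expect,
          expect_xor (Function.extend m (fun _ => false) fun _ => true)
            fun τ : Cube D => |∑ k, bitSign (τ k) * v k|]
        ring

theorem signAverage_extend_zero (r : RademacherChoice) {m : Fin d → Fin D}
    (hm : Function.Injective m) (v : Fin d → ℝ) :
    signAverage r (fun k => ∑ j, if m j = k then v j else 0) = signAverage r v := by
  cases r
  · simp only [signAverage]
    rw [← Cube.expect_comp hm fun σ : Cube d => |∑ j, bitSign (σ j) * v j|]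
    refine expect_congr rfl fun τ _ => ?_
    congr 1
    simp only [mul_sum]
    rw [sum_comm]
    simp
  · simp only [signAverage]
    rw [sum_comm]
    simp

namespace Coef

/-- The embedding `h_I ↦ ∑ h_K`, where for `I` of level `j` with address `v` the sum extends over
the intervals `K` of level `m j` whose digits at the positions `m 0, …, m (j - 1)` form `v`. -/
noncomputable def spread (m : Fin d → Fin D) : Coef d →ₗ[ℝ] Coef D where
  toFun a k w := ∑ j, if m j = k then a j (Cube.trunc (Cube.pad D w ∘ m) j) else 0
  map_add' a b := by
    funext k w
    simp only [Pi.add_apply, ← sum_add_distrib]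
    exact sum_congr rfl fun j _ => by split_ifs <;> simp
  map_smul' c a := by
    funext k w
    simp only [Pi.smul_apply, smul_eq_mul, RingHom.id_apply, mul_sum]
    exact sum_congr rfl fun j _ => by split_ifs <;> simp

theorem spread_apply (m : Fin d → Fin D) (a : Coef d) (k : Fin D) (w : Cube k) :
    spread m a k w = ∑ j, if m j = k then a j (Cube.trunc (Cube.pad D w ∘ m) j) else 0 := rfl

/-- The left inverse of `spread m` that averages the coefficients of the levels in the range of
`m` over the other digits of the address. -/
noncomputable def compress (m : Fin d → Fin D) : Coef D →ₗ[ℝ] Coef d where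
  toFun b j v := 𝔼 x : Cube D, b (m j) (Cube.trunc (Function.extend m (Cube.pad d v) x) (m j))
  map_add' a b := by
    funext k w
    simp only [Pi.add_apply, ← expect_add_distrib]
  map_smul' c a := by
    funext k w
    simp only [Pi.smul_apply, smul_eq_mul, RingHom.id_apply, mul_expect]

theorem compress_apply (m : Fin d → Fin D) (b : Coef D) (j : Fin d) (v : Cube j) :
    compress m b j v =
      𝔼 x : Cube D, b (m j) (Cube.trunc (Function.extend m (Cube.pad d v) x) (m j)) := rfl

variable {m : Fin d → Fin D}

theorem trunc_pad_comp (hm : StrictMono m) (x : Cube D) (j : Fin d) :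
    Cube.trunc (Cube.pad D (x.trunc (m j)) ∘ m) j = Cube.trunc (x ∘ m) j := by
  rw [Cube.trunc_eq_iff]
  intro i hi
  exact Cube.pad_trunc_apply x (hm hi)

theorem trunc_extend_pad (hm : StrictMono m) (y : Cube d) (x : Cube D) (j : Fin d) :
    Cube.trunc (Function.extend m (Cube.pad d (y.trunc j)) x) (m j) =
      Cube.trunc (Function.extend m y x) (m j) := by
  rw [Cube.trunc_eq_iff]
  intro i hi
  by_cases h : ∃ j', m j' = i
  · obtain ⟨j', rfl⟩ := h
    rw [hm.injective.extend_apply, hm.injective.extend_apply,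
      Cube.pad_trunc_apply y (hm.lt_iff_lt.1 hi)]
  · rw [Function.extend_apply' _ _ _ h, Function.extend_apply' _ _ _ h]

theorem compress_trunc (hm : StrictMono m) (b : Coef D) (y : Cube d) (j : Fin d) :
    compress m b j (y.trunc j) =
      𝔼 x : Cube D, b (m j) (Cube.trunc (Function.extend m y x) (m j)) := by
  simp only [compress_apply, trunc_extend_pad hm]

theorem term_spread (hm : StrictMono m) (a : Coef d) (x : Cube D) (k : Fin D) :
    (spread m a).term x k = ∑ j, if m j = k then a.term (x ∘ m) j else 0 := by
  rw [term, spread_apply, sum_mul]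
  refine sum_congr rfl fun j _ => ?_
  split_ifs with h
  · subst h
    rw [trunc_pad_comp hm]
    rfl
  · rw [zero_mul]

theorem term_compress (hm : StrictMono m) (b : Coef D) (y : Cube d) (j : Fin d) :
    (compress m b).term y j = 𝔼 x : Cube D, b.term (Function.extend m y x) (m j) := by
  rw [term, compress_trunc hm, expect_mul]
  refine expect_congr rfl fun x _ => ?_
  rw [term, hm.injective.extend_apply]

theorem compress_spread (hm : StrictMono m) (a : Coef d) : compress m (spread m a) = a := by
  funext j v
  rw [compress_apply]
  have : ∀ x : Cube D,
      spread m a (m j) (Cube.trunc (Function.extend m (Cube.pad d v) x) (m j)) = a j v := by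
    intro x
    rw [spread_apply, sum_eq_single j]
    · rw [if_pos rfl, trunc_pad_comp hm]
      congr 1
      have : Function.extend m (Cube.pad d v) x ∘ m = Cube.pad d v := by
        funext i
        exact hm.injective.extend_apply _ _ _
      rw [this, Cube.trunc_pad]
    · intro j' _ hj'
      rw [if_neg fun h => hj' (hm.injective h)]
    · simp
  simp only [this]
  exact Fintype.expect_const _

theorem term_update_self (b : Coef D) (x : Cube D) (k : Fin D) :
    b.term (Function.update x k (!x k)) k = -b.term x k := by
  rw [term, term, Cube.trunc_update le_rfl, Function.update_self, bitSign_not, mul_neg]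

theorem term_update_of_lt (b : Coef D) (x : Cube D) {j k : Fin D} (h : j < k) (c : Bool) :
    b.term (Function.update x k c) j = b.term x j := by
  rw [term, term, Cube.trunc_update h.le, Function.update_of_ne h.ne]

theorem signAverage_compress_le (r : RademacherChoice) (hm : StrictMono m) (b : Coef D)
    (y : Cube d) : signAverage r ((compress m b).term y) ≤
      𝔼 x : Cube D, signAverage r (b.term (Function.extend m y x)) := by
  have h0 : (compress m b).term y = fun j => 𝔼 x : Cube D, b.term (Function.extend m y x) (m j) :=
    funext fun j => term_compress hm b y j
  rw [h0]
  cases r with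
  | independent =>
    calc signAverage .independent (fun j => 𝔼 x : Cube D, b.term (Function.extend m y x) (m j))
        = 𝔼 σ : Cube d, |𝔼 x : Cube D,
            ∑ j, bitSign (σ j) * (b.term (Function.extend m y x) ∘ m) j| := by
          simp only [signAverage]
          refine expect_congr rfl fun σ _ => ?_
          rw [expect_sum_comm]
          simp only [mul_expect, Function.comp_apply]
      _ ≤ 𝔼 σ : Cube d, 𝔼 x : Cube D,
            |∑ j, bitSign (σ j) * (b.term (Function.extend m y x) ∘ m) j| :=
          expect_le_expect fun σ _ => abs_expect_le _ _
      _ = 𝔼 x : Cube D, signAverage .independent (b.term (Function.extend m y x) ∘ m) :=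
          expect_comm _ _ _
      _ ≤ _ := expect_le_expect fun x _ => signAverage_comp_le hm.injective _
  | constant =>
    -- the levels outside the range of `m` average to zero
    have h1 : ∑ j, 𝔼 x : Cube D, b.term (Function.extend m y x) (m j) =
        𝔼 x : Cube D, ∑ k, b.term (Function.extend m y x) k := by
      rw [expect_sum_comm, ← sum_image (s := univ) (g := m)
        (f := fun k => 𝔼 x : Cube D, b.term (Function.extend m y x) k)
        fun _ _ _ _ h => hm.injective h]
      refine sum_subset (subset_univ _) fun k _ hk => ?_
      have hk' : ¬∃ j, m j = k := by simpa using hk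
      refine expect_eq_zero_of_flip k _ fun x => ?_
      have h2 : x k = Function.extend m y x k := (Function.extend_apply' _ _ _ hk').symm
      rw [Cube.extend_update _ _ hk', h2, term_update_self]
    simp only [signAverage]
    rw [h1]
    exact abs_expect_le _ _

/-- Up to a factor, the coefficients of `compress m b` are the inner products of `b` with the
images of the Haar functions under `spread m`. -/
theorem compress_eq_expect (hm : StrictMono m) (b : Coef D) (j : Fin d) (v : Cube j) :
    compress m b j v = 2 ^ (j : ℕ) * 𝔼 w : Cube (m j),
      b (m j) w * if Cube.trunc (Cube.pad D w ∘ m) j = v then 1 else 0 := by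
  have h1 : 𝔼 w : Cube (m j), b (m j) w * (if Cube.trunc (Cube.pad D w ∘ m) j = v then 1 else 0) =
      𝔼 x : Cube D, b (m j) (x.trunc (m j)) * if Cube.trunc (x ∘ m) j = v then 1 else 0 := by
    rw [← Cube.expect_trunc (m j)]
    simp only [trunc_pad_comp hm]
  have h2 : ∀ (y : Cube d) (x : Cube D), Function.extend m y x ∘ m = y := fun y x =>
    funext fun i => hm.injective.extend_apply _ _ _
  rw [h1, ← Cube.expect_expect_extend hm.injective]
  simp only [h2, ← expect_mul, ← compress_trunc hm]
  rw [Cube.expect_trunc j fun v' => compress m b j v' * if v' = v then 1 else 0]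
  simp only [mul_ite, mul_one, mul_zero, Fintype.expect_eq_sum_div_card, sum_ite_eq', mem_univ,
    if_true]
  simp
  field_simp

end Coef

/-- The nodes of the first `D` levels of the dyadic tree. -/
abbrev TreeNode (D : ℕ) : Type := Σ k : Fin D, Cube k

/-- The tree automorphism that interchanges the two halves of every interval `I` with
`ε I = true`, as a map of cells. -/
def treeMap (ε : TreeNode D → Bool) (x : Cube D) : Cube D := fun k => x k ^^ ε ⟨k, x.trunc k⟩

theorem eq_of_treeMap_eq (ε : TreeNode D → Bool) (x y : Cube D) (k : Fin D)
    (h : ∀ i ≤ k, treeMap ε x i = treeMap ε y i) : x k = y k := by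
  induction k using WellFoundedLT.induction with
  | _ k ih =>
    have h1 : x.trunc k = y.trunc k := by
      rw [Cube.trunc_eq_iff]
      exact fun i hi => ih i hi fun j hj => h j (hj.trans hi.le)
    have h2 := h k le_rfl
    simp only [treeMap, h1] at h2
    exact Bool.xor_left_inj.1 h2

theorem treeMap_bijective (ε : TreeNode D → Bool) : Function.Bijective (treeMap ε) :=
  Finite.injective_iff_bijective.1 fun x y h =>
    funext fun k => eq_of_treeMap_eq ε x y k fun i _ => congrFun h i

/-- The action of a tree automorphism on the nodes of level `k`. -/
def nodeMap (ε : TreeNode D → Bool) (k : Fin D) (w : Cube k) : Cube k :=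
  (treeMap ε (Cube.pad D w)).trunc k

theorem trunc_treeMap (ε : TreeNode D → Bool) (x : Cube D) (k : Fin D) :
    (treeMap ε x).trunc k = nodeMap ε k (x.trunc k) := by
  rw [nodeMap, Cube.trunc_eq_iff]
  intro i hi
  have h1 : (Cube.pad D (x.trunc k)).trunc i = x.trunc i := by
    rw [Cube.trunc_eq_iff]
    exact fun j hj => Cube.pad_trunc_apply x (hj.trans hi)
  simp only [treeMap, h1, Cube.pad_trunc_apply x hi]

theorem nodeMap_bijective (ε : TreeNode D → Bool) (k : Fin D) :
    Function.Bijective (nodeMap ε k) := by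
  refine Finite.injective_iff_bijective.1 fun v w h => ?_
  rw [nodeMap, nodeMap, Cube.trunc_eq_iff] at h
  rw [← Cube.trunc_pad v, ← Cube.trunc_pad w, Cube.trunc_eq_iff]
  exact fun i hi => eq_of_treeMap_eq ε _ _ i fun j hj => h j (hj.trans_lt hi)

namespace Coef

/-- The action of a tree automorphism on Haar coefficients, which is the composition of functions
with `treeMap ε`. -/
noncomputable def twist (ε : TreeNode D → Bool) : Coef D ≃ₗ[ℝ] Coef D where
  toFun a k w := bitSign (ε ⟨k, w⟩) * a k (nodeMap ε k w)
  invFun b k w := bitSign (ε ⟨k, (Equiv.ofBijective _ (nodeMap_bijective ε k)).symm w⟩) *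
    b k ((Equiv.ofBijective _ (nodeMap_bijective ε k)).symm w)
  map_add' a b := by
    funext k w
    simp only [Pi.add_apply, mul_add]
  map_smul' c a := by
    funext k w
    simp only [Pi.smul_apply, smul_eq_mul, RingHom.id_apply]
    ring
  left_inv a := by
    funext k w
    simp only
    rw [← mul_assoc, bitSign_mul_self, one_mul]
    congr 1
    exact (Equiv.ofBijective _ (nodeMap_bijective ε k)).apply_symm_apply w
  right_inv a := by
    funext k w
    have : (Equiv.ofBijective _ (nodeMap_bijective ε k)).symm (nodeMap ε k w) = w :=
      (Equiv.ofBijective _ (nodeMap_bijective ε k)).symm_apply_apply w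
    simp only
    rw [this, ← mul_assoc, bitSign_mul_self, one_mul]

theorem twist_apply (ε : TreeNode D → Bool) (a : Coef D) (k : Fin D) (w : Cube k) :
    twist ε a k w = bitSign (ε ⟨k, w⟩) * a k (nodeMap ε k w) := rfl

theorem term_twist (ε : TreeNode D → Bool) (a : Coef D) (x : Cube D) :
    (twist ε a).term x = a.term (treeMap ε x) := by
  funext k
  rw [term, twist_apply, term, trunc_treeMap, treeMap, bitSign_xor]
  ring

end Coef

namespace HaarSystemSpace

variable {X : HaarSystemSpace} {r : RademacherChoice} {m : Fin d → Fin D}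

theorem coefNorm_spread (hm : StrictMono m) (a : Coef d) :
    X.coefNorm r (Coef.spread m a) = X.coefNorm r a := by
  unfold coefNorm
  rw [← cubeNorm_comp (equidistributed_comp hm.injective)]
  congr 1
  funext x
  have : (Coef.spread m a).term x = fun k => ∑ j, if m j = k then a.term (x ∘ m) j else 0 :=
    funext fun k => Coef.term_spread hm a x k
  rw [this, signAverage_extend_zero r hm.injective]
  rfl

theorem coefNorm_compress_le (hm : StrictMono m) (b : Coef D) :
    X.coefNorm r (Coef.compress m b) ≤ X.coefNorm r b := by
  unfold coefNorm
  refine le_trans (cubeNorm_mono fun y => ?_) (cubeNorm_expect_extend_le hm.injective _)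
  rw [abs_of_nonneg (signAverage_nonneg _ _)]
  exact (Coef.signAverage_compress_le r hm b y).trans (le_abs_self _)

theorem coefNorm_twist (ε : TreeNode D → Bool) (a : Coef D) :
    X.coefNorm r (Coef.twist ε a) = X.coefNorm r a := by
  unfold coefNorm
  simp only [Coef.term_twist]
  exact cubeNorm_comp (equidistributed_equiv (Equiv.ofBijective _ (treeMap_bijective ε)))
    fun x => signAverage r (a.term x)

theorem coefNorm_twist_symm (ε : TreeNode D → Bool) (a : Coef D) :
    X.coefNorm r ((Coef.twist ε).symm a) = X.coefNorm r a := by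
  rw [← coefNorm_twist ε, LinearEquiv.apply_symm_apply]

/-- A single level carries the norm of `X`. -/
theorem coefNorm_single (k : Fin D) (g : Cube k → ℝ) :
    X.coefNorm r (Pi.single k g : Coef D) = X.cubeNorm k g := by
  have h1 : ∀ x : Cube D, Coef.term (Pi.single k g) x =
      fun j => if j = k then g (x.trunc k) * bitSign (x k) else 0 := by
    intro x
    funext j
    rw [Coef.term]
    by_cases h : j = k
    · subst h
      rw [Pi.single_eq_same, if_pos rfl]
    · rw [if_neg h, Pi.single_eq_of_ne h]
      simp
  unfold coefNorm
  rw [← cubeNorm_comp (Cube.equidistributed_trunc k)]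
  simp only [h1, signAverage_single, abs_mul, abs_bitSign, mul_one]
  apply le_antisymm <;> exact cubeNorm_mono fun x => by simp

/-- Conditionally on the first `k` digits, the average of the random sums dominates the
coefficient of level `k`. -/
theorem abs_le_expect_signAverage (r : RademacherChoice) (a : Coef D) (k : Fin D) (y : Cube k) :
    |a k y| ≤ 𝔼 x : Cube D, signAverage r (a.term
      (Function.extend (fun i : Fin k => (⟨i, i.2.trans k.2⟩ : Fin D)) y x)) := by
  set m : Fin k → Fin D := fun i => ⟨i, i.2.trans k.2⟩ with hmdef
  have hm : StrictMono m := fun i j h => h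
  have hlt : ∀ j, (∃ i, m i = j) → j < k := by
    rintro j ⟨i, rfl⟩
    exact i.2
  have htr : ∀ x, Cube.trunc (Function.extend m y x) k = y := by
    intro x
    funext i
    exact hm.injective.extend_apply _ _ i
  have hk : ∀ x, Function.extend m y x k = x k := fun x =>
    Function.extend_apply' _ _ _ fun h => (hlt k h).false
  have hterm : ∀ x, a.term (Function.extend m y x) k = a k y * bitSign (x k) := by
    intro x
    rw [Coef.term, htr, hk]
  cases r with
  | independent =>
    have h1 : ∀ x, |a k y| ≤ signAverage .independent (a.term (Function.extend m y x)) := by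
      intro x
      have h2 := signAverage_comp_le (m := fun _ : Fin 1 => k)
        (fun _ _ _ => Subsingleton.elim _ _) (a.term (Function.extend m y x))
      refine le_trans (le_of_eq ?_) h2
      simp only [signAverage, Function.comp_apply, Fin.sum_univ_one, Fin.isValue, hterm, abs_mul,
        abs_bitSign, one_mul, mul_one]
      exact (Fintype.expect_const _).symm
    calc |a k y| = 𝔼 _x : Cube D, |a k y| := (Fintype.expect_const _).symm
      _ ≤ _ := expect_le_expect fun x _ => h1 x
  | constant =>
    have h1 : a k y = 𝔼 x : Cube D, bitSign (x k) * ∑ j, a.term (Function.extend m y x) j := by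
      simp only [mul_sum]
      rw [expect_sum_comm, sum_eq_single k]
      · simp only [hterm]
        have : ∀ x : Cube D, bitSign (x k) * (a k y * bitSign (x k)) = a k y := by
          intro x
          rw [mul_comm, mul_assoc, bitSign_mul_self, mul_one]
        simp only [this]
        exact (Fintype.expect_const _).symm
      · intro j _ hj
        rcases lt_or_gt_of_ne hj with h | h
        · refine Cube.expect_sign_mul_eq_zero k _ fun x => ?_
          rw [Cube.extend_update _ _ fun h' => (hlt k h').false, Coef.term_update_of_lt _ _ h]
        · have hj' : ¬∃ i, m i = j := fun h' => ((hlt j h').trans h).false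
          refine expect_eq_zero_of_flip j _ fun x => ?_
          have h2 : x j = Function.extend m y x j := (Function.extend_apply' _ _ _ hj').symm
          rw [Cube.extend_update _ _ hj', h2, Coef.term_update_self, Function.update_of_ne h.ne,
            mul_neg]
      · simp
    calc |a k y| ≤ 𝔼 x : Cube D, |bitSign (x k) * ∑ j, a.term (Function.extend m y x) j| := by
          rw [h1]
          exact abs_expect_le _ _
      _ = _ := by simp only [abs_mul, abs_bitSign, one_mul, signAverage]

/-- The projection onto a single level is contractive. -/
theorem cubeNorm_level_le (a : Coef D) (k : Fin D) : X.cubeNorm k (a k) ≤ X.coefNorm r a := by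
  unfold coefNorm
  refine le_trans (cubeNorm_mono fun y => ?_) (cubeNorm_expect_extend_le
    (m := fun i : Fin k => (⟨i, i.2.trans k.2⟩ : Fin D))
    (fun _ _ h => Fin.ext (Fin.mk.inj_iff.1 h)) _)
  exact (abs_le_expect_signAverage r a k y).trans (le_abs_self _)

end HaarSystemSpace

end CoefMaps

/-! ### Norms of indicator functions of dyadic intervals -/

section PointNorm

open Finset
open scoped BigOperators

namespace HaarSystemSpace

variable (X : HaarSystemSpace)

/-- The norm `‖χ_I‖_X` of the indicator function of a dyadic interval of level `k`. -/
noncomputable def pointNorm (k : ℕ) : ℝ := X.cubeNorm k (Pi.single (fun _ => false) 1)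

variable {X} {k l : ℕ}

theorem cubeNorm_single (w : Cube k) (c : ℝ) :
    X.cubeNorm k (Pi.single w c) = |c| * X.pointNorm k := by
  have hinv : Function.Involutive fun (x : Cube k) (i : Fin k) => x i ^^ w i := by
    intro x
    funext i
    simp
  have h1 : (Pi.single w c : Cube k → ℝ) =
      c • ((Pi.single (fun _ => false) 1 : Cube k → ℝ) ∘ (hinv.toPerm : Equiv.Perm (Cube k))) := by
    funext x
    have h2 : (hinv.toPerm : Equiv.Perm (Cube k)) x = (fun _ => false) ↔ x = w := by
      constructor
      · intro h
        funext i
        have h3 : (x i ^^ w i) = false := congrFun h i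
        simpa using h3
      · rintro rfl
        funext i
        change (x i ^^ x i) = false
        simp
    simp only [Pi.single_apply, Pi.smul_apply, Function.comp_apply, h2, smul_eq_mul, mul_ite,
      mul_one, mul_zero]
  rw [h1, map_smul_eq_mul, cubeNorm_comp (equidistributed_equiv _), Real.norm_eq_abs]
  rfl

theorem abs_mul_pointNorm_le (g : Cube k → ℝ) (w : Cube k) :
    |g w| * X.pointNorm k ≤ X.cubeNorm k g := by
  rw [← cubeNorm_single w]
  refine cubeNorm_mono fun x => ?_
  by_cases h : x = w
  · rw [h, Pi.single_eq_same]
  · rw [Pi.single_eq_of_ne h, abs_zero]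
    exact abs_nonneg _

/-- The norm of `X` dominates the norm of `L¹`. -/
theorem expect_abs_le_cubeNorm (g : Cube k → ℝ) : 𝔼 w, |g w| ≤ X.cubeNorm k g := by
  have h1 : ∀ (y : Cube 0) (x : Cube k), Function.extend Fin.elim0 y x = x := fun y x =>
    funext fun i => Function.extend_apply' _ _ _ fun ⟨j, _⟩ => j.elim0
  have h2 := X.cubeNorm_expect_extend_le (m := (Fin.elim0 : Fin 0 → Fin k))
    (fun j => j.elim0) (fun x => |g x|)
  simp only [h1] at h2
  rw [cubeNorm_const, abs_of_nonneg (expect_nonneg fun _ _ => abs_nonneg _)] at h2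
  exact h2.trans (cubeNorm_mono fun x => by simp)

theorem cubeNorm_le_one {g : Cube k → ℝ} (h : ∀ w, |g w| ≤ 1) : X.cubeNorm k g ≤ 1 := by
  refine (cubeNorm_mono fun x => ?_).trans (cubeNorm_const (X := X) (D := k) 1).le |>.trans
    abs_one.le
  rw [abs_one]
  exact h x

theorem pointNorm_zero : X.pointNorm 0 = 1 := by
  refine Eq.trans ?_ ((cubeNorm_const (X := X) (D := 0) 1).trans abs_one)
  refine congrArg (X.cubeNorm 0) (funext fun x => ?_)
  rw [Subsingleton.elim x fun _ => false, Pi.single_eq_same]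

theorem pointNorm_eq_succ : X.pointNorm k = X.cubeNorm (k + 1)
    ((Pi.single (fun _ => false) 1 : Cube k → ℝ) ∘ fun x : Cube (k + 1) => x ∘ Fin.castSucc) :=
  (cubeNorm_comp (equidistributed_comp (Fin.castSucc_injective k)) _).symm

theorem pointNorm_succ_le : X.pointNorm (k + 1) ≤ X.pointNorm k := by
  rw [pointNorm_eq_succ (k := k)]
  refine cubeNorm_mono fun x => ?_
  by_cases h : x = fun _ => false
  · subst h
    rw [Pi.single_eq_same]
    simp [Function.comp_def]
  · rw [Pi.single_eq_of_ne h, abs_zero]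
    exact abs_nonneg _

theorem pointNorm_le_succ : X.pointNorm k ≤ 2 * X.pointNorm (k + 1) := by
  set e : Cube (k + 1) := fun i => decide (i = Fin.last k) with he
  have h1 : X.cubeNorm (k + 1) (Pi.single (fun _ => false) 1 + Pi.single e 1) ≤
      2 * X.pointNorm (k + 1) := by
    refine (map_add_le_add _ _ _).trans (le_of_eq ?_)
    rw [cubeNorm_single, cubeNorm_single, abs_one]
    ring
  refine le_trans ?_ h1
  rw [pointNorm_eq_succ]
  refine cubeNorm_mono fun x => ?_
  have hne : (fun _ => false) ≠ e := fun h => by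
    have := congrFun h (Fin.last k)
    simp [he] at this
  by_cases h : x ∘ Fin.castSucc = fun _ => false
  · have hx : ∀ i : Fin k, x i.castSucc = false := fun i => congrFun h i
    have h2 : x = (fun _ => false) ∨ x = e := by
      cases hl : x (Fin.last k)
      · left
        funext i
        refine Fin.lastCases hl hx i
      · right
        funext i
        refine Fin.lastCases ?_ (fun i => ?_) i
        · simp [he, hl]
        · simp [he, hx, Fin.castSucc_ne_last]
    rcases h2 with rfl | rfl
    · simp [Function.comp_def, Pi.single_eq_of_ne hne]
    · simp [h, Pi.single_eq_of_ne hne.symm]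
  · simp [Function.comp_apply, Pi.single_eq_of_ne h]

theorem pointNorm_pos (k : ℕ) : 0 < X.pointNorm k := by
  induction k with
  | zero => rw [pointNorm_zero]; exact one_pos
  | succ k ih =>
    have := pointNorm_le_succ (X := X) (k := k)
    linarith

theorem pointNorm_antitone : Antitone X.pointNorm := antitone_nat_of_succ_le fun _ => pointNorm_succ_le

theorem pow_mul_pointNorm_monotone : Monotone fun k => 2 ^ k * X.pointNorm k := by
  refine monotone_nat_of_le_succ fun k => ?_
  have := pointNorm_le_succ (X := X) (k := k)
  rw [pow_succ, mul_assoc]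
  exact mul_le_mul_of_nonneg_left this (by positivity)

theorem pointNorm_le_one (k : ℕ) : X.pointNorm k ≤ 1 := by
  rw [← pointNorm_zero (X := X)]
  exact pointNorm_antitone (Nat.zero_le k)

theorem one_le_pow_mul_pointNorm (k : ℕ) : 1 ≤ 2 ^ k * X.pointNorm k := by
  have := pow_mul_pointNorm_monotone (X := X) (Nat.zero_le k)
  simpa [pointNorm_zero] using this

/-- Of the norm of a dyadic interval of level `k` and the dual norm of one of level `l`, one is
small if `k` and `l` are large. -/
theorem pointNorm_mul_inv_le (k l : ℕ) :
    X.pointNorm k * (2 ^ l * X.pointNorm l)⁻¹ ≤ (2 ^ min k l)⁻¹ := by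
  have hk := pointNorm_pos (X := X) k
  have hl := pointNorm_pos (X := X) l
  rw [← div_eq_mul_inv, div_le_iff₀ (by positivity)]
  rcases le_total k l with h | h
  · rw [min_eq_left h]
    have := pow_mul_pointNorm_monotone (X := X) h
    simp only at this
    rw [← div_eq_inv_mul, le_div_iff₀ (by positivity), mul_comm]
    exact this
  · rw [min_eq_right h, inv_mul_cancel_left₀ (by positivity)]
    exact pointNorm_antitone h

end HaarSystemSpace

end PointNorm

/-! ### Orthogonality of random signs and the Hilbert–Schmidt bound -/

section HilbertSchmidt

open Finset
open scoped BigOperators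

/-- The terms of a sum of random signs with coefficients are orthogonal if, for any two of them,
the coefficients of both do not depend on the sign of one. -/
theorem expect_sq_sum {ι κ : Type*} [Fintype ι] [DecidableEq ι] [DecidableEq κ] (S : Finset κ)
    (p : κ → ι) (x : κ → (ι → Bool) → ℝ)
    (h : ∀ i ∈ S, ∀ j ∈ S, i ≠ j → p i ≠ p j ∧ ∃ q, (q = p i ∨ q = p j) ∧
      ∀ ω b, x i (Function.update ω q b) = x i ω ∧ x j (Function.update ω q b) = x j ω) :
    𝔼 ω : ι → Bool, (∑ i ∈ S, bitSign (ω (p i)) * x i ω) ^ 2 =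
      ∑ i ∈ S, 𝔼 ω : ι → Bool, x i ω ^ 2 := by
  simp only [sq, sum_mul_sum]
  rw [expect_sum_comm]
  refine sum_congr rfl fun i hi => ?_
  rw [expect_sum_comm, sum_eq_single i]
  · refine expect_congr rfl fun ω _ => ?_
    rw [mul_mul_mul_comm, bitSign_mul_self, one_mul]
  · intro j hj hji
    obtain ⟨hp, q, hq, hx⟩ := h i hi j hj hji.symm
    refine expect_eq_zero_of_flip q _ fun ω => ?_
    rw [(hx ω _).1, (hx ω _).2]
    rcases hq with rfl | rfl
    · rw [Function.update_self, Function.update_of_ne hp.symm, bitSign_not]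
      ring
    · rw [Function.update_self, Function.update_of_ne hp, bitSign_not]
      ring
  · exact fun h' => absurd hi h'

theorem expect_sq_sum_const {ι : Type*} [Fintype ι] [DecidableEq ι] (y : ι → ℝ) :
    𝔼 ω : ι → Bool, (∑ i, bitSign (ω i) * y i) ^ 2 = ∑ i, y i ^ 2 := by
  refine (expect_sq_sum univ id (fun i _ => y i) fun i _ j _ hij =>
    ⟨hij, i, Or.inl rfl, fun _ _ => ⟨rfl, rfl⟩⟩).trans ?_
  exact sum_congr rfl fun i _ => Fintype.expect_const _

/-- If the entries of a vector are bounded by `a` and its `ℓ¹`-norm by `b`, then the square of its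
`ℓ²`-norm is bounded by `a * b`. -/
theorem sum_sq_le_mul {ι : Type*} [Fintype ι] (y : ι → ℝ) {a b : ℝ} (ha0 : 0 ≤ a)
    (ha : ∀ i, |y i| ≤ a) (hb : ∑ i, |y i| ≤ b) : ∑ i, y i ^ 2 ≤ a * b := by
  calc ∑ i, y i ^ 2 ≤ ∑ i, a * |y i| := sum_le_sum fun i _ => by
        rw [← sq_abs, sq]
        exact mul_le_mul_of_nonneg_right (ha i) (abs_nonneg _)
    _ = a * ∑ i, |y i| := (mul_sum _ _ _).symm
    _ ≤ a * b := mul_le_mul_of_nonneg_left hb ha0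

theorem exists_bitSign_mul_eq_abs (c : ℝ) : ∃ b : Bool, bitSign b * c = |c| := by
  rcases le_total 0 c with h | h
  · exact ⟨false, by simp [abs_of_nonneg h]⟩
  · exact ⟨true, by simp [abs_of_nonpos h]⟩

namespace HaarSystemSpace

variable {X : HaarSystemSpace} {k l : ℕ} {C : ℝ} {t : Cube k → Cube l → ℝ}

theorem sum_sq_entries_le_pointNorm (hC : 0 ≤ C)
    (ht : ∀ g : Cube k → ℝ, X.cubeNorm l (fun L => ∑ K, g K * t K L) ≤ C * X.cubeNorm k g) :
    ∑ K, ∑ L, (t K L / 2 ^ l) ^ 2 ≤ C ^ 2 * X.pointNorm k := by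
  have hrow : ∀ K, 𝔼 L, |t K L| ≤ C * X.pointNorm k := by
    intro K
    have h1 := ht (Pi.single K 1)
    rw [cubeNorm_single, abs_one, one_mul] at h1
    refine le_trans ?_ ((expect_abs_le_cubeNorm _).trans h1)
    simp [Pi.single_apply]
  have key : ∀ θ : Cube l → Bool,
      ∑ K, (∑ L, bitSign (θ L) * (t K L / 2 ^ l)) ^ 2 ≤ C * X.pointNorm k * C := by
    intro θ
    have he : ∀ K, ∑ L, bitSign (θ L) * (t K L / 2 ^ l) = 𝔼 L, bitSign (θ L) * t K L := by
      intro K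
      rw [Fintype.expect_eq_sum_div_card, sum_div]
      exact sum_congr rfl fun L _ => by simp [mul_div_assoc]
    refine sum_sq_le_mul _ (mul_nonneg hC (pointNorm_pos k).le) (fun K => ?_) ?_
    · rw [he]
      refine (abs_expect_le _ _).trans (le_trans (le_of_eq ?_) (hrow K))
      simp only [abs_mul, abs_bitSign, one_mul]
    · choose s hs using fun K => exists_bitSign_mul_eq_abs (∑ L, bitSign (θ L) * (t K L / 2 ^ l))
      have h1 := ht fun K => bitSign (s K)
      have h2 : X.cubeNorm k (fun K => bitSign (s K)) ≤ 1 := cubeNorm_le_one fun w => by simp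
      calc ∑ K, |∑ L, bitSign (θ L) * (t K L / 2 ^ l)|
          = 𝔼 L, bitSign (θ L) * ∑ K, bitSign (s K) * t K L := by
            simp only [mul_sum]
            rw [expect_sum_comm]
            refine sum_congr rfl fun K _ => ?_
            rw [← hs K, he, mul_expect]
            exact expect_congr rfl fun L _ => by ring
        _ ≤ 𝔼 L, |∑ K, bitSign (s K) * t K L| := by
            refine expect_le_expect fun L _ => (le_abs_self _).trans (le_of_eq ?_)
            rw [abs_mul, abs_bitSign, one_mul]
        _ ≤ C * X.cubeNorm k fun K => bitSign (s K) := (expect_abs_le_cubeNorm _).trans h1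
        _ ≤ C * 1 := mul_le_mul_of_nonneg_left h2 hC
        _ = C := mul_one C
  calc ∑ K, ∑ L, (t K L / 2 ^ l) ^ 2
      = 𝔼 θ : Cube l → Bool, ∑ K, (∑ L, bitSign (θ L) * (t K L / 2 ^ l)) ^ 2 := by
        rw [expect_sum_comm]
        exact sum_congr rfl fun K _ => (expect_sq_sum_const _).symm
    _ ≤ 𝔼 _θ : Cube l → Bool, C * X.pointNorm k * C := expect_le_expect fun θ _ => key θ
    _ = C ^ 2 * X.pointNorm k := by rw [Fintype.expect_const]; ring

theorem sum_sq_entries_le_inv_pointNorm (hC : 0 ≤ C)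
    (ht : ∀ g : Cube k → ℝ, X.cubeNorm l (fun L => ∑ K, g K * t K L) ≤ C * X.cubeNorm k g) :
    ∑ K, ∑ L, (t K L / 2 ^ l) ^ 2 ≤ C ^ 2 * (2 ^ l * X.pointNorm l)⁻¹ := by
  have hl := pointNorm_pos (X := X) l
  have key : ∀ θ : Cube k → Bool,
      ∑ L, (∑ K, bitSign (θ K) * (t K L / 2 ^ l)) ^ 2 ≤ C * (2 ^ l * X.pointNorm l)⁻¹ * C := by
    intro θ
    have h1 : X.cubeNorm l (fun L => ∑ K, bitSign (θ K) * t K L) ≤ C := by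
      refine (ht fun K => bitSign (θ K)).trans ?_
      have h2 : X.cubeNorm k (fun K => bitSign (θ K)) ≤ 1 := cubeNorm_le_one fun w => by simp
      exact (mul_le_mul_of_nonneg_left h2 hC).trans (mul_one C).le
    have he : ∀ L, ∑ K, bitSign (θ K) * (t K L / 2 ^ l) =
        (∑ K, bitSign (θ K) * t K L) / 2 ^ l := by
      intro L
      rw [sum_div]
      exact sum_congr rfl fun K _ => by ring
    simp only [he]
    refine sum_sq_le_mul _ (by positivity) (fun L => ?_) ?_
    · have h2 := (abs_mul_pointNorm_le (X := X) (fun L => ∑ K, bitSign (θ K) * t K L) L).trans h1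
      rw [abs_div, abs_of_pos (by positivity : (0 : ℝ) < 2 ^ l), ← div_eq_mul_inv,
        div_le_div_iff₀ (by positivity) (by positivity)]
      calc _ = 2 ^ l * (|∑ K, bitSign (θ K) * t K L| * X.pointNorm l) := by ring
        _ ≤ 2 ^ l * C := mul_le_mul_of_nonneg_left h2 (by positivity)
        _ = _ := by ring
    · have h2 := (expect_abs_le_cubeNorm (X := X) fun L => ∑ K, bitSign (θ K) * t K L).trans h1
      refine le_trans (le_of_eq ?_) h2
      rw [Fintype.expect_eq_sum_div_card, sum_div]
      exact sum_congr rfl fun L _ => by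
        rw [abs_div, abs_of_pos (by positivity : (0 : ℝ) < 2 ^ l)]
        simp
  calc ∑ K, ∑ L, (t K L / 2 ^ l) ^ 2
      = 𝔼 θ : Cube k → Bool, ∑ L, (∑ K, bitSign (θ K) * (t K L / 2 ^ l)) ^ 2 := by
        rw [expect_sum_comm, sum_comm]
        exact sum_congr rfl fun L _ => (expect_sq_sum_const _).symm
    _ ≤ 𝔼 _θ : Cube k → Bool, C * (2 ^ l * X.pointNorm l)⁻¹ * C :=
        expect_le_expect fun θ _ => key θ
    _ = C ^ 2 * (2 ^ l * X.pointNorm l)⁻¹ := by rw [Fintype.expect_const]; ring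

/-- The Hilbert–Schmidt norm of the block of an operator that maps level `k` to level `l` is small
if both levels are high. -/
theorem sum_sq_entries_le (hC : 0 ≤ C)
    (ht : ∀ g : Cube k → ℝ, X.cubeNorm l (fun L => ∑ K, g K * t K L) ≤ C * X.cubeNorm k g)
    {q : ℕ} (hk : 4 * q ≤ k) (hl : 4 * q ≤ l) :
    ∑ K, ∑ L, (t K L / 2 ^ l) ^ 2 ≤ C ^ 2 / 4 ^ q := by
  have h1 := sum_sq_entries_le_pointNorm hC ht
  have h2 := sum_sq_entries_le_inv_pointNorm hC ht
  have h3 := pointNorm_mul_inv_le (X := X) k l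
  have h0 : 0 ≤ ∑ K, ∑ L, (t K L / 2 ^ l) ^ 2 :=
    sum_nonneg fun _ _ => sum_nonneg fun _ _ => sq_nonneg _
  have h4 : ((2 : ℝ) ^ min k l)⁻¹ ≤ ((4 ^ q) ^ 2)⁻¹ := by
    refine inv_anti₀ (by positivity) ?_
    have : ((4 : ℝ) ^ q) ^ 2 = 2 ^ (4 * q) := by
      rw [← pow_mul, show (4 : ℝ) = 2 ^ 2 by norm_num, ← pow_mul]
      congr 1
      ring
    rw [this]
    exact pow_le_pow_right₀ (by norm_num) (le_min hk hl)
  refine (sq_le_sq₀ h0 (by positivity)).1 ?_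
  calc (∑ K, ∑ L, (t K L / 2 ^ l) ^ 2) ^ 2
      ≤ (C ^ 2 * X.pointNorm k) * (C ^ 2 * (2 ^ l * X.pointNorm l)⁻¹) := by
        rw [sq]
        exact mul_le_mul h1 h2 h0 (by have := pointNorm_pos (X := X) k; positivity)
    _ = (C ^ 2) ^ 2 * (X.pointNorm k * (2 ^ l * X.pointNorm l)⁻¹) := by ring
    _ ≤ (C ^ 2) ^ 2 * ((4 ^ q) ^ 2)⁻¹ := mul_le_mul_of_nonneg_left (h3.trans h4) (by positivity)
    _ = (C ^ 2 / 4 ^ q) ^ 2 := by rw [div_pow, div_eq_mul_inv]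

end HaarSystemSpace

end HilbertSchmidt

/-! ### Second moments of the matrix of a randomly conjugated operator -/

section SecondMoments

open Finset
open scoped BigOperators

variable {D d : ℕ}

/-- The position of a node in an enumeration of the tree that is compatible with the levels. -/
def nodeRank (p : TreeNode D) : ℕ := 2 ^ (p.1 : ℕ) + Cube.code p.1 p.2

theorem level_le_of_nodeRank_le {p q : TreeNode D} (h : nodeRank p ≤ nodeRank q) : p.1 ≤ q.1 := by
  by_contra hlt
  have h1 : 2 ^ ((q.1 : ℕ) + 1) ≤ 2 ^ (p.1 : ℕ) :=
    Nat.pow_le_pow_right (by norm_num) (not_le.1 hlt)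
  have h2 := Cube.code_lt q.1 q.2
  rw [pow_succ] at h1
  unfold nodeRank at h
  omega

theorem nodeRank_injective : Function.Injective (nodeRank (D := D)) := by
  rintro ⟨k, v⟩ ⟨l, w⟩ h
  obtain rfl : k = l := le_antisymm (level_le_of_nodeRank_le h.le) (level_le_of_nodeRank_le h.ge)
  have h1 : Cube.code k v = Cube.code k w := Nat.add_left_cancel h
  rw [Cube.code_injective k h1]

/-- A function of the signs that does not depend on the signs attached to the levels `≥ k`. -/
def IsAdapted (k : Fin D) (f : (TreeNode D → Bool) → ℝ) : Prop :=
  ∀ ω p b, k ≤ p.1 → f (Function.update ω p b) = f ω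

theorem expect_sq_level_sum (k : Fin D) (x : Cube k → (TreeNode D → Bool) → ℝ)
    (hx : ∀ K, IsAdapted k (x K)) :
    𝔼 ω : TreeNode D → Bool, (∑ K, bitSign (ω ⟨k, K⟩) * x K ω) ^ 2 =
      ∑ K, 𝔼 ω : TreeNode D → Bool, x K ω ^ 2 := by
  refine expect_sq_sum univ (fun K => (⟨k, K⟩ : TreeNode D)) x fun K _ L _ hKL => ⟨?_, ?_⟩
  · intro h
    exact hKL (eq_of_heq (Sigma.mk.inj_iff.1 h).2)
  · exact ⟨⟨k, K⟩, Or.inl rfl, fun ω b => ⟨hx K ω _ b le_rfl, hx L ω _ b le_rfl⟩⟩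

/-- The second moment of a random bilinear form whose matrix is strictly triangular with respect to
the enumeration of the tree. -/
theorem expect_sq_triangular_le (k l : Fin D) (x : Cube k → (TreeNode D → Bool) → ℝ)
    (y : Cube l → (TreeNode D → Bool) → ℝ) (hx : ∀ K, IsAdapted k (x K))
    (hy : ∀ L, IsAdapted l (y L)) (hx1 : ∀ K ω, x K ω ^ 2 ≤ 1) (hy1 : ∀ L ω, y L ω ^ 2 ≤ 1)
    (c : Cube k → Cube l → ℝ)
    (hc : ∀ K L, c K L ≠ 0 → nodeRank (⟨k, K⟩ : TreeNode D) < nodeRank (⟨l, L⟩ : TreeNode D)) :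
    𝔼 ω : TreeNode D → Bool, (∑ L, bitSign (ω ⟨l, L⟩) *
        (y L ω * ∑ K, bitSign (ω ⟨k, K⟩) * (x K ω * c K L))) ^ 2 ≤ ∑ K, ∑ L, c K L ^ 2 := by
  have hinv : ∀ L, ∀ q : TreeNode D, q.1 = l → nodeRank (⟨l, L⟩ : TreeNode D) ≤ nodeRank q →
      ∀ ω b, y L (Function.update ω q b) *
          ∑ K, bitSign (Function.update ω q b ⟨k, K⟩) * (x K (Function.update ω q b) * c K L) =
        y L ω * ∑ K, bitSign (ω ⟨k, K⟩) * (x K ω * c K L) := by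
    intro L q hq hLq ω b
    rw [hy L ω q b hq.ge]
    congr 1
    refine sum_congr rfl fun K _ => ?_
    by_cases hKL : c K L = 0
    · rw [hKL]
      ring
    · have h1 := (hc K L hKL).trans_le hLq
      have h2 : (⟨k, K⟩ : TreeNode D) ≠ q := fun h => by
        rw [h] at h1
        exact lt_irrefl _ h1
      rw [Function.update_of_ne h2, hx K ω q b (level_le_of_nodeRank_le h1.le)]
  have h1 : 𝔼 ω : TreeNode D → Bool, (∑ L, bitSign (ω ⟨l, L⟩) *
        (y L ω * ∑ K, bitSign (ω ⟨k, K⟩) * (x K ω * c K L))) ^ 2 =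
      ∑ L, 𝔼 ω : TreeNode D → Bool,
        (y L ω * ∑ K, bitSign (ω ⟨k, K⟩) * (x K ω * c K L)) ^ 2 := by
    refine expect_sq_sum univ (fun L => (⟨l, L⟩ : TreeNode D))
      (fun L ω => y L ω * ∑ K, bitSign (ω ⟨k, K⟩) * (x K ω * c K L))
      fun L _ L' _ hLL => ⟨?_, ?_⟩
    · intro h
      exact hLL (eq_of_heq (Sigma.mk.inj_iff.1 h).2)
    · rcases le_total (nodeRank (⟨l, L⟩ : TreeNode D)) (nodeRank (⟨l, L'⟩ : TreeNode D)) with h | h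
      · exact ⟨⟨l, L'⟩, Or.inr rfl, fun ω b => ⟨hinv L _ rfl h ω b, hinv L' _ rfl le_rfl ω b⟩⟩
      · exact ⟨⟨l, L⟩, Or.inl rfl, fun ω b => ⟨hinv L _ rfl le_rfl ω b, hinv L' _ rfl h ω b⟩⟩
  rw [h1, sum_comm]
  refine sum_le_sum fun L _ => ?_
  calc 𝔼 ω : TreeNode D → Bool, (y L ω * ∑ K, bitSign (ω ⟨k, K⟩) * (x K ω * c K L)) ^ 2
      ≤ 𝔼 ω : TreeNode D → Bool, (∑ K, bitSign (ω ⟨k, K⟩) * (x K ω * c K L)) ^ 2 := by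
        refine expect_le_expect fun ω _ => ?_
        rw [mul_pow]
        exact mul_le_of_le_one_left (sq_nonneg _) (hy1 L ω)
    _ = ∑ K, 𝔼 ω : TreeNode D → Bool, (x K ω * c K L) ^ 2 := by
        refine expect_sq_level_sum k (fun K ω => x K ω * c K L) fun K ω p b hp => ?_
        simp only
        rw [hx K ω p b hp]
    _ ≤ ∑ K, c K L ^ 2 := by
        refine sum_le_sum fun K _ => ?_
        calc 𝔼 ω : TreeNode D → Bool, (x K ω * c K L) ^ 2
            ≤ 𝔼 _ω : TreeNode D → Bool, c K L ^ 2 := by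
              refine expect_le_expect fun ω _ => ?_
              rw [mul_pow]
              exact mul_le_of_le_one_left (sq_nonneg _) (hx1 K ω)
          _ = c K L ^ 2 := Fintype.expect_const _

theorem pad_nodeMap_apply (ε : TreeNode D → Bool) {k j : Fin D} (hj : j < k) (K : Cube k) :
    Cube.pad D (nodeMap ε k K) j =
      (Cube.pad D K j ^^ ε ⟨j, (Cube.pad D K).trunc j⟩) := by
  rw [nodeMap, Cube.pad_trunc_apply _ hj, treeMap]

/-- The indicator of the event that the image of the node `K` of level `k` has the digits
`y 0, …, y (e - 1)` at the positions `m 0, …, m (e - 1)`. -/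
def matchInd (m : Fin d → Fin D) (k : Fin D) (y : Cube d) (e : ℕ) (K : Cube k)
    (ε : TreeNode D → Bool) : ℝ :=
  if ∀ i : Fin d, (i : ℕ) < e → Cube.pad D (nodeMap ε k K) (m i) = y i then 1 else 0

theorem matchInd_nonneg (m : Fin d → Fin D) (k : Fin D) (y : Cube d) (e : ℕ) (K : Cube k)
    (ε : TreeNode D → Bool) : 0 ≤ matchInd m k y e K ε := by
  unfold matchInd
  split_ifs <;> norm_num

theorem matchInd_le_one (m : Fin d → Fin D) (k : Fin D) (y : Cube d) (e : ℕ) (K : Cube k)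
    (ε : TreeNode D → Bool) : matchInd m k y e K ε ≤ 1 := by
  unfold matchInd
  split_ifs <;> norm_num

theorem matchInd_sq_le_one (m : Fin d → Fin D) (k : Fin D) (y : Cube d) (e : ℕ) (K : Cube k)
    (ε : TreeNode D → Bool) : matchInd m k y e K ε ^ 2 ≤ 1 :=
  pow_le_one₀ (matchInd_nonneg m k y e K ε) (matchInd_le_one m k y e K ε)

theorem isAdapted_matchInd {m : Fin d → Fin D} (hm : StrictMono m) {k : Fin D} (y : Cube d)
    (i : Fin d) (hi : m i ≤ k) (K : Cube k) : IsAdapted (m i) (matchInd m k y i K) := by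
  intro ω p b hp
  unfold matchInd
  have h1 : ∀ i' : Fin d, (i' : ℕ) < i → Cube.pad D (nodeMap (Function.update ω p b) k K) (m i') =
      Cube.pad D (nodeMap ω k K) (m i') := by
    intro i' hi'
    have h2 : m i' < m i := hm hi'
    rw [pad_nodeMap_apply _ (h2.trans_le hi), pad_nodeMap_apply _ (h2.trans_le hi),
      Function.update_of_ne]
    intro h
    rw [← h] at hp
    exact (h2.trans_le hp).false
  have h3 : (∀ i' : Fin d, (i' : ℕ) < i →
      Cube.pad D (nodeMap (Function.update ω p b) k K) (m i') = y i') ↔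
      ∀ i' : Fin d, (i' : ℕ) < i → Cube.pad D (nodeMap ω k K) (m i') = y i' :=
    forall_congr' fun i' => imp_congr_right fun hi' => by rw [h1 i' hi']
  simp only [h3]

theorem expect_trunc_eq (k : Fin D) (j : Fin D) (hj : j < k) (P : Cube j) :
    𝔼 K : Cube k, (if (Cube.pad D K).trunc j = P then (1 : ℝ) else 0) = 1 / 2 ^ (j : ℕ) := by
  have h1 : ∀ K : Cube k, (Cube.pad D K).trunc j = Cube.trunc K ⟨j, hj⟩ := by
    intro K
    funext i
    have : (i : ℕ) < k := i.2.trans hj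
    simp [Cube.pad, Cube.trunc, this]
  simp only [h1]
  rw [Cube.expect_trunc (⟨j, hj⟩ : Fin k) fun P' => if P' = P then (1 : ℝ) else 0,
    Fintype.expect_eq_sum_div_card]
  simp

theorem matchInd_succ {m : Fin d → Fin D} {k : Fin D} (y : Cube d) (i : Fin d) (hi : m i < k)
    (K : Cube k) (ε : TreeNode D → Bool) :
    matchInd m k y (i + 1) K ε = matchInd m k y i K ε / 2 +
      bitSign (ε ⟨m i, (Cube.pad D K).trunc (m i)⟩) *
        (bitSign (y i) / 2 * matchInd m k y i K ε * bitSign (Cube.pad D K (m i))) := by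
  have h1 : (∀ i' : Fin d, (i' : ℕ) < i + 1 → Cube.pad D (nodeMap ε k K) (m i') = y i') ↔
      (∀ i' : Fin d, (i' : ℕ) < i → Cube.pad D (nodeMap ε k K) (m i') = y i') ∧
        Cube.pad D (nodeMap ε k K) (m i) = y i := by
    constructor
    · exact fun h => ⟨fun i' hi' => h i' (by omega), h i (by omega)⟩
    · rintro ⟨h2, h3⟩ i' hi'
      rcases Nat.lt_succ_iff_lt_or_eq.1 hi' with h | h
      · exact h2 i' h
      · rw [Fin.ext h]
        exact h3
  unfold matchInd
  rw [pad_nodeMap_apply ε hi] at h1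
  simp only [h1]
  by_cases h2 : ∀ i' : Fin d, (i' : ℕ) < i → Cube.pad D (nodeMap ε k K) (m i') = y i'
  · rw [if_pos h2]
    simp only [and_iff_right h2]
    cases Cube.pad D K (m i) <;> cases ε ⟨m i, (Cube.pad D K).trunc (m i)⟩ <;> cases y i <;>
      norm_num
  · rw [if_neg h2, if_neg fun h => h2 h.1]
    ring

/-- The nodes of level `k` whose image has `e` prescribed digits form a random set of density
`2^{-e}`, and its mass with respect to an evenly spread weight `t` is concentrated at its mean: by
`matchInd_succ`, every further digit halves the mass up to a random sum over a level `≥ 4q`. -/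
theorem expect_sq_sum_matchInd_le {m : Fin d → Fin D} (hm : StrictMono m) {k : Fin D} (y : Cube d)
    {C : ℝ} {t : Cube k → ℝ} (ht : ∀ K, |t K| ≤ C / 2 ^ (k : ℕ)) {q : ℕ}
    (hq : ∀ i, 4 * q ≤ (m i : ℕ)) (e : ℕ) (he : e ≤ d)
    (hk : ∀ i : Fin d, (i : ℕ) < e → m i < k) :
    𝔼 ε : TreeNode D → Bool, (∑ K, matchInd m k y e K ε * t K - (∑ K, t K) / 2 ^ e) ^ 2 ≤
      C ^ 2 / 4 ^ q := by
  induction e with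
  | zero =>
    have h1 : ∀ ε : TreeNode D → Bool,
        ∑ K, matchInd m k y 0 K ε * t K - (∑ K, t K) / 2 ^ 0 = 0 := by
      intro ε
      simp [matchInd]
    simp only [h1]
    rw [Fintype.expect_const, zero_pow two_ne_zero]
    positivity
  | succ e ih =>
    have ih' := ih (by omega) fun i hi => hk i (by omega)
    set i : Fin d := ⟨e, by omega⟩ with hi
    have hik : m i < k := hk i (by simp [hi])
    set x : Cube (m i) → (TreeNode D → Bool) → ℝ := fun P ε =>
      ∑ K, (if (Cube.pad D K).trunc (m i) = P then
        bitSign (y i) / 2 * matchInd m k y e K ε * bitSign (Cube.pad D K (m i)) * t K else 0)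
      with hx
    set Y : (TreeNode D → Bool) → ℝ := fun ε => ∑ P, bitSign (ε ⟨m i, P⟩) * x P ε with hY
    have hstep : ∀ ε, ∑ K, matchInd m k y (e + 1) K ε * t K - (∑ K, t K) / 2 ^ (e + 1) =
        (∑ K, matchInd m k y e K ε * t K - (∑ K, t K) / 2 ^ e) / 2 + Y ε := by
      intro ε
      have h1 : Y ε = ∑ K, bitSign (ε ⟨m i, (Cube.pad D K).trunc (m i)⟩) *
          (bitSign (y i) / 2 * matchInd m k y e K ε * bitSign (Cube.pad D K (m i)) * t K) := by
        simp only [hY, hx, mul_sum]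
        rw [sum_comm]
        simp
      have h2 : ∀ K, matchInd m k y (e + 1) K ε * t K = matchInd m k y e K ε * t K / 2 +
          bitSign (ε ⟨m i, (Cube.pad D K).trunc (m i)⟩) *
          (bitSign (y i) / 2 * matchInd m k y e K ε * bitSign (Cube.pad D K (m i)) * t K) := by
        intro K
        rw [show e + 1 = (i : ℕ) + 1 from rfl, matchInd_succ y i hik]
        simp only [hi]
        ring
      rw [h1, sum_congr rfl fun K _ => h2 K, sum_add_distrib, ← sum_div, pow_succ]
      ring
    have hxa : ∀ P, IsAdapted (m i) (x P) := by
      intro P ω p b hp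
      simp only [hx]
      refine sum_congr rfl fun K _ => ?_
      have := isAdapted_matchInd hm y i hik.le K ω p b hp
      simp only [hi] at this
      rw [this]
    have hxb : ∀ P ε, x P ε ^ 2 ≤ (C / 2 * (1 / 2 ^ (m i : ℕ))) ^ 2 := by
      intro P ε
      rw [← sq_abs]
      refine pow_le_pow_left₀ (abs_nonneg _) ?_ 2
      calc |x P ε| ≤ ∑ K, |if (Cube.pad D K).trunc (m i) = P then
            bitSign (y i) / 2 * matchInd m k y e K ε * bitSign (Cube.pad D K (m i)) * t K else 0| :=
            abs_sum_le_sum_abs _ _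
        _ ≤ ∑ K, (C / 2) * ((if (Cube.pad D K).trunc (m i) = P then (1 : ℝ) else 0) /
              2 ^ (k : ℕ)) := by
            refine sum_le_sum fun K _ => ?_
            split_ifs
            · rw [abs_mul, abs_mul, abs_mul, abs_bitSign, abs_div, abs_bitSign, mul_one,
                abs_of_nonneg (matchInd_nonneg m k y e K ε), abs_of_pos (by norm_num : (0:ℝ) < 2)]
              have h1 := matchInd_le_one m k y e K ε
              have h0 := matchInd_nonneg m k y e K ε
              calc 1 / 2 * matchInd m k y e K ε * |t K| ≤ 1 / 2 * 1 * (C / 2 ^ (k : ℕ)) :=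
                    mul_le_mul (by linarith) (ht K) (abs_nonneg _) (by norm_num)
                _ = C / 2 * (1 / 2 ^ (k : ℕ)) := by ring
            · simp
        _ = C / 2 * (1 / 2 ^ (m i : ℕ)) := by
            rw [← mul_sum, ← sum_div, ← expect_trunc_eq k (m i) hik P,
              Fintype.expect_eq_sum_div_card]
            simp
    have hYb : 𝔼 ε : TreeNode D → Bool, Y ε ^ 2 ≤ C ^ 2 / 4 ^ q / 4 := by
      rw [expect_sq_level_sum (m i) x hxa]
      have hpow : (4 : ℝ) ^ q ≤ 2 ^ (m i : ℕ) := by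
        rw [show (4 : ℝ) = 2 ^ 2 by norm_num, ← pow_mul]
        exact pow_le_pow_right₀ (by norm_num) (by have := hq i; omega)
      calc ∑ P, 𝔼 ε : TreeNode D → Bool, x P ε ^ 2
          ≤ ∑ _P : Cube (m i), (C / 2 * (1 / 2 ^ (m i : ℕ))) ^ 2 := by
            refine sum_le_sum fun P _ => ?_
            exact (expect_le_expect fun ε _ => hxb P ε).trans (Fintype.expect_const _).le
        _ = C ^ 2 / 2 ^ (m i : ℕ) / 4 := by
            rw [sum_const, card_univ]
            simp
            field_simp
            norm_num
        _ ≤ C ^ 2 / 4 ^ q / 4 := by gcongr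
    calc 𝔼 ε : TreeNode D → Bool,
          (∑ K, matchInd m k y (e + 1) K ε * t K - (∑ K, t K) / 2 ^ (e + 1)) ^ 2
        ≤ 𝔼 ε : TreeNode D → Bool, (1 / 2 *
          (∑ K, matchInd m k y e K ε * t K - (∑ K, t K) / 2 ^ e) ^ 2 + 2 * Y ε ^ 2) := by
          refine expect_le_expect fun ε _ => ?_
          rw [hstep]
          nlinarith [sq_nonneg
            ((∑ K, matchInd m k y e K ε * t K - (∑ K, t K) / 2 ^ e) / 2 - Y ε)]
      _ = 1 / 2 * 𝔼 ε : TreeNode D → Bool,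
            (∑ K, matchInd m k y e K ε * t K - (∑ K, t K) / 2 ^ e) ^ 2 +
          2 * 𝔼 ε : TreeNode D → Bool, Y ε ^ 2 := by
          rw [expect_add_distrib, mul_expect, mul_expect]
      _ ≤ 1 / 2 * (C ^ 2 / 4 ^ q) + 2 * (C ^ 2 / 4 ^ q / 4) := by linarith
      _ = C ^ 2 / 4 ^ q := by ring

end SecondMoments

/-! ### Random conjugation makes an operator almost a level multiplier -/

section Conjugation

open Finset
open scoped BigOperators

variable {D d : ℕ}

namespace Coef

/-- The coefficients of the Haar function of the node `K` of level `k`. -/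
noncomputable def unit (k : Fin D) (K : Cube k) : Coef D := Pi.single k (Pi.single K 1)

theorem unit_apply_self (k : Fin D) (K L : Cube k) : unit k K k L = if L = K then 1 else 0 := by
  rw [unit, Pi.single_eq_same, Pi.single_apply]

theorem unit_apply_of_ne {k l : Fin D} (h : l ≠ k) (K : Cube k) (L : Cube l) :
    unit k K l L = 0 := by
  rw [unit, Pi.single_eq_of_ne h]
  rfl

theorem single_eq_sum (k : Fin D) (g : Cube k → ℝ) :
    (Pi.single k g : Coef D) = ∑ K, g K • unit k K := by
  have h1 : g = ∑ K, g K • (Pi.single K 1 : Cube k → ℝ) := by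
    funext L
    simp [Finset.sum_apply, Pi.single_apply]
  conv_lhs => rw [h1]
  change LinearMap.single ℝ (fun k : Fin D => Cube k → ℝ) k _ = _
  rw [map_sum]
  exact sum_congr rfl fun K _ => map_smul _ _ _

theorem eq_sum_unit (a : Coef D) : a = ∑ k, ∑ K, a k K • unit k K := by
  conv_lhs => rw [← Finset.univ_sum_single a]
  exact sum_congr rfl fun k _ => single_eq_sum k _

theorem map_single_apply (T : Coef D →ₗ[ℝ] Coef D) (k l : Fin D) (g : Cube k → ℝ) (L : Cube l) :
    T (Pi.single k g) l L = ∑ K, g K * T (unit k K) l L := by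
  rw [single_eq_sum, map_sum, Finset.sum_apply, Finset.sum_apply]
  exact sum_congr rfl fun K _ => by rw [map_smul]; rfl

/-- The inner product of `T h_K` and `h_L`. -/
noncomputable def pairing (T : Coef D →ₗ[ℝ] Coef D) (k l : Fin D) (K : Cube k) (L : Cube l) : ℝ :=
  T (unit k K) l L / 2 ^ (l : ℕ)

/-- The average of the diagonal entries of `T` over the level `k`. -/
noncomputable def levelAverage (T : Coef D →ₗ[ℝ] Coef D) (k : Fin D) : ℝ :=
  ∑ K, pairing T k k K K

theorem levelAverage_eq_expect (T : Coef D →ₗ[ℝ] Coef D) (k : Fin D) :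
    levelAverage T k = 𝔼 K, T (unit k K) k K := by
  rw [Fintype.expect_eq_sum_div_card, sum_div]
  exact sum_congr rfl fun K _ => by simp [pairing]

/-- The Haar multiplier whose entries depend on the level only. -/
noncomputable def levelMul (c : Fin d → ℝ) : Coef d →ₗ[ℝ] Coef d where
  toFun a j v := c j * a j v
  map_add' a b := by
    funext j v
    simp only [Pi.add_apply, mul_add]
  map_smul' s a := by
    funext j v
    simp only [Pi.smul_apply, smul_eq_mul, RingHom.id_apply]
    ring

theorem levelMul_apply (c : Fin d → ℝ) (a : Coef d) (j : Fin d) (v : Cube j) :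
    levelMul c a j v = c j * a j v := rfl

/-- The operator `T`, conjugated by the tree automorphism with signs `ε` and then compressed to the
span of the images of the Haar functions under `spread m`. -/
noncomputable def conjugate (m : Fin d → Fin D) (ε : TreeNode D → Bool) (T : Coef D →ₗ[ℝ] Coef D) :
    Coef d →ₗ[ℝ] Coef d :=
  compress m ∘ₗ (twist ε).symm.toLinearMap ∘ₗ T ∘ₗ (twist ε).toLinearMap ∘ₗ spread m

variable {m : Fin d → Fin D}

theorem trunc_comp_eq_iff (m : Fin d → Fin D) (j : Fin d) (v : Cube j) (w : Cube (m j)) :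
    Cube.trunc (Cube.pad D w ∘ m) j = v ↔
      ∀ i : Fin d, (i : ℕ) < j → Cube.pad D w (m i) = Cube.pad d v i := by
  conv_lhs => rw [← Cube.trunc_pad v]
  rw [Cube.trunc_eq_iff]
  rfl

theorem spread_unit (m : Fin d → Fin D) (i : Fin d) (v : Cube i) :
    spread m (unit i v) =
      Pi.single (m i) fun K => if Cube.trunc (Cube.pad D K ∘ m) i = v then 1 else 0 := by
  funext k K
  rw [spread_apply, sum_eq_single i]
  · by_cases h : m i = k
    · subst h
      rw [if_pos rfl, Pi.single_eq_same, unit_apply_self]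
    · rw [if_neg h, Pi.single_eq_of_ne fun h' => h h'.symm]
      rfl
  · intro j _ hj
    rw [unit_apply_of_ne hj, ite_self]
  · simp

theorem twist_single (ε : TreeNode D → Bool) (k : Fin D) (g : Cube k → ℝ) :
    twist ε (Pi.single k g) =
      Pi.single k fun K => bitSign (ε ⟨k, K⟩) * g (nodeMap ε k K) := by
  funext l L
  rw [twist_apply]
  by_cases h : l = k
  · subst h
    rw [Pi.single_eq_same, Pi.single_eq_same]
  · rw [Pi.single_eq_of_ne h, Pi.single_eq_of_ne h]
    simp

theorem compress_twist_symm (hm : StrictMono m) (ε : TreeNode D → Bool) (g : Coef D) (j : Fin d)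
    (w : Cube j) : compress m ((twist ε).symm g) j w = 2 ^ (j : ℕ) *
      ∑ L, bitSign (ε ⟨m j, L⟩) * matchInd m (m j) (Cube.pad d w) j L ε *
        (g (m j) L / 2 ^ (m j : ℕ)) := by
  rw [compress_eq_expect hm]
  congr 1
  rw [← Fintype.expect_equiv (Equiv.ofBijective _ (nodeMap_bijective ε (m j)))
    (fun L => (twist ε).symm g (m j) (nodeMap ε (m j) L) *
      if Cube.trunc (Cube.pad D (nodeMap ε (m j) L) ∘ m) j = w then 1 else 0) _ fun _ => rfl]
  rw [Fintype.expect_eq_sum_div_card, sum_div]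
  refine sum_congr rfl fun L _ => ?_
  have h1 : (twist ε).symm g (m j) (nodeMap ε (m j) L) = bitSign (ε ⟨m j, L⟩) * g (m j) L := by
    have h2 : twist ε ((twist ε).symm g) (m j) L = g (m j) L := by
      rw [LinearEquiv.apply_symm_apply]
    rw [twist_apply] at h2
    rw [← h2, ← mul_assoc, bitSign_mul_self, one_mul]
  rw [h1]
  have h2 : (if Cube.trunc (Cube.pad D (nodeMap ε (m j) L) ∘ m) j = w then (1 : ℝ) else 0) =
      matchInd m (m j) (Cube.pad d w) j L ε := by
    simp only [trunc_comp_eq_iff, matchInd]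
  rw [h2, Fintype.card_fun, Fintype.card_bool, Fintype.card_fin]
  push_cast
  ring

/-- The entries of the compression are random bilinear forms in the signs. -/
theorem conjugate_unit_apply (hm : StrictMono m) (ε : TreeNode D → Bool) (T : Coef D →ₗ[ℝ] Coef D)
    (i j : Fin d) (v : Cube i) (w : Cube j) :
    conjugate m ε T (unit i v) j w = 2 ^ (j : ℕ) * ∑ K, ∑ L,
      (bitSign (ε ⟨m i, K⟩) * matchInd m (m i) (Cube.pad d v) i K ε) *
        (bitSign (ε ⟨m j, L⟩) * matchInd m (m j) (Cube.pad d w) j L ε) *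
          pairing T (m i) (m j) K L := by
  have h1 : conjugate m ε T (unit i v) =
      compress m ((twist ε).symm (T (twist ε (spread m (unit i v))))) := rfl
  rw [h1, compress_twist_symm hm, spread_unit, twist_single]
  congr 1
  simp only [map_single_apply, sum_div, mul_sum]
  rw [sum_comm]
  refine sum_congr rfl fun K _ => sum_congr rfl fun L _ => ?_
  simp only [trunc_comp_eq_iff, matchInd, pairing]
  ring

end Coef

namespace HaarSystemSpace

variable {X : HaarSystemSpace} {r : RademacherChoice} {T : Coef D →ₗ[ℝ] Coef D} {C : ℝ}

theorem coefNorm_unit (k : Fin D) (K : Cube k) :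
    X.coefNorm r (Coef.unit k K) = X.pointNorm k := by
  rw [Coef.unit, coefNorm_single, cubeNorm_single, abs_one, one_mul]

theorem abs_apply_mul_pointNorm_le (a : Coef D) (k : Fin D) (K : Cube k) :
    |a k K| * X.pointNorm k ≤ X.coefNorm r a :=
  (abs_mul_pointNorm_le _ _).trans (cubeNorm_level_le a k)

theorem abs_apply_unit_self_le (hT : ∀ a, X.coefNorm r (T a) ≤ C * X.coefNorm r a) (k : Fin D)
    (K : Cube k) : |T (Coef.unit k K) k K| ≤ C := by
  have h1 := (abs_apply_mul_pointNorm_le (X := X) (r := r) (T (Coef.unit k K)) k K).trans (hT _)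
  rw [coefNorm_unit] at h1
  exact le_of_mul_le_mul_right h1 (pointNorm_pos _)

theorem abs_levelAverage_le (hT : ∀ a, X.coefNorm r (T a) ≤ C * X.coefNorm r a) (k : Fin D) :
    |Coef.levelAverage T k| ≤ C := by
  rw [Coef.levelAverage_eq_expect]
  refine (abs_expect_le _ _).trans ?_
  refine (expect_le_expect fun K _ => abs_apply_unit_self_le hT k K).trans ?_
  exact (Fintype.expect_const _).le

theorem sum_sq_pairing_le (hC : 0 ≤ C) (hT : ∀ a, X.coefNorm r (T a) ≤ C * X.coefNorm r a)
    (k l : Fin D) {q : ℕ} (hk : 4 * q ≤ (k : ℕ)) (hl : 4 * q ≤ (l : ℕ)) :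
    ∑ K, ∑ L, Coef.pairing T k l K L ^ 2 ≤ C ^ 2 / 4 ^ q := by
  refine sum_sq_entries_le (X := X) hC (fun g => ?_) hk hl
  have h1 : (fun L => ∑ K, g K * T (Coef.unit k K) l L) = T (Pi.single k g) l := by
    funext L
    rw [Coef.map_single_apply]
  rw [h1, ← coefNorm_single (r := r) k g]
  exact (cubeNorm_level_le _ l).trans (hT _)

variable {m : Fin d → Fin D}

/-- The difference between the bilinear form that gives an entry of the compression of `T` and
the corresponding entry of the level multiplier. -/
noncomputable def deviation (m : Fin d → Fin D) (T : Coef D →ₗ[ℝ] Coef D) (p s : TreeNode d)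
    (ε : TreeNode D → Bool) : ℝ :=
  (∑ K, ∑ L, (bitSign (ε ⟨m p.1, K⟩) * matchInd m (m p.1) (Cube.pad d p.2) p.1 K ε) *
      (bitSign (ε ⟨m s.1, L⟩) * matchInd m (m s.1) (Cube.pad d s.2) s.1 L ε) *
        Coef.pairing T (m p.1) (m s.1) K L) -
    if p = s then Coef.levelAverage T (m p.1) / 2 ^ (p.1 : ℕ) else 0

theorem sum_diagonal_eq (hm : StrictMono m) (p s : TreeNode d) (ε : TreeNode D → Bool) :
    (∑ K, ∑ L, (bitSign (ε ⟨m p.1, K⟩) * matchInd m (m p.1) (Cube.pad d p.2) p.1 K ε) *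
      (bitSign (ε ⟨m s.1, L⟩) * matchInd m (m s.1) (Cube.pad d s.2) s.1 L ε) *
        if nodeRank (⟨m p.1, K⟩ : TreeNode D) = nodeRank (⟨m s.1, L⟩ : TreeNode D) then
          Coef.pairing T (m p.1) (m s.1) K L else 0) =
      if p = s then ∑ K, matchInd m (m p.1) (Cube.pad d p.2) p.1 K ε *
        Coef.pairing T (m p.1) (m p.1) K K else 0 := by
  obtain ⟨i, v⟩ := p
  obtain ⟨j, w⟩ := s
  simp only [nodeRank_injective.eq_iff]
  by_cases hij : i = j
  · subst hij
    have h1 : ∀ K L : Cube (m i), (⟨m i, K⟩ : TreeNode D) = ⟨m i, L⟩ ↔ K = L := fun K L =>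
      ⟨fun h => eq_of_heq (Sigma.mk.inj_iff.1 h).2, fun h => by rw [h]⟩
    simp only [h1, mul_ite, mul_zero, sum_ite_eq, mem_univ, if_true]
    by_cases hvw : v = w
    · subst hvw
      rw [if_pos rfl]
      refine sum_congr rfl fun K _ => ?_
      rw [mul_mul_mul_comm, bitSign_mul_self, one_mul]
      congr 1
      unfold matchInd
      split_ifs <;> norm_num
    · rw [if_neg (show ¬(⟨i, v⟩ : TreeNode d) = ⟨i, w⟩ from
        fun h => hvw (eq_of_heq (Sigma.mk.inj_iff.1 h).2))]
      refine sum_eq_zero fun K _ => ?_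
      have h2 : matchInd m (m i) (Cube.pad d v) i K ε * matchInd m (m i) (Cube.pad d w) i K ε =
          0 := by
        unfold matchInd
        simp only [← Coef.trunc_comp_eq_iff]
        split_ifs with h3 h4
        · exact absurd (h3.symm.trans h4) hvw
        all_goals norm_num
      rw [mul_mul_mul_comm, h2, mul_zero, zero_mul]
  · rw [if_neg (show ¬(⟨i, v⟩ : TreeNode d) = ⟨j, w⟩ from fun h => hij (Sigma.mk.inj_iff.1 h).1)]
    refine sum_eq_zero fun K _ => sum_eq_zero fun L _ => ?_
    rw [if_neg fun h => hij (hm.injective (Sigma.mk.inj_iff.1 h).1), mul_zero]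

theorem expect_deviation_sq_le (hm : StrictMono m) (hC : 0 ≤ C)
    (hT : ∀ a, X.coefNorm r (T a) ≤ C * X.coefNorm r a) {q : ℕ} (hq : ∀ i, 4 * q ≤ (m i : ℕ))
    (p s : TreeNode d) :
    𝔼 ε : TreeNode D → Bool, deviation m T p s ε ^ 2 ≤ 9 * (C ^ 2 / 4 ^ q) := by
  set x : Cube (m p.1) → (TreeNode D → Bool) → ℝ := fun K ε =>
    matchInd m (m p.1) (Cube.pad d p.2) p.1 K ε with hx
  set y : Cube (m s.1) → (TreeNode D → Bool) → ℝ := fun L ε =>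
    matchInd m (m s.1) (Cube.pad d s.2) s.1 L ε with hy
  set P : Cube (m p.1) → Cube (m s.1) → ℝ := Coef.pairing T (m p.1) (m s.1) with hP
  set rk : Cube (m p.1) → ℕ := fun K => nodeRank (⟨m p.1, K⟩ : TreeNode D) with hrk
  set rl : Cube (m s.1) → ℕ := fun L => nodeRank (⟨m s.1, L⟩ : TreeNode D) with hrl
  have hxa : ∀ K, IsAdapted (m p.1) (x K) := fun K => isAdapted_matchInd hm _ _ le_rfl K
  have hya : ∀ L, IsAdapted (m s.1) (y L) := fun L => isAdapted_matchInd hm _ _ le_rfl L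
  have hx1 : ∀ K ε, x K ε ^ 2 ≤ 1 := fun K ε => matchInd_sq_le_one _ _ _ _ _ _
  have hy1 : ∀ L ε, y L ε ^ 2 ≤ 1 := fun L ε => matchInd_sq_le_one _ _ _ _ _ _
  have hPs : ∑ K, ∑ L, P K L ^ 2 ≤ C ^ 2 / 4 ^ q :=
    sum_sq_pairing_le hC hT _ _ (hq _) (hq _)
  set A : (TreeNode D → Bool) → ℝ := fun ε => ∑ L, bitSign (ε ⟨m s.1, L⟩) *
    (y L ε * ∑ K, bitSign (ε ⟨m p.1, K⟩) * (x K ε * if rk K < rl L then P K L else 0)) with hA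
  set B : (TreeNode D → Bool) → ℝ := fun ε => ∑ K, bitSign (ε ⟨m p.1, K⟩) *
    (x K ε * ∑ L, bitSign (ε ⟨m s.1, L⟩) * (y L ε * if rl L < rk K then P K L else 0)) with hB
  set E : (TreeNode D → Bool) → ℝ := fun ε => if p = s then
    ∑ K, x K ε * Coef.pairing T (m p.1) (m p.1) K K -
      Coef.levelAverage T (m p.1) / 2 ^ (p.1 : ℕ) else 0 with hE
  have hsplit : ∀ ε, deviation m T p s ε = A ε + B ε + E ε := by
    intro ε
    have h1 : ∀ K L, P K L = (if rk K < rl L then P K L else 0) + (if rl L < rk K then P K L else 0) +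
        if rk K = rl L then P K L else 0 := by
      intro K L
      rcases lt_trichotomy (rk K) (rl L) with h | h | h
      · simp [h, h.not_gt, h.ne]
      · simp [h]
      · simp [h, h.not_gt, h.ne']
    have h2 : A ε = ∑ K, ∑ L, (bitSign (ε ⟨m p.1, K⟩) * x K ε) *
        (bitSign (ε ⟨m s.1, L⟩) * y L ε) * if rk K < rl L then P K L else 0 := by
      simp only [hA, mul_sum]
      rw [sum_comm]
      exact sum_congr rfl fun K _ => sum_congr rfl fun L _ => by ring
    have h3 : B ε = ∑ K, ∑ L, (bitSign (ε ⟨m p.1, K⟩) * x K ε) *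
        (bitSign (ε ⟨m s.1, L⟩) * y L ε) * if rl L < rk K then P K L else 0 := by
      simp only [hB, mul_sum]
      exact sum_congr rfl fun K _ => sum_congr rfl fun L _ => by ring
    have h4 := sum_diagonal_eq (T := T) hm p s ε
    have h5 : deviation m T p s ε = (∑ K, ∑ L, (bitSign (ε ⟨m p.1, K⟩) * x K ε) *
        (bitSign (ε ⟨m s.1, L⟩) * y L ε) * P K L) -
        if p = s then Coef.levelAverage T (m p.1) / 2 ^ (p.1 : ℕ) else 0 := rfl
    have h6 : ∑ K, ∑ L, (bitSign (ε ⟨m p.1, K⟩) * x K ε) *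
        (bitSign (ε ⟨m s.1, L⟩) * y L ε) * P K L = A ε + B ε +
        ∑ K, ∑ L, (bitSign (ε ⟨m p.1, K⟩) * x K ε) *
          (bitSign (ε ⟨m s.1, L⟩) * y L ε) * if rk K = rl L then P K L else 0 := by
      rw [h2, h3, ← sum_add_distrib, ← sum_add_distrib]
      refine sum_congr rfl fun K _ => ?_
      rw [← sum_add_distrib, ← sum_add_distrib]
      refine sum_congr rfl fun L _ => ?_
      rw [← mul_add, ← mul_add, ← h1]
    rw [h5, h6, add_sub_assoc]
    congr 1
    rw [show (∑ K, ∑ L, (bitSign (ε ⟨m p.1, K⟩) * x K ε) * (bitSign (ε ⟨m s.1, L⟩) * y L ε) *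
      if rk K = rl L then P K L else 0) = _ from h4]
    simp only [hE]
    split_ifs
    · rfl
    · ring
  have hAb : 𝔼 ε, A ε ^ 2 ≤ C ^ 2 / 4 ^ q := by
    refine (expect_sq_triangular_le _ _ x y hxa hya hx1 hy1
      (fun K L => if rk K < rl L then P K L else 0) fun K L h => ?_).trans
      (le_trans (sum_le_sum fun K _ => sum_le_sum fun L _ => ?_) hPs)
    · by_contra h'
      exact h (if_neg h')
    · split_ifs
      · exact le_rfl
      · rw [zero_pow two_ne_zero]
        exact sq_nonneg _
  have hBb : 𝔼 ε, B ε ^ 2 ≤ C ^ 2 / 4 ^ q := by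
    refine (expect_sq_triangular_le _ _ y x hya hxa hy1 hx1
      (fun L K => if rl L < rk K then P K L else 0) fun L K h => ?_).trans
      (le_trans ?_ hPs)
    · by_contra h'
      exact h (if_neg h')
    · rw [sum_comm]
      refine sum_le_sum fun K _ => sum_le_sum fun L _ => ?_
      split_ifs
      · exact le_rfl
      · rw [zero_pow two_ne_zero]
        exact sq_nonneg _
  have hEb : 𝔼 ε, E ε ^ 2 ≤ C ^ 2 / 4 ^ q := by
    by_cases hps : p = s
    · simp only [hE, if_pos hps]
      refine expect_sq_sum_matchInd_le hm (Cube.pad d p.2) (C := C)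
        (t := fun K => Coef.pairing T (m p.1) (m p.1) K K) (fun K => ?_) hq p.1 p.1.2.le
        fun i hi => hm hi
      rw [Coef.pairing, abs_div, abs_of_pos (by positivity : (0 : ℝ) < 2 ^ (m p.1 : ℕ))]
      exact div_le_div_of_nonneg_right (abs_apply_unit_self_le hT _ _) (by positivity)
    · simp only [hE, if_neg hps]
      rw [Fintype.expect_const, zero_pow two_ne_zero]
      positivity
  calc 𝔼 ε : TreeNode D → Bool, deviation m T p s ε ^ 2
      ≤ 𝔼 ε : TreeNode D → Bool, 3 * (A ε ^ 2 + B ε ^ 2 + E ε ^ 2) := by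
        refine expect_le_expect fun ε _ => ?_
        rw [hsplit]
        nlinarith [sq_nonneg (A ε - B ε), sq_nonneg (B ε - E ε), sq_nonneg (A ε - E ε)]
    _ = 3 * (𝔼 ε, A ε ^ 2 + 𝔼 ε, B ε ^ 2 + 𝔼 ε, E ε ^ 2) := by
        rw [← mul_expect, expect_add_distrib, expect_add_distrib]
    _ ≤ 9 * (C ^ 2 / 4 ^ q) := by linarith

theorem card_treeNode_le (d : ℕ) : (Fintype.card (TreeNode d) : ℝ) ≤ 2 ^ d := by
  have h1 : Fintype.card (TreeNode d) = ∑ k ∈ range d, 2 ^ k := by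
    rw [Fintype.card_sigma, ← Fin.sum_univ_eq_sum_range]
    simp
  rw [h1, Nat.geomSum_eq le_rfl]
  have : 2 ^ d - 1 ≤ 2 ^ d := Nat.sub_le _ _
  rw [Nat.div_one]
  exact_mod_cast this

/-- For suitable signs, all deviations are small simultaneously. -/
theorem exists_sum_abs_deviation_le (hm : StrictMono m) (hC : 0 ≤ C)
    (hT : ∀ a, X.coefNorm r (T a) ≤ C * X.coefNorm r a) {q : ℕ} (hq : ∀ i, 4 * q ≤ (m i : ℕ)) :
    ∃ ε : TreeNode D → Bool, ∑ p, ∑ s, |deviation m T p s ε| ≤ 4 ^ d * (3 * C / 2 ^ q) := by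
  have hpow : (4 : ℝ) ^ q = (2 ^ q) ^ 2 := by
    rw [← pow_mul, mul_comm, pow_mul]
    norm_num
  have h1 : 𝔼 ε : TreeNode D → Bool, ∑ p, ∑ s, deviation m T p s ε ^ 2 ≤
      ∑ _p : TreeNode d, ∑ _s : TreeNode d, 9 * (C ^ 2 / 4 ^ q) := by
    rw [expect_sum_comm]
    refine sum_le_sum fun p _ => ?_
    rw [expect_sum_comm]
    exact sum_le_sum fun s _ => expect_deviation_sq_le hm hC hT hq p s
  obtain ⟨ε, -, hε⟩ := exists_le_of_expect_le univ_nonempty h1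
  refine ⟨ε, ?_⟩
  have hcard := card_treeNode_le d
  set c : ℝ := (Fintype.card (TreeNode d) : ℝ) with hc
  have hc0 : 0 ≤ c := by positivity
  have h2 : (∑ p, ∑ s, |deviation m T p s ε|) ^ 2 ≤ (c ^ 2 * (3 * C / 2 ^ q)) ^ 2 := by
    simp only [← Fintype.sum_prod_type'] at hε ⊢
    refine (sq_sum_le_card_mul_sum_sq).trans ?_
    simp only [sq_abs]
    calc _ ≤ ((univ : Finset (TreeNode d × TreeNode d)).card : ℝ) *
          ∑ _x : TreeNode d × TreeNode d, 9 * (C ^ 2 / 4 ^ q) :=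
          mul_le_mul_of_nonneg_left hε (by positivity)
      _ = _ := by
          rw [sum_const, card_univ, Fintype.card_prod, hpow]
          push_cast
          rw [nsmul_eq_mul]
          push_cast
          rw [← hc]
          field_simp
          ring
  have h3 := (sq_le_sq₀ (sum_nonneg fun _ _ => sum_nonneg fun _ _ => abs_nonneg _)
    (by positivity)).1 h2
  refine h3.trans (mul_le_mul_of_nonneg_right ?_ (by positivity))
  calc c ^ 2 ≤ (2 ^ d) ^ 2 := pow_le_pow_left₀ hc0 hcard 2
    _ = 4 ^ d := by rw [← pow_mul, mul_comm, pow_mul]; norm_num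

theorem conjugate_sub_levelMul_unit (hm : StrictMono m) (T : Coef D →ₗ[ℝ] Coef D)
    (ε : TreeNode D → Bool) (p s : TreeNode d) :
    (Coef.conjugate m ε T - Coef.levelMul fun i => Coef.levelAverage T (m i))
      (Coef.unit p.1 p.2) s.1 s.2 = 2 ^ (s.1 : ℕ) * deviation m T p s ε := by
  rw [LinearMap.sub_apply, Pi.sub_apply, Pi.sub_apply, Coef.conjugate_unit_apply hm,
    Coef.levelMul_apply, deviation, mul_sub]
  congr 1
  by_cases h : p = s
  · subst h
    rw [if_pos rfl, Coef.unit_apply_self, if_pos rfl, mul_one]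
    field_simp
  · rw [if_neg h, mul_zero]
    obtain ⟨i, v⟩ := p
    obtain ⟨j, w⟩ := s
    by_cases hij : j = i
    · subst hij
      rw [Coef.unit_apply_self, if_neg, mul_zero]
      rintro rfl
      exact h rfl
    · rw [Coef.unit_apply_of_ne hij, mul_zero]

theorem coefNorm_sum_le {ι : Type*} (S : Finset ι) (f : ι → Coef D) :
    X.coefNorm r (∑ i ∈ S, f i) ≤ ∑ i ∈ S, X.coefNorm r (f i) := by
  refine Finset.le_sum_of_subadditive (X.coefNorm r) ?_ coefNorm_add_le _ _
  have := coefNorm_smul (X := X) (r := r) 0 (0 : Coef D)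
  rw [zero_smul, abs_zero, zero_mul] at this
  exact this.le

/-- An operator with small entries has small norm. The powers of `2` come from the estimates
`|a_I| ≤ 2^j ‖a‖` for `I` of level `j` and `‖h_J‖ ≤ 1`. -/
theorem coefNorm_apply_le_of_entries {n : ℕ} (R : Coef (n + 1) →ₗ[ℝ] Coef (n + 1))
    (z : TreeNode (n + 1) → TreeNode (n + 1) → ℝ)
    (hz : ∀ p s, R (Coef.unit p.1 p.2) s.1 s.2 = 2 ^ (s.1 : ℕ) * z p s) (a : Coef (n + 1)) :
    X.coefNorm r (R a) ≤ 4 ^ n * (∑ p, ∑ s, |z p s|) * X.coefNorm r a := by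
  have hunit : ∀ p : TreeNode (n + 1), X.coefNorm r (R (Coef.unit p.1 p.2)) ≤
      2 ^ n * ∑ s, |z p s| := by
    intro p
    rw [Coef.eq_sum_unit (R (Coef.unit p.1 p.2)),
      ← Fintype.sum_sigma' fun k K => R (Coef.unit p.1 p.2) k K • Coef.unit k K]
    refine (coefNorm_sum_le _ _).trans ?_
    rw [mul_sum]
    refine sum_le_sum fun s _ => ?_
    rw [coefNorm_smul, hz, coefNorm_unit, abs_mul,
      abs_of_pos (by positivity : (0 : ℝ) < 2 ^ (s.1 : ℕ))]
    have h1 : (2 : ℝ) ^ (s.1 : ℕ) ≤ 2 ^ n :=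
      pow_le_pow_right₀ (by norm_num) (Nat.lt_succ_iff.1 s.1.2)
    have h2 := pointNorm_le_one (X := X) (s.1 : ℕ)
    calc 2 ^ (s.1 : ℕ) * |z p s| * X.pointNorm s.1 ≤ 2 ^ (s.1 : ℕ) * |z p s| * 1 :=
          mul_le_mul_of_nonneg_left h2 (by positivity)
      _ ≤ 2 ^ n * |z p s| := by
          rw [mul_one]
          exact mul_le_mul_of_nonneg_right h1 (abs_nonneg _)
  have hcoef : ∀ p : TreeNode (n + 1), |a p.1 p.2| ≤ 2 ^ n * X.coefNorm r a := by
    intro p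
    have h1 := abs_apply_mul_pointNorm_le (X := X) (r := r) a p.1 p.2
    have h2 := one_le_pow_mul_pointNorm (X := X) (p.1 : ℕ)
    have h3 : (2 : ℝ) ^ (p.1 : ℕ) ≤ 2 ^ n :=
      pow_le_pow_right₀ (by norm_num) (Nat.lt_succ_iff.1 p.1.2)
    calc |a p.1 p.2| ≤ |a p.1 p.2| * (2 ^ (p.1 : ℕ) * X.pointNorm p.1) :=
          le_mul_of_one_le_right (abs_nonneg _) h2
      _ = 2 ^ (p.1 : ℕ) * (|a p.1 p.2| * X.pointNorm p.1) := by ring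
      _ ≤ 2 ^ n * X.coefNorm r a :=
          mul_le_mul h3 h1 (mul_nonneg (abs_nonneg _) (pointNorm_pos _).le) (by positivity)
  have ha : R a = ∑ p : TreeNode (n + 1), a p.1 p.2 • R (Coef.unit p.1 p.2) := by
    conv_lhs => rw [Coef.eq_sum_unit a,
      ← Fintype.sum_sigma' fun k K => a k K • Coef.unit k K, map_sum]
    exact sum_congr rfl fun p _ => map_smul _ _ _
  rw [ha]
  refine (coefNorm_sum_le _ _).trans ?_
  calc ∑ p : TreeNode (n + 1), X.coefNorm r (a p.1 p.2 • R (Coef.unit p.1 p.2))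
      ≤ ∑ p : TreeNode (n + 1), (2 ^ n * X.coefNorm r a) * (2 ^ n * ∑ s, |z p s|) := by
        refine sum_le_sum fun p _ => ?_
        rw [coefNorm_smul]
        exact mul_le_mul (hcoef p) (hunit p) (coefNorm_nonneg _)
          (mul_nonneg (by positivity) (coefNorm_nonneg _))
    _ = 4 ^ n * (∑ p, ∑ s, |z p s|) * X.coefNorm r a := by
        rw [← mul_sum, ← mul_sum, show (4 : ℝ) ^ n = 2 ^ n * 2 ^ n by
          rw [← mul_pow]; norm_num]
        ring

/-- Some tree automorphism makes the compression of `T` a small perturbation of the level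
multiplier given by the averages of the diagonal of `T`. -/
theorem exists_coefNorm_conjugate_sub_le {n : ℕ} {m : Fin (n + 1) → Fin D} (hm : StrictMono m)
    (hC : 0 ≤ C) (hT : ∀ a, X.coefNorm r (T a) ≤ C * X.coefNorm r a) {q : ℕ}
    (hq : ∀ i, 4 * q ≤ (m i : ℕ)) :
    ∃ ε : TreeNode D → Bool, ∀ a : Coef (n + 1),
      X.coefNorm r (Coef.conjugate m ε T a - Coef.levelMul (fun i => Coef.levelAverage T (m i)) a) ≤
        12 * 16 ^ n * C / 2 ^ q * X.coefNorm r a := by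
  obtain ⟨ε, hε⟩ := exists_sum_abs_deviation_le hm hC hT hq
  refine ⟨ε, fun a => ?_⟩
  have h1 := coefNorm_apply_le_of_entries (X := X) (r := r)
    (Coef.conjugate m ε T - Coef.levelMul fun i => Coef.levelAverage T (m i))
    (fun p s => deviation m T p s ε) (conjugate_sub_levelMul_unit hm T ε) a
  refine h1.trans (mul_le_mul_of_nonneg_right ?_ (coefNorm_nonneg _))
  calc (4 : ℝ) ^ n * ∑ p, ∑ s, |deviation m T p s ε|
      ≤ 4 ^ n * (4 ^ (n + 1) * (3 * C / 2 ^ q)) := mul_le_mul_of_nonneg_left hε (by positivity)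
    _ = 12 * 16 ^ n * C / 2 ^ q := by
        rw [show (16 : ℝ) ^ n = 4 ^ n * 4 ^ n by rw [← mul_pow]; norm_num, pow_succ]
        ring

end HaarSystemSpace

end Conjugation

/-! ### Level multipliers -/

section LevelMultipliers

open Finset

variable {X : HaarSystemSpace} {r : RademacherChoice} {D : ℕ}

namespace HaarSystemSpace

theorem coefNorm_levelMul_le_card (c : Fin D → ℝ) {w : ℝ} (hc : ∀ k, |c k| ≤ w) (a : Coef D) :
    X.coefNorm r (Coef.levelMul c a) ≤ D * w * X.coefNorm r a := by
  rw [← Finset.univ_sum_single (Coef.levelMul c a)]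
  refine (coefNorm_sum_le _ _).trans ?_
  calc ∑ k, X.coefNorm r (Pi.single k (Coef.levelMul c a k))
      ≤ ∑ _k : Fin D, w * X.coefNorm r a := by
        refine sum_le_sum fun k _ => ?_
        have h1 : Coef.levelMul c a k = c k • a k := rfl
        rw [coefNorm_single, h1, map_smul_eq_mul, Real.norm_eq_abs]
        exact mul_le_mul (hc k) (cubeNorm_level_le a k) (apply_nonneg _ _)
          ((abs_nonneg _).trans (hc k))
    _ = D * w * X.coefNorm r a := by simp [mul_assoc]

theorem hardyNorm_sum_node (s : TreeNode D → ℝ) :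
    X.coefNorm r (fun k w => s ⟨k, w⟩ : Coef D) =
      ‖∑ p : TreeNode D, s p • X.haarHardy r (Cube.node p.2)‖ := by
  rw [← hardyNorm_haarSum, haarSum_apply, ← Fintype.sum_sigma' fun (k : Fin D) (w : Cube k) =>
    s ⟨k, w⟩ • haarVec (some (Cube.node w))]
  rfl

theorem treeNode_node_injective : Function.Injective fun p : TreeNode D => Cube.node p.2 := by
  rintro ⟨k, v⟩ ⟨l, w⟩ h
  obtain ⟨h1, h2⟩ := Cube.node_injective h
  obtain rfl : k = l := Fin.ext h1
  rw [show v = w from h2]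

theorem coefNorm_levelMul_sign_le {K : ℝ} (hK : X.IsUnconditional r K) (θ : Fin D → ℝ)
    (hθ : ∀ k, θ k = 1 ∨ θ k = -1) (a : Coef D) :
    X.coefNorm r (Coef.levelMul θ a) ≤ K * X.coefNorm r a := by
  classical
  have h := hK (univ.image fun p : TreeNode D => Cube.node p.2)
    (fun I => if h : I.1 < D then a ⟨I.1, h⟩ ((Cube.codeEquiv I.1).symm I.2) else 0)
    (fun I => if h : I.1 < D then θ ⟨I.1, h⟩ else 1)
    (fun I => by
      split_ifs
      · exact hθ _
      · exact Or.inl rfl)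
  rw [sum_image fun _ _ _ _ h => treeNode_node_injective h,
    sum_image fun _ _ _ _ h => treeNode_node_injective h] at h
  have h1 : ∀ p : TreeNode D, (if h : (Cube.node p.2).1 < D then
      a ⟨(Cube.node p.2).1, h⟩ ((Cube.codeEquiv (Cube.node p.2).1).symm (Cube.node p.2).2) else 0) =
      a p.1 p.2 := by
    intro p
    have : (Cube.node p.2).1 < D := p.1.2
    rw [dif_pos this]
    exact congrArg (a p.1) ((Cube.codeEquiv p.1).symm_apply_apply p.2)
  have h2 : ∀ p : TreeNode D, (if h : (Cube.node p.2).1 < D then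
      θ ⟨(Cube.node p.2).1, h⟩ else 1) = θ p.1 := fun p => dif_pos p.1.2
  simp only [h1, h2] at h
  rw [← hardyNorm_sum_node fun p => θ p.1 * a p.1 p.2,
    ← hardyNorm_sum_node fun p => a p.1 p.2] at h
  exact h

/-- By convexity it suffices to bound the multipliers with entries `±w`. -/
theorem coefNorm_levelMul_le_of_isUnconditional {K : ℝ} (hK : X.IsUnconditional r K)
    (c : Fin D → ℝ) {w : ℝ} (hc : ∀ k, |c k| ≤ w) (hw : 0 ≤ w) (a : Coef D) :
    X.coefNorm r (Coef.levelMul c a) ≤ K * w * X.coefNorm r a := by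
  set f : (Fin D → ℝ) → ℝ := fun c => X.coefNorm r (Coef.levelMul c a) with hf
  have hlin : ∀ (x y : ℝ) (c c' : Fin D → ℝ), Coef.levelMul (x • c + y • c') a =
      x • Coef.levelMul c a + y • Coef.levelMul c' a := by
    intro x y c c'
    funext k v
    simp only [Coef.levelMul_apply, Pi.add_apply, Pi.smul_apply, smul_eq_mul]
    ring
  have hconv : ConvexOn ℝ (convexHull ℝ (Set.univ.pi fun _ : Fin D => ({-w, w} : Set ℝ))) f := by
    refine ⟨convex_convexHull _ _, fun c _ c' _ x y hx hy _ => ?_⟩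
    simp only [hf, hlin]
    refine (coefNorm_add_le _ _).trans ?_
    rw [coefNorm_smul, coefNorm_smul, abs_of_nonneg hx, abs_of_nonneg hy]
    rfl
  have hmem : c ∈ convexHull ℝ (Set.univ.pi fun _ : Fin D => ({-w, w} : Set ℝ)) := by
    rw [convexHull_pi]
    intro k _
    rw [convexHull_pair, segment_eq_Icc (by linarith)]
    exact abs_le.1 (hc k)
  obtain ⟨y, hy, hle⟩ := hconv.exists_ge_of_mem_convexHull (subset_convexHull _ _) hmem
  refine hle.trans ?_
  have hy' : ∀ k, ∃ θ : ℝ, (θ = 1 ∨ θ = -1) ∧ y k = w * θ := by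
    intro k
    rcases hy k (Set.mem_univ k) with h | h
    · exact ⟨-1, Or.inr rfl, by rw [h]; ring⟩
    · exact ⟨1, Or.inl rfl, by rw [Set.mem_singleton_iff.1 h]; ring⟩
  choose θ hθ hyθ using hy'
  have hyeq : Coef.levelMul y a = w • Coef.levelMul θ a := by
    funext k v
    simp only [Coef.levelMul_apply, Pi.smul_apply, smul_eq_mul, hyθ]
    ring
  simp only [hf, hyeq]
  rw [coefNorm_smul, abs_of_nonneg hw]
  calc w * X.coefNorm r (Coef.levelMul θ a) ≤ w * (K * X.coefNorm r a) :=
        mul_le_mul_of_nonneg_left (coefNorm_levelMul_sign_le hK θ hθ a) hw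
    _ = K * w * X.coefNorm r a := by ring

end HaarSystemSpace

end LevelMultipliers

/-! ### Selection of levels and the factorization for coefficients -/

section Factorization

open Finset

/-- Among sufficiently many numbers of `[-Γ, Γ]` there are `n + 1` that are close to each other. -/
theorem exists_strictMono_close {D n M s : ℕ} {Γ : ℝ} (hΓ : 0 < Γ) (hM : 0 < M) (c : Fin D → ℝ)
    (hc : ∀ k, |c k| ≤ Γ) (hD : s + (M + 1) * n < D) :
    ∃ m : Fin (n + 1) → Fin D, StrictMono m ∧ (∀ i, s ≤ (m i : ℕ)) ∧
      ∀ i j, |c (m i) - c (m j)| ≤ 2 * Γ / M := by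
  classical
  have hM' : (0 : ℝ) < M := by exact_mod_cast hM
  set box : Fin D → ℕ := fun k => ⌊(c k + Γ) * M / (2 * Γ)⌋₊ with hbox
  set S : Finset (Fin D) := Finset.Ici ⟨s, by omega⟩ with hS
  have hcard : S.card = D - s := by simp [hS]
  have hmaps : ∀ k ∈ S, box k ∈ Finset.range (M + 1) := by
    intro k _
    rw [Finset.mem_range, Nat.lt_succ_iff]
    refine Nat.floor_le_of_le ?_
    rw [div_le_iff₀ (by positivity)]
    nlinarith [(abs_le.1 (hc k)).2]
  obtain ⟨b, -, hb⟩ := Finset.exists_lt_card_fiber_of_mul_lt_card_of_maps_to hmaps (n := n)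
    (by rw [Finset.card_range, hcard]; omega)
  set F := S.filter fun k => box k = b with hF
  refine ⟨F.orderEmbOfCardLe hb, (F.orderEmbOfCardLe hb).strictMono, fun i => ?_, fun i j => ?_⟩
  · have h1 := F.orderEmbOfCardLe_mem hb i
    have h2 : (⟨s, by omega⟩ : Fin D) ≤ _ := Finset.mem_Ici.1 (Finset.mem_filter.1 h1).1
    exact h2
  · have h1 := (Finset.mem_filter.1 (F.orderEmbOfCardLe_mem hb i)).2
    have h2 := (Finset.mem_filter.1 (F.orderEmbOfCardLe_mem hb j)).2
    set k := F.orderEmbOfCardLe hb i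
    set l := F.orderEmbOfCardLe hb j
    have hpos : ∀ k, 0 ≤ (c k + Γ) * M / (2 * Γ) := fun k => by
      have := (abs_le.1 (hc k)).1
      exact div_nonneg (mul_nonneg (by linarith) hM'.le) (by positivity)
    have h3 := Nat.floor_le (hpos k)
    have h4 := Nat.lt_floor_add_one ((c k + Γ) * M / (2 * Γ))
    have h5 := Nat.floor_le (hpos l)
    have h6 := Nat.lt_floor_add_one ((c l + Γ) * M / (2 * Γ))
    simp only [hbox] at h1 h2
    rw [h1] at h3 h4
    rw [h2] at h5 h6
    have h7 : |(c k + Γ) * M / (2 * Γ) - (c l + Γ) * M / (2 * Γ)| ≤ 1 := by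
      rw [abs_le]
      constructor <;> linarith
    have h8 : (c k + Γ) * M / (2 * Γ) - (c l + Γ) * M / (2 * Γ) = (c k - c l) * (M / (2 * Γ)) := by
      ring
    rw [h8, abs_mul, abs_of_pos (by positivity : (0 : ℝ) < M / (2 * Γ)),
      ← le_div_iff₀ (by positivity), one_div_div] at h7
    exact h7

namespace HaarSystemSpace

variable {X : HaarSystemSpace} {r : RademacherChoice} {D n : ℕ} {C : ℝ}

/-- The factorization in terms of coefficients. Here `L` is a bound for the norms of the level
multipliers. -/
theorem exists_coef_factorization {Γ ρ L : ℝ} (hΓ : 0 < Γ) (hρ : 0 < ρ) (hR : 1 < Γ / ρ)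
    (hmul : ∀ (c : Fin (n + 1) → ℝ) (w : ℝ), 0 ≤ w → (∀ k, |c k| ≤ w) → ∀ a : Coef (n + 1),
      X.coefNorm r (Coef.levelMul c a) ≤ L * w * X.coefNorm r a)
    {Q : ℕ} (hQ : L * (Γ / ρ) ≤ Q) (hQ2 : 1 ≤ Q) {N : ℕ}
    (hN : (42 * n * Q + 42 + ⌊4 * Real.logb 2 (Γ / ρ)⌋ : ℤ) ≤ N)
    (T : Coef (N + 1) →ₗ[ℝ] Coef (N + 1)) (hC : 0 ≤ C) (hCΓ : C ≤ Γ)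
    (hT : ∀ a, X.coefNorm r (T a) ≤ C * X.coefNorm r a) :
    ∃ (k : Fin (N + 1)) (B : Coef (n + 1) →ₗ[ℝ] Coef (N + 1))
      (A : Coef (N + 1) →ₗ[ℝ] Coef (n + 1)),
      (∀ a, X.coefNorm r (B a) ≤ X.coefNorm r a) ∧ (∀ b, X.coefNorm r (A b) ≤ X.coefNorm r b) ∧
      (∀ a, A (B a) = a) ∧
      ∀ a, X.coefNorm r (Coef.levelAverage T k • a - A (T (B a))) ≤ ρ * X.coefNorm r a := by
  set R := Γ / ρ with hRdef
  have hlog : 0 < Real.logb 2 R := Real.logb_pos (by norm_num) hR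
  set f : ℕ := ⌊Real.logb 2 R⌋₊ with hf
  set q : ℕ := 4 * n + 5 + f with hq
  -- the choice of `q` makes the random error at most `(3/4) ρ`
  have hf1 : R ≤ 2 ^ (f + 1) := by
    have h1 := (Nat.lt_floor_add_one (Real.logb 2 R)).le
    rw [Real.logb_le_iff_le_rpow (by norm_num) (by linarith)] at h1
    exact_mod_cast h1
  have hf2 : (4 * f : ℤ) ≤ ⌊4 * Real.logb 2 R⌋ := by
    rw [Int.le_floor]
    push_cast
    have := Nat.floor_le hlog.le
    linarith
  have hnQ : (n : ℤ) ≤ n * Q := by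
    have : n * 1 ≤ n * Q := Nat.mul_le_mul_left n hQ2
    rw [mul_one] at this
    exact_mod_cast this
  have hD : 4 * q + (12 * Q + 1) * n < N + 1 := by
    zify
    rw [hq]
    push_cast
    nlinarith
  obtain ⟨m, hm, hmq, hmc⟩ := exists_strictMono_close hΓ (M := 12 * Q) (by omega)
    (Coef.levelAverage T) (fun k => (abs_levelAverage_le hT k).trans hCΓ) hD
  obtain ⟨ε, hε⟩ := exists_coefNorm_conjugate_sub_le (X := X) (r := r) hm hC hT hmq
  refine ⟨m 0, (Coef.twist ε).toLinearMap ∘ₗ Coef.spread m,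
    Coef.compress m ∘ₗ (Coef.twist ε).symm.toLinearMap, fun a => ?_, fun b => ?_, fun a => ?_,
    fun a => ?_⟩
  · exact ((coefNorm_twist ε _).trans (coefNorm_spread hm a)).le
  · exact (coefNorm_compress_le hm _).trans (coefNorm_twist_symm ε b).le
  · change Coef.compress m ((Coef.twist ε).symm (Coef.twist ε (Coef.spread m a))) = a
    rw [LinearEquiv.symm_apply_apply, Coef.compress_spread hm]
  · have hp := coefNorm_nonneg (X := X) (r := r) a
    set w : ℝ := 2 * Γ / (12 * Q : ℕ) with hw
    have hQ0 : (0 : ℝ) < Q := by exact_mod_cast hQ2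
    have hw0 : 0 ≤ w := by positivity
    have h1 := hmul (fun i => Coef.levelAverage T (m 0) - Coef.levelAverage T (m i)) w hw0
      (fun i => hmc 0 i) a
    have h2 := hε a
    have h3 : Coef.levelAverage T (m 0) • a - Coef.conjugate m ε T a =
        Coef.levelMul (fun i => Coef.levelAverage T (m 0) - Coef.levelAverage T (m i)) a +
        (-1 : ℝ) • (Coef.conjugate m ε T a -
          Coef.levelMul (fun i => Coef.levelAverage T (m i)) a) := by
      funext k v
      simp only [Coef.levelMul_apply, Pi.add_apply, Pi.sub_apply, Pi.smul_apply, smul_eq_mul]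
      ring
    change X.coefNorm r (Coef.levelAverage T (m 0) • a - Coef.conjugate m ε T a) ≤ _
    rw [h3]
    refine (coefNorm_add_le _ _).trans ?_
    rw [coefNorm_smul, abs_neg, abs_one, one_mul]
    have h4 : L * w ≤ ρ / 6 := by
      rw [hw]
      push_cast
      rw [mul_div_assoc', div_le_iff₀ (by positivity)]
      have h5 : L * Γ ≤ Q * ρ := by
        have := mul_le_mul_of_nonneg_right hQ hρ.le
        rwa [hRdef, mul_assoc, div_mul_cancel₀ _ hρ.ne'] at this
      linarith
    have h5 : 12 * 16 ^ n * C / 2 ^ q ≤ 3 / 4 * ρ := by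
      have h6 : (2 : ℝ) ^ q = 16 ^ n * 16 * 2 ^ (f + 1) := by
        rw [hq, show (16 : ℝ) = 2 ^ 4 by norm_num, ← pow_mul, ← pow_add, ← pow_add]
        congr 1
        ring
      rw [h6, div_le_iff₀ (by positivity)]
      have h7 : C ≤ 2 ^ (f + 1) * ρ := by
        refine hCΓ.trans ?_
        have := mul_le_mul_of_nonneg_right hf1 hρ.le
        rwa [hRdef, div_mul_cancel₀ _ hρ.ne'] at this
      calc 12 * 16 ^ n * C ≤ 12 * 16 ^ n * (2 ^ (f + 1) * ρ) :=
            mul_le_mul_of_nonneg_left h7 (by positivity)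
        _ = 3 / 4 * ρ * (16 ^ n * 16 * 2 ^ (f + 1)) := by ring
    have h6 := mul_le_mul_of_nonneg_right h4 hp
    have h7 := mul_le_mul_of_nonneg_right h5 hp
    have h8 : 0 ≤ ρ * X.coefNorm r a := by positivity
    linarith

end HaarSystemSpace

end Factorization

/-! ### Passage to the Hardy space -/

section Transfer

open Finset
open scoped BigOperators

variable (X : HaarSystemSpace) (r : RademacherChoice) {n N : ℕ}

namespace HaarSystemSpace

theorem hardySum_mem_levelSpan (n : ℕ) (a : Coef (n + 1)) :
    (∑ p : TreeNode (n + 1), a p.1 p.2 • X.haarHardy r (Cube.node p.2)) ∈ X.levelSpan r n :=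
  Submodule.sum_mem _ fun p _ => Submodule.smul_mem _ _
    (Submodule.subset_span ⟨Cube.node p.2, Nat.lt_succ_iff.1 p.1.2, rfl⟩)

/-- The linear combination of Haar functions with given coefficients as an element of `Y_n`. -/
noncomputable def levelSum (n : ℕ) : Coef (n + 1) →ₗ[ℝ] X.levelSpan r n where
  toFun a := ⟨∑ p : TreeNode (n + 1), a p.1 p.2 • X.haarHardy r (Cube.node p.2),
    X.hardySum_mem_levelSpan r n a⟩
  map_add' a b := by
    apply Subtype.ext
    simp only [Pi.add_apply, add_smul, sum_add_distrib, Submodule.coe_add]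
  map_smul' c a := by
    apply Subtype.ext
    simp only [Pi.smul_apply, smul_eq_mul, mul_smul, smul_sum, RingHom.id_apply,
      Submodule.coe_smul]

theorem norm_levelSum (a : Coef (n + 1)) : ‖X.levelSum r n a‖ = X.coefNorm r a :=
  (hardyNorm_sum_node (X := X) (r := r) fun p : TreeNode (n + 1) => a p.1 p.2).symm

theorem levelSum_unit {k : Fin (n + 1)} (w : Cube k) :
    X.levelSum r n (Coef.unit k w) = X.levelHaar r (Cube.node w) (Nat.lt_succ_iff.1 k.2) := by
  apply Subtype.ext
  change (∑ p : TreeNode (n + 1), Coef.unit k w p.1 p.2 • X.haarHardy r (Cube.node p.2)) =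
    X.haarHardy r (Cube.node w)
  rw [Finset.sum_eq_single ⟨k, w⟩]
  · rw [Coef.unit_apply_self, if_pos rfl, one_smul]
  · rintro ⟨l, v⟩ _ h
    by_cases hl : l = k
    · subst hl
      rw [Coef.unit_apply_self, if_neg, zero_smul]
      rintro rfl
      exact h rfl
    · rw [Coef.unit_apply_of_ne hl, zero_smul]
  · simp

theorem levelSum_bijective : Function.Bijective (X.levelSum r n) := by
  constructor
  · rw [← LinearMap.ker_eq_bot, LinearMap.ker_eq_bot']
    intro a ha
    have h1 := X.norm_levelSum r a
    rw [ha, norm_zero] at h1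
    funext k K
    have h2 := abs_apply_mul_pointNorm_le (X := X) (r := r) a k K
    rw [← h1] at h2
    have h3 : |a k K| ≤ 0 := by
      by_contra h
      have := mul_pos (not_le.1 h) (pointNorm_pos (X := X) (k : ℕ))
      linarith
    exact abs_eq_zero.1 (le_antisymm h3 (abs_nonneg _))
  · have h1 : X.levelSpan r n ≤ (LinearMap.range (X.levelSum r n)).map (X.levelSpan r n).subtype := by
      refine Submodule.span_le.2 ?_
      rintro _ ⟨I, hI, rfl⟩
      obtain ⟨w, hw⟩ := Cube.exists_node I
      refine ⟨X.levelHaar r I hI, ⟨Coef.unit ⟨I.1, Nat.lt_succ_iff.2 hI⟩ w, ?_⟩, rfl⟩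
      rw [levelSum_unit]
      apply Subtype.ext
      change X.haarHardy r (Cube.node w) = X.haarHardy r I
      rw [hw]
    rintro ⟨f, hf⟩
    obtain ⟨g, ⟨a, rfl⟩, hg⟩ := h1 hf
    exact ⟨a, Subtype.ext hg⟩

/-- Haar coefficients as coordinates of `Y_n`. -/
noncomputable def levelEquiv (n : ℕ) : Coef (n + 1) ≃ₗ[ℝ] X.levelSpan r n :=
  LinearEquiv.ofBijective (X.levelSum r n) (X.levelSum_bijective r)

theorem norm_levelEquiv (a : Coef (n + 1)) : ‖X.levelEquiv r n a‖ = X.coefNorm r a :=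
  X.norm_levelSum r a

theorem coefNorm_levelEquiv_symm (f : X.levelSpan r n) :
    X.coefNorm r ((X.levelEquiv r n).symm f) = ‖f‖ := by
  rw [← norm_levelEquiv, LinearEquiv.apply_symm_apply]

theorem expect_indicator_mul_sum_term {D : ℕ} (b : Coef D) (k : Fin D) (w : Cube k) :
    𝔼 x : Cube D, (if x.trunc k = w then bitSign (x k) else 0) * ∑ j, b.term x j =
      b k w / 2 ^ (k : ℕ) := by
  simp only [mul_sum]
  rw [expect_sum_comm, sum_eq_single k]
  · have h1 : ∀ x : Cube D, (if x.trunc k = w then bitSign (x k) else 0) * b.term x k =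
        if x.trunc k = w then b k w else 0 := by
      intro x
      split_ifs with h
      · rw [Coef.term, h, mul_left_comm, bitSign_mul_self, mul_one]
      · rw [zero_mul]
    simp only [h1]
    rw [Cube.expect_trunc k fun v => if v = w then b k w else 0, Fintype.expect_eq_sum_div_card]
    simp
  · intro j _ hj
    rcases lt_or_gt_of_ne hj with h | h
    · refine expect_eq_zero_of_flip k _ fun x => ?_
      rw [Coef.term_update_of_lt _ _ h, Cube.trunc_update le_rfl, Function.update_self,
        bitSign_not]
      split_ifs <;> ring
    · refine expect_eq_zero_of_flip j _ fun x => ?_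
      rw [Coef.term_update_self, Cube.trunc_update h.le, Function.update_of_ne h.ne]
      ring
  · simp

theorem toFun_levelEquiv (b : Coef (n + 1)) {s : ℝ} (hs : s ∈ Set.Ico (0 : ℝ) 1) :
    Hardy.toFun (X.levelEquiv r n b : X.Hardy r) s = ∑ j, b.term (cell (n + 1) s) j := by
  rw [← haarSum_fun b hs, haarSum_apply, ← Fintype.sum_sigma' fun (k : Fin (n + 1)) (w : Cube k) =>
    b k w • haarVec (some (Cube.node w))]
  rfl

theorem integral_haar_mul (b : Coef (n + 1)) (k : Fin (n + 1)) (w : Cube k) :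
    ∫ s in Set.Ico (0 : ℝ) 1, (Cube.node w).haar s *
      Hardy.toFun (X.levelEquiv r n b : X.Hardy r) s = b k w / 2 ^ (k : ℕ) := by
  rw [← expect_indicator_mul_sum_term b k w, ← integral_cell fun x : Cube (n + 1) =>
    (if x.trunc k = w then bitSign (x k) else 0) * ∑ j, b.term x j]
  refine setIntegral_congr_fun measurableSet_Ico fun s hs => ?_
  rw [X.toFun_levelEquiv r b hs, haar_node hs, trunc_cell]
  rfl

variable {X r}

/-- The operator `T`, expressed in Haar coefficients. -/
noncomputable def coefMap (T : X.levelSpan r N →L[ℝ] X.levelSpan r N) :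
    Coef (N + 1) →ₗ[ℝ] Coef (N + 1) :=
  (X.levelEquiv r N).symm.toLinearMap ∘ₗ T.toLinearMap ∘ₗ (X.levelEquiv r N).toLinearMap

theorem levelEquiv_coefMap (T : X.levelSpan r N →L[ℝ] X.levelSpan r N) (a : Coef (N + 1)) :
    X.levelEquiv r N (coefMap T a) = T (X.levelEquiv r N a) :=
  LinearEquiv.apply_symm_apply _ _

theorem coefNorm_coefMap_le (T : X.levelSpan r N →L[ℝ] X.levelSpan r N) (a : Coef (N + 1)) :
    X.coefNorm r (coefMap T a) ≤ ‖T‖ * X.coefNorm r a := by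
  rw [← norm_levelEquiv, ← norm_levelEquiv, levelEquiv_coefMap]
  exact T.le_opNorm _

theorem HasLargePositiveDiagonal.le_apply {δ : ℝ} {T : X.levelSpan r N →L[ℝ] X.levelSpan r N}
    (hT : HasLargePositiveDiagonal δ T) (k : Fin (N + 1)) (w : Cube k) :
    δ ≤ coefMap T (Coef.unit k w) k w := by
  have h1 := hT (Cube.node w) (Nat.lt_succ_iff.1 k.2)
  have h2 : T (X.levelHaar r (Cube.node w) (Nat.lt_succ_iff.1 k.2)) =
      X.levelEquiv r N (coefMap T (Coef.unit k w)) := by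
    rw [levelEquiv_coefMap, ← levelSum_unit]
    rfl
  rw [h2, integral_haar_mul] at h1
  have h3 : (Cube.node w).length = 1 / 2 ^ (k : ℕ) := rfl
  rw [h3, mul_one_div] at h1
  exact (div_le_div_iff_of_pos_right (by positivity)).1 h1

theorem HasLargePositiveDiagonal.le_levelAverage {δ : ℝ}
    {T : X.levelSpan r N →L[ℝ] X.levelSpan r N} (hT : HasLargePositiveDiagonal δ T)
    (k : Fin (N + 1)) : δ ≤ Coef.levelAverage (coefMap T) k := by
  rw [Coef.levelAverage_eq_expect]
  exact le_expect univ_nonempty fun w _ => hT.le_apply k w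

/-- A factorization in terms of coefficients yields one for the operators. -/
theorem projectionallyFactors_of_coef {T : X.levelSpan r N →L[ℝ] X.levelSpan r N} {c ρ : ℝ}
    (hρ : 0 ≤ ρ) (B : Coef (n + 1) →ₗ[ℝ] Coef (N + 1)) (A : Coef (N + 1) →ₗ[ℝ] Coef (n + 1))
    (hB : ∀ a, X.coefNorm r (B a) ≤ X.coefNorm r a) (hA : ∀ b, X.coefNorm r (A b) ≤ X.coefNorm r b)
    (hAB : ∀ a, A (B a) = a)
    (hc : ∀ a, X.coefNorm r (c • a - A (coefMap T (B a))) ≤ ρ * X.coefNorm r a) :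
    ProjectionallyFactors (c • ContinuousLinearMap.id ℝ (X.levelSpan r n)) T 1 ρ := by
  set B' : X.levelSpan r n →L[ℝ] X.levelSpan r N := LinearMap.mkContinuous
    ((X.levelEquiv r N).toLinearMap ∘ₗ B ∘ₗ (X.levelEquiv r n).symm.toLinearMap) 1 (fun f => by
      change ‖X.levelEquiv r N (B ((X.levelEquiv r n).symm f))‖ ≤ _
      rw [norm_levelEquiv, one_mul, ← coefNorm_levelEquiv_symm]
      exact hB _) with hB'
  set A' : X.levelSpan r N →L[ℝ] X.levelSpan r n := LinearMap.mkContinuous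
    ((X.levelEquiv r n).toLinearMap ∘ₗ A ∘ₗ (X.levelEquiv r N).symm.toLinearMap) 1 (fun f => by
      change ‖X.levelEquiv r n (A ((X.levelEquiv r N).symm f))‖ ≤ _
      rw [norm_levelEquiv, one_mul, ← coefNorm_levelEquiv_symm]
      exact hA _) with hA'
  have hBf : ∀ f, B' f = X.levelEquiv r N (B ((X.levelEquiv r n).symm f)) := fun f => rfl
  have hAf : ∀ f, A' f = X.levelEquiv r n (A ((X.levelEquiv r N).symm f)) := fun f => rfl
  refine ⟨B', A', ?_, ?_, ?_⟩
  · exact mul_le_one₀ (LinearMap.mkContinuous_norm_le _ zero_le_one _) B'.opNorm_nonneg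
      (LinearMap.mkContinuous_norm_le _ zero_le_one _)
  · refine ContinuousLinearMap.opNorm_le_bound _ hρ fun f => ?_
    obtain ⟨a, rfl⟩ := (X.levelEquiv r n).surjective f
    have h1 : (c • ContinuousLinearMap.id ℝ (X.levelSpan r n) - A' ∘L T ∘L B')
        (X.levelEquiv r n a) = X.levelEquiv r n (c • a - A (coefMap T (B a))) := by
      change c • X.levelEquiv r n a - A' (T (B' (X.levelEquiv r n a))) = _
      rw [hBf, hAf, LinearEquiv.symm_apply_apply, ← levelEquiv_coefMap,
        LinearEquiv.symm_apply_apply, map_sub, map_smul]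
    rw [h1, norm_levelEquiv, norm_levelEquiv]
    exact hc a
  · ext1 f
    change A' (B' f) = f
    rw [hBf, hAf, LinearEquiv.symm_apply_apply, hAB, LinearEquiv.apply_symm_apply]

/-- If the bound for `T` is below the admissible error, then `c = 0` has the required property. -/
theorem projectionallyFactors_zero (hnN : n ≤ N) {T : X.levelSpan r N →L[ℝ] X.levelSpan r N}
    {ρ : ℝ} (hT : ‖T‖ ≤ ρ) :
    ProjectionallyFactors ((0 : ℝ) • ContinuousLinearMap.id ℝ (X.levelSpan r n)) T 1 ρ := by
  have hm : StrictMono (Fin.castLE (Nat.succ_le_succ hnN)) := Fin.strictMono_castLE _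
  refine projectionallyFactors_of_coef (T.opNorm_nonneg.trans hT) (Coef.spread _)
    (Coef.compress _) (fun a => (coefNorm_spread hm a).le) (fun b => coefNorm_compress_le hm b)
    (fun a => Coef.compress_spread hm a) fun a => ?_
  have h1 : ∀ b : Coef (n + 1), (0 : ℝ) • a - b = (-1 : ℝ) • b := fun b => by
    rw [zero_smul, zero_sub, neg_one_smul]
  rw [h1, coefNorm_smul, abs_neg, abs_one, one_mul]
  calc _ ≤ X.coefNorm r (coefMap T (Coef.spread _ a)) := coefNorm_compress_le hm _
    _ ≤ ‖T‖ * X.coefNorm r (Coef.spread _ a) := coefNorm_coefMap_le T _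
    _ = ‖T‖ * X.coefNorm r a := by rw [coefNorm_spread hm]
    _ ≤ ρ * X.coefNorm r a := mul_le_mul_of_nonneg_right hT (coefNorm_nonneg _)

end HaarSystemSpace

end Transfer

/-! ### The factorization theorem -/

open HaarSystemSpace

theorem proposition4p1 (X : HaarSystemSpace) (r : RademacherChoice) (Γ δ η : ℝ)
    (hΓ : 0 < Γ) (hδ : 0 < δ) (hη : 0 < η) (n N : ℕ) (hnN : n ≤ N)
    (hN : (42 * n * (n + 1) * ⌈Γ / (η * δ)⌉ + 42 + ⌊4 * Real.logb 2 (Γ / (η * δ))⌋ : ℤ) ≤ N ∨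
      ∃ K : ℝ, 1 ≤ K ∧ X.IsUnconditional r K ∧
        (42 * n * ⌈K * Γ / (η * δ)⌉ + 42 + ⌊4 * Real.logb 2 (Γ / (η * δ))⌋ : ℤ) ≤ N)
    (T : X.levelSpan r N →L[ℝ] X.levelSpan r N) (hT : ‖T‖ ≤ Γ) :
    ∃ c : ℝ, |c| ≤ ‖T‖ ∧
      ProjectionallyFactors (c • ContinuousLinearMap.id ℝ (X.levelSpan r n)) T 1 (3 * η * δ) ∧
      (HaarSystemSpace.HasLargePositiveDiagonal δ T → (1 - η) * δ ≤ c) := by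
  have hρ : 0 < η * δ := mul_pos hη hδ
  have hTc := coefNorm_coefMap_le T
  rcases le_or_gt Γ (η * δ) with hR | hR
  · refine ⟨0, abs_zero.trans_le T.opNorm_nonneg, projectionallyFactors_zero hnN (by nlinarith), fun hdiag => ?_⟩
    -- a large diagonal forces `δ ≤ ‖T‖ ≤ η δ`
    have h1 := hdiag.le_levelAverage 0
    have h2 := (le_abs_self _).trans (abs_levelAverage_le hTc 0)
    nlinarith
  · have hR1 : 1 < Γ / (η * δ) := (one_lt_div hρ).2 hR
    obtain ⟨L, Q, hL, hmul, hQ, hNQ⟩ : ∃ (L : ℝ) (Q : ℕ), 1 ≤ L ∧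
        (∀ (c : Fin (n + 1) → ℝ) (w : ℝ), 0 ≤ w → (∀ k, |c k| ≤ w) → ∀ a : Coef (n + 1),
          X.coefNorm r (Coef.levelMul c a) ≤ L * w * X.coefNorm r a) ∧ L * (Γ / (η * δ)) ≤ Q ∧
        (42 * n * Q + 42 + ⌊4 * Real.logb 2 (Γ / (η * δ))⌋ : ℤ) ≤ N := by
      rcases hN with hN | ⟨K, hK1, hK, hN⟩
      · obtain ⟨Q, hQ⟩ := Int.eq_ofNat_of_zero_le (Int.ceil_nonneg (zero_le_one.trans hR1.le))
        refine ⟨(n + 1 : ℕ), (n + 1) * Q, by push_cast; linarith [n.cast_nonneg (α := ℝ)],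
          fun c w _ hc a => coefNorm_levelMul_le_card c hc a, ?_, ?_⟩
        · have h1 := Int.le_ceil (Γ / (η * δ))
          rw [hQ] at h1
          push_cast at h1 ⊢
          exact mul_le_mul_of_nonneg_left h1 (by positivity)
        · rw [hQ] at hN
          refine le_trans (le_of_eq ?_) hN
          push_cast
          ring
      · have h0 : 0 ≤ K * Γ / (η * δ) := by positivity
        obtain ⟨Q, hQ⟩ := Int.eq_ofNat_of_zero_le (Int.ceil_nonneg h0)
        refine ⟨K, Q, hK1, fun c w hw hc a =>
          coefNorm_levelMul_le_of_isUnconditional hK c hc hw a, ?_, ?_⟩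
        · have h1 := Int.le_ceil (K * Γ / (η * δ))
          rw [hQ] at h1
          rw [← mul_div_assoc]
          exact_mod_cast h1
        · rw [hQ] at hN
          exact hN
    have hQ1 : 1 ≤ Q := by
      have : (0 : ℝ) < Q := lt_of_lt_of_le (by positivity) hQ
      exact_mod_cast this
    obtain ⟨k, B, A, hB, hA, hAB, hc⟩ := exists_coef_factorization (X := X) (r := r) hΓ hρ hR1
      hmul hQ hQ1 hNQ (coefMap T) T.opNorm_nonneg hT hTc
    refine ⟨Coef.levelAverage (coefMap T) k, abs_levelAverage_le hTc k,
      projectionallyFactors_of_coef (by positivity) B A hB hA hAB fun a => ?_, fun hdiag => ?_⟩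
    · refine (hc a).trans (mul_le_mul_of_nonneg_right ?_ (coefNorm_nonneg _))
      linarith
    · have h1 := hdiag.le_levelAverage k
      nlinarith
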